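/- Fix an integer $n\ge 2$. **Graphs.** MOY-type graphs are the oriented plane diagrams (read from bottom to top) between finite sequences of $\uparrow,\downarrow$ which are built by composition $\circ$ and tensor product $\otimes$ from vertical strands, evaluations $\mathrm{ev}$, coevaluations $\mathrm{coev}$, the wide-edge graph $S\colon\uparrow\uparrow\to\uparrow\uparrow$, an auxiliary graph $T\colon\uparrow\uparrow\uparrow\to\uparrow\uparrow\uparrow$, and their duals. Write $\mathrm{id}_k$ for $k$ upward strands. Plane isotopies (exchange of heights of distant pieces, straightening of a strand, sliding $S$ or $T$ through evaluations) are realized by distinguished invertible arrows. $\Gamma\{m\}$ denotes a graph with a formal shift $m\in\mathbb Z$, and $[m]\Gamma=\bigoplus_{j=0}^{m-1}\Gamma\{1-m+2j\}$. **Morphisms.** Morphisms between finite formal direct sums of shifted graphs are generated over $\mathbb Q$, under composition $gf$, vertical composition $g\circ f$, tensor product with strands, shifts and direct sums, by identities, the isotopy arrows, the arrows $$\chi_0\colon \mathrm{id}_2\to S\{1\},\quad \chi_1\colon S\{-1\}\to \mathrm{id}_2,\quad \epsilon\colon \mathrm{id}_1\{-1\}\to\mathrm{id}_1\{1\},\quad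 \alpha,\gamma\colon S\{-1\}\to S\{1\},$$ the invertible arrows $$\varphi,\psi\colon S\circ S\to S\{-1\}\oplus S\{1\},\qquad \lambda\colon \bigcirc\to[n]\emptyset,\qquad \mu\colon(\mathrm{ev}\otimes\mathrm{id}_1)\circ(\mathrm{id}_1^\vee\otimes S)\circ(\mathrm{coev}\otimes\mathrm{id}_1)\to[n-1]\,\mathrm{id}_1,$$ $$\nu\colon(\mathrm{id}_1\otimes\mathrm{ev}\otimes\mathrm{id}_1^\vee)\circ(S\otimes S^\vee)\circ(\mathrm{id}_1\otimes\mathrm{coev}\otimes\mathrm{id}_1^\vee)\to(\mathrm{coev}\circ\mathrm{ev})\oplus[n-2]\,(\mathrm{id}_1\otimes\mathrm{id}_1^\vee),$$ $$\eta\colon (S\otimes\mathrm{id}_1)\circ(\mathrm{id}_1\otimes S)\circ(S\otimes\mathrm{id}_1)\to (S\otimes\mathrm{id}_1)\oplus T,$$ and the reflections of all these in vertical and horizontal axes. They are subject to the axioms of a $\mathbb Q$-linear category with associative, unital, bilinear vertical composition satisfying the interchange law, compatible with tensoring by strands and with reflections, to naturality and multiplicativity of the exchange of heights, and to a set $L$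 of elementary relations (together with their reflections). Here components are numbered from $0$ in the order written. The full list is: 1. $\chi_1\chi_0=0$; $\ \alpha=(1_S\circ\chi_1)(\chi_0\circ 1_S)$; $\ (1_S\otimes1)\circ(1\otimes\chi_0)=0$ as an arrow $S\otimes\mathrm{id}_1\to(S\otimes\mathrm{id}_1)\circ(\mathrm{id}_1\otimes S)\{1\}$; 2. (moy2a) $\varphi(1_S\circ\chi_0)=\binom{1}{0}$; (moy2b) $\varphi(\chi_0\circ1_S)=\binom{1}{\alpha}$; (moy2c) $\psi(\chi_0\circ1_S)=\binom{1}{\gamma}$; (moy2d) $1_S\circ\chi_1=\varphi_1$; 3. (shift1) $\psi(1_S\circ\alpha)=\left(\begin{smallmatrix}0&1\\0&0\end{smallmatrix}\right)\varphi$; (shift2) $\varphi(1_S\circ\gamma)=\left(\begin{smallmatrix}0&1\\0&0\end{smallmatrix}\right)\psi$; 4. with $\epsilon$, $\chi_i$, $\alpha$, $\gamma$ placed inside the circle or the loop in the source of $\mu$: $\lambda_j\epsilon=\lambda_{j+1}$ for $j<n-1$ and $\lambda_{n-1}\epsilon=0$; $\mu_j\chi_0=\lambda_{j+1}\otimes1$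 for $j<n-1$; $(\lambda_j\otimes1)\chi_1=\mu_j$ for $j<n-1$ and $(\lambda_{n-1}\otimes1)\chi_1=0$; $\mu_j\alpha=0$; $\mu_j\gamma=\epsilon\mu_j$; 5. $\nu_0(\chi_0\otimes1)=0$, $\nu_{j+1}(\chi_0\otimes1)=1\otimes\mu_{j+1}$ and $(\mu_j\otimes 1)(1\otimes\chi_1)=\nu_{j+1}$ for $j<n-2$, $(\mu_{n-2}\otimes1)(1\otimes\chi_1)=0$ (with the reflected $\mu$'s); $\eta_0(\chi_0\otimes1)=\chi_1$, $\eta_1(\chi_0\otimes1)=0$ on $(S\otimes\mathrm{id}_1)\circ(\mathrm{id}_1\otimes S)$; 6. left-right reflection fixes $\chi_0,\chi_1,\epsilon,\alpha,\gamma,\varphi,\psi$, and on $\lambda$, $\nu$ the reflections in the vertical and in the horizontal axis agree. **The category.** $\mathbf{KR}=\mathbf{KR}_{n,L}$ has as objects the finite sequences of $\uparrow,\downarrow$; its morphisms $a\to b$ are bounded formal complexes of finite formal direct sums of shifted graphs with source $a$ and target $b$, modulo the equivalence relation generated by isomorphism of complexes and by cancellation of a term $N\xrightarrow{1}N$ which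 is a subcomplex or a quotient complex of the form $$\cdots\to M_{i-1}\xrightarrow{\binom{\alpha_{i-1}}{A_{i-1}}}N\oplus M_i\xrightarrow{\left(\begin{smallmatrix}1&\alpha_i\\0&A_i\end{smallmatrix}\right)}N\oplus M_{i+1}\xrightarrow{(0\ A_{i+1})}M_{i+2}\to\cdots,$$ $$\cdots\to M_{i-1}\xrightarrow{\binom{A_{i-1}}{0}}M_i\oplus N\xrightarrow{\left(\begin{smallmatrix}A_i&\alpha_i\\0&1\end{smallmatrix}\right)}M_{i+1}\oplus N\xrightarrow{(A_{i+1}\ \alpha_{i+1})}M_{i+2}\to\cdots,$$ each being identified with $\cdots\to M_i\xrightarrow{A_i}M_{i+1}\to\cdots$. Composition and tensor product are the total complexes of the termwise ones. The class $Kh_n(D)$ of an oriented tangle diagram $D$ is obtained by sending strands, evaluations and coevaluations to the corresponding graphs in degree $0$, the positive crossing to $\sigma^+=[\mathrm{id}_2\{n-1\}\xrightarrow{\chi_0}S\{n\}]$ and the negative crossing to $\sigma^-=[S\{-n\}\xrightarrow{\chi_1}\mathrm{id}_2\{1-n\}]$, with the $\mathrm{id}_2$-terms in degree $0$, and composition and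 juxtaposition of diagrams to composition and tensor product of complexes. **Theorem.** Let $L$ be the full list of relations above or, more generally, any part of it which contains (moy2a), (moy2b), (moy2c), (shift1), (shift2). Let $\sigma^m$ be the braid on two upward strands with $m$ positive crossings. Then the following sequences, with the $\mathrm{id}_2$-term in degree $0$, with first arrow $\chi_0$ and with the later arrows alternately $\alpha,\gamma,\alpha,\gamma,\dots$ beginning with $\alpha$, are complexes, and in $\mathbf{KR}_{n,L}(\uparrow\uparrow,\uparrow\uparrow)$ one has, for all $k\ge0$, $$Kh_n(\sigma^{2k+1})=\Big[\mathrm{id}_2\xrightarrow{\chi_0}S\{1\}\xrightarrow{\alpha}S\{3\}\xrightarrow{\gamma}S\{5\}\xrightarrow{\alpha}\cdots\xrightarrow{\alpha}S\{4k-1\}\xrightarrow{\gamma}S\{4k+1\}\Big]\{(n-1)(2k+1)\}$$ (for $k=0$ this is $[\mathrm{id}_2\xrightarrow{\chi_0}S\{1\}]\{n-1\}$), and, for all $k\ge1$, $$Kh_n(\sigma^{2k})=\Big[\mathrm{id}_2\xrightarrow{\chi_0}S\{1\}\xrightarrow{\alpha}S\{3\}\xrightarrow{\gamma}S\{5\}\xrightarrow{\alpha}\cdots\xrightarrow{\gamma}S\{4k-3\}\xrightarrow{\alpha}S\{4k-1\}\Big]\{2k(n-1)\}$$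 (for $k=1$ this is $[\mathrm{id}_2\xrightarrow{\chi_0}S\{1\}\xrightarrow{\alpha}S\{3\}]\{2(n-1)\}$). -/

import Mathlib

open CategoryTheory

namespace KR

/-! ## Boundary data and plane graphs of MOY type -/

/-- The two kinds of boundary points: an upgoing or a downgoing arrow (with label 1). -/
inductive Dir
  | up
  | dn
  deriving DecidableEq

/-- Reversal of an arrow. -/
def Dir.flip : Dir → Dir
  | .up => .dn
  | .dn => .up

/-- The elementary pieces of MOY-type graphs, for both orientations.
`cap o` is the evaluation with source `o, o.flip`; `cup o` is the coevaluation with target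
`o, o.flip`; `S o` is the wide-edge (label 2) graph on two strands, `T o` the auxiliary graph on
three strands. -/
inductive Piece
  | cap (o : Dir)
  | cup (o : Dir)
  | S (o : Dir)
  | T (o : Dir)

namespace Piece

/-- Source (bottom boundary) of a piece. -/
def src : Piece → List Dir
  | cap o => [o, o.flip]
  | cup _ => []
  | S o => [o, o]
  | T o => [o, o, o]

/-- Target (top boundary) of a piece. -/
def tgt : Piece → List Dir
  | cap _ => []
  | cup o => [o, o.flip]
  | S o => [o, o]
  | T o => [o, o, o]

/-- Reflection of a piece in a vertical axis (left and right are exchanged). -/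
def hrefl : Piece → Piece
  | cap o => cap o.flip
  | cup o => cup o.flip
  | S o => S o
  | T o => T o

/-- Reflection of a piece in a horizontal axis (top and bottom are exchanged). -/
def vrefl : Piece → Piece
  | cap o => cup o.flip
  | cup o => cap o.flip
  | S o => S o.flip
  | T o => T o.flip

end Piece

/-- A horizontal layer `id_left ⊗ piece ⊗ id_right` of a plane graph. -/
structure Layer where
  left : List Dir
  piece : Piece
  right : List Dir

namespace Layer

def src (t : Layer) : List Dir := t.left ++ t.piece.src ++ t.right

def tgt (t : Layer) : List Dir := t.left ++ t.piece.tgt ++ t.right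

/-- Juxtaposition with vertical strands on both sides. -/
def strands (l r : List Dir) (t : Layer) : Layer := ⟨l ++ t.left, t.piece, t.right ++ r⟩

def hrefl (t : Layer) : Layer := ⟨t.right.reverse, t.piece.hrefl, t.left.reverse⟩

def vrefl (t : Layer) : Layer := ⟨t.left.map Dir.flip, t.piece.vrefl, t.right.map Dir.flip⟩

end Layer

/-- `Stack a ts b`: the layers `ts`, listed from top to bottom, can be glued to a graph with
source `a` and target `b`. -/
def Stack (a : List Dir) : List Layer → List Dir → Prop
  | [], b => a = b
  | t :: ts, b => t.tgt = b ∧ Stack a ts t.src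

/-- A MOY-type graph: a plane diagram cut into horizontal layers, each of which contains
exactly one elementary piece. The layers are listed from top to bottom; the identity graphs have no
layers. -/
@[ext] structure Graph where
  src : List Dir
  tgt : List Dir
  layers : List Layer
  ok : Stack src layers tgt

theorem Stack.append {a b c : List Dir} {ss ts : List Layer} (h₁ : Stack b ss c)
    (h₂ : Stack a ts b) : Stack a (ss ++ ts) c := by
  induction ss generalizing c with
  | nil => cases h₁; exact h₂
  | cons t ss ih => exact ⟨h₁.1, ih h₁.2⟩

theorem Stack.strands {a b : List Dir} {ts : List Layer} (l r : List Dir) (h : Stack a ts b) :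
    Stack (l ++ a ++ r) (ts.map (Layer.strands l r)) (l ++ b ++ r) := by
  induction ts generalizing b with
  | nil => cases h; rfl
  | cons t ts ih =>
    obtain ⟨rfl, h₂⟩ := h
    refine ⟨by simp [Layer.strands, Layer.tgt], ?_⟩
    have := ih h₂
    simpa [Layer.strands, Layer.src] using this

theorem Stack.hrefl {a b : List Dir} {ts : List Layer} (h : Stack a ts b) :
    Stack a.reverse (ts.map Layer.hrefl) b.reverse := by
  induction ts generalizing b with
  | nil => cases h; rfl
  | cons t ts ih =>
    obtain ⟨rfl, h₂⟩ := h
    have key : ∀ t : Layer, t.hrefl.tgt = t.tgt.reverse ∧ t.hrefl.src = t.src.reverse := by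
      rintro ⟨l, p, r⟩
      cases p with
      | cap o => cases o <;>
          simp [Layer.hrefl, Layer.tgt, Layer.src, Piece.hrefl, Piece.src, Piece.tgt, Dir.flip]
      | cup o => cases o <;>
          simp [Layer.hrefl, Layer.tgt, Layer.src, Piece.hrefl, Piece.src, Piece.tgt, Dir.flip]
      | S o => simp [Layer.hrefl, Layer.tgt, Layer.src, Piece.hrefl, Piece.src, Piece.tgt]
      | T o => simp [Layer.hrefl, Layer.tgt, Layer.src, Piece.hrefl, Piece.src, Piece.tgt]
    refine ⟨(key t).1, ?_⟩
    rw [(key t).2]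
    exact ih h₂

theorem Layer.vrefl_src_tgt (t : Layer) :
    t.vrefl.tgt = t.src.map Dir.flip ∧ t.vrefl.src = t.tgt.map Dir.flip := by
  obtain ⟨l, p, r⟩ := t
  cases p <;> simp [Layer.vrefl, Layer.tgt, Layer.src, Piece.vrefl, Piece.src, Piece.tgt]

theorem Stack.vrefl {a b : List Dir} {ts : List Layer} (h : Stack a ts b) :
    Stack (b.map Dir.flip) (ts.map Layer.vrefl).reverse (a.map Dir.flip) := by
  induction ts generalizing b with
  | nil => cases h; rfl
  | cons t ts ih =>
    obtain ⟨rfl, h₂⟩ := h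
    rw [List.map_cons, List.reverse_cons]
    refine Stack.append (ih h₂) ⟨(Layer.vrefl_src_tgt t).1, ?_⟩
    exact (Layer.vrefl_src_tgt t).2.symm

namespace Graph

/-- Vertical strands: the identity graph of a sequence of arrows. -/
def id (a : List Dir) : Graph := ⟨a, a, [], rfl⟩

/-- The graph with one layer. -/
def layer (t : Layer) : Graph := ⟨t.src, t.tgt, [t], rfl, rfl⟩

/-- `comp Ψ Γ` is the composition `Ψ ∘ Γ`: `Ψ` is glued on top of `Γ`. -/
def comp (Ψ Γ : Graph) (h : Ψ.src = Γ.tgt) : Graph :=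
  ⟨Γ.src, Ψ.tgt, Ψ.layers ++ Γ.layers, Stack.append Ψ.ok (h ▸ Γ.ok)⟩

/-- `id_l ⊗ Γ ⊗ id_r`. -/
def strands (l r : List Dir) (Γ : Graph) : Graph :=
  ⟨l ++ Γ.src ++ r, l ++ Γ.tgt ++ r, Γ.layers.map (Layer.strands l r), Γ.ok.strands l r⟩

/-- The tensor product `Γ ⊗ Δ = (Γ ⊗ id) ∘ (id ⊗ Δ)`. -/
def tens (Γ Δ : Graph) : Graph :=
  comp (strands [] Δ.tgt Γ) (strands Γ.src [] Δ) (by simp [strands])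

/-- The same plane graph as `tens Γ Δ`, up to the heights of the pieces:
`(id ⊗ Δ) ∘ (Γ ⊗ id)`. -/
def tens' (Γ Δ : Graph) : Graph :=
  comp (strands Γ.tgt [] Δ) (strands [] Δ.src Γ) (by simp [strands])

/-- Reflection in a vertical axis. -/
def hrefl (Γ : Graph) : Graph :=
  ⟨Γ.src.reverse, Γ.tgt.reverse, Γ.layers.map Layer.hrefl, Γ.ok.hrefl⟩

/-- Reflection in a horizontal axis. -/
def vrefl (Γ : Graph) : Graph :=
  ⟨Γ.tgt.map Dir.flip, Γ.src.map Dir.flip, (Γ.layers.map Layer.vrefl).reverse, Γ.ok.vrefl⟩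

/-- The wide-edge graph on two strands. -/
def S (o : Dir) : Graph := layer ⟨[], .S o, []⟩

/-- The auxiliary graph on three strands. -/
def T (o : Dir) : Graph := layer ⟨[], .T o, []⟩

/-- `ev ∘ coev`: an oriented circle. -/
def circle : Graph :=
  ⟨[], [], [⟨[], .cap .dn, []⟩, ⟨[], .cup .dn, []⟩], rfl, rfl, rfl⟩

/-- `(ev ⊗ id) ∘ (id ⊗ S) ∘ (coev ⊗ id)`: a strand with a digon-like loop on its left. -/
def curl : Graph :=
  ⟨[.up], [.up], [⟨[], .cap .dn, [.up]⟩, ⟨[.dn], .S .up, []⟩, ⟨[], .cup .dn, [.up]⟩],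
    rfl, rfl, rfl, rfl⟩

/-- `(id ⊗ ev ⊗ id) ∘ (S ⊗ S^∨) ∘ (id ⊗ coev ⊗ id)`. -/
def square : Graph :=
  ⟨[.up, .dn], [.up, .dn],
    [⟨[.up], .cap .up, [.dn]⟩, ⟨[], .S .up, [.dn, .dn]⟩, ⟨[.up, .up], .S .dn, []⟩,
      ⟨[.up], .cup .up, [.dn]⟩], rfl, rfl, rfl, rfl, rfl⟩

/-- `coev ∘ ev`. -/
def cupCap : Graph :=
  ⟨[.up, .dn], [.up, .dn], [⟨[], .cup .up, []⟩, ⟨[], .cap .up, []⟩], rfl, rfl, rfl⟩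

/-- `S ∘ S`. -/
def SS : Graph := comp (S .up) (S .up) rfl

/-- `S ⊗ id₁`. -/
def SI : Graph := strands [] [.up] (S .up)

/-- `id₁ ⊗ S`. -/
def IS : Graph := strands [.up] [] (S .up)

/-- `(S ⊗ id₁) ∘ (id₁ ⊗ S) ∘ (S ⊗ id₁)`. -/
def triple : Graph := comp (comp SI IS rfl) SI rfl

/-- A strand with a zigzag. -/
def zigzag : Graph :=
  ⟨[.up], [.up], [⟨[], .cap .up, [.up]⟩, ⟨[.up], .cup .dn, []⟩], rfl, rfl, rfl⟩

/-- Two nested evaluations. -/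
def cap₂ : Graph :=
  ⟨[.dn, .dn, .up, .up], [], [⟨[], .cap .dn, []⟩, ⟨[.dn], .cap .dn, [.up]⟩], rfl, rfl, rfl⟩

/-- Three nested evaluations. -/
def cap₃ : Graph :=
  ⟨[.dn, .dn, .dn, .up, .up, .up], [],
    [⟨[], .cap .dn, []⟩, ⟨[.dn], .cap .dn, [.up]⟩, ⟨[.dn, .dn], .cap .dn, [.up, .up]⟩],
    rfl, rfl, rfl, rfl⟩

end Graph

open KR.Graph (circle curl square cupCap SS SI IS triple cap₂ cap₃ layer S T)

/-! ## Elementary morphisms -/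

/-- The distinguished invertible arrows from a graph to a formal direct sum of shifted graphs.
The arrows `exch`, `zigzag`, `slideS`, `slideT` realize the elementary plane isotopies: change of
heights of distant pieces, straightening of a strand, sliding a piece through evaluations. -/
inductive Splitting
  | lam
  | mu
  | phi
  | psi
  | nu
  | eta
  | exch (Γ Δ : Graph)
  | zigzag
  | slideS
  | slideT

namespace Splitting

/-- The graph on which the invertible arrow starts. -/
def source : Splitting → Graph
  | lam => circle
  | mu => curl
  | phi => SS
  | psi => SS
  | nu => square
  | eta => triple
  | exch Γ Δ => Graph.tens Γ Δ
  | zigzag => Graph.zigzag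
  | slideS => Graph.comp cap₂ (Graph.strands [.dn, .dn] [] (S .up)) rfl
  | slideT => Graph.comp cap₃ (Graph.strands [.dn, .dn, .dn] [] (T .up)) rfl

/-- The number of summands of the target. -/
def count (n : ℕ) : Splitting → ℕ
  | lam => n
  | mu => n - 1
  | phi => 2
  | psi => 2
  | nu => n - 2 + 1
  | eta => 2
  | _ => 1

/-- The `j`-th summand of the target, without its shift. -/
def target : Splitting → ℕ → Graph
  | lam, _ => Graph.id []
  | mu, _ => Graph.id [.up]
  | phi, _ => S .up
  | psi, _ => S .up
  | nu, 0 => cupCap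
  | nu, _ + 1 => Graph.id [.up, .dn]
  | eta, 0 => SI
  | eta, _ + 1 => T .up
  | exch Γ Δ, _ => Graph.tens' Γ Δ
  | zigzag, _ => Graph.id [.up]
  | slideS, _ => Graph.comp cap₂ (Graph.strands [] [.up, .up] (S .dn)) rfl
  | slideT, _ => Graph.comp cap₃ (Graph.strands [] [.up, .up, .up] (T .dn)) rfl

/-- The shift of the `j`-th summand of the target; the summands of `[m] Γ` are the graphs
`Γ{1 - m + 2 j}` with `0 ≤ j < m`. -/
def shift (n : ℕ) : Splitting → ℕ → ℤ
  | lam, j => 1 - n + 2 * j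
  | mu, j => 1 - (n - 1) + 2 * j
  | phi, j => -1 + 2 * j
  | psi, j => -1 + 2 * j
  | nu, 0 => 0
  | nu, j + 1 => 1 - (n - 2) + 2 * j
  | _, _ => 0

end Splitting

/-- The elementary arrows. An element of `Gen n Γ Δ d` stands for the arrows
`Γ{m} → Δ{m + d}`, for all `m`. An invertible arrow to a direct sum is given by its components
`proj`, its inverse by the components `incl`. Reflected arrows are added below. -/
inductive Gen (n : ℕ) : Graph → Graph → ℤ → Type
  | chi0 : Gen n (Graph.id [.up, .up]) (S .up) 1
  | chi1 : Gen n (S .up) (Graph.id [.up, .up]) 1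
  | eps : Gen n (Graph.id [.up]) (Graph.id [.up]) 2
  | alpha : Gen n (S .up) (S .up) 2
  | gamma : Gen n (S .up) (S .up) 2
  | proj (D : Splitting) (j : Fin (D.count n)) : Gen n D.source (D.target j) (D.shift n j)
  | incl (D : Splitting) (j : Fin (D.count n)) : Gen n (D.target j) D.source (-D.shift n j)

/-- Formal expressions for morphisms: an element of `Raw n Γ Δ d` stands for the morphisms
`Γ{m} → Δ{m + d}`, for all `m`. They are built from the elementary arrows by identities, linear
combinations, (horizontal) composition `comp g f = g f`, vertical composition
`vcomp g f = g ∘ f`, tensor product with identities of vertical strands, and the two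
reflections. -/
inductive Raw (n : ℕ) : Graph → Graph → ℤ → Type
  | one (Γ : Graph) {d : ℤ} (h : d = 0) : Raw n Γ Γ d
  | gen {Γ Δ : Graph} {d e : ℤ} (g : Gen n Γ Δ e) (h : d = e) : Raw n Γ Δ d
  | zero (Γ Δ : Graph) (d : ℤ) : Raw n Γ Δ d
  | add {Γ Δ : Graph} {d : ℤ} (f g : Raw n Γ Δ d) : Raw n Γ Δ d
  | smul {Γ Δ : Graph} {d : ℤ} (q : ℚ) (f : Raw n Γ Δ d) : Raw n Γ Δ d
  | comp {Γ Δ Ξ : Graph} {d e k : ℤ} (g : Raw n Δ Ξ e) (f : Raw n Γ Δ d) (h : k = d + e) :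
      Raw n Γ Ξ k
  | vcomp {Ψ Ψ' Γ Γ' : Graph} {d e k : ℤ} (g : Raw n Ψ Ψ' d) (f : Raw n Γ Γ' e)
      (c : Ψ.src = Γ.tgt) (c' : Ψ'.src = Γ'.tgt) (h : k = d + e) :
      Raw n (Graph.comp Ψ Γ c) (Graph.comp Ψ' Γ' c') k
  | strands (l r : List Dir) {Γ Δ : Graph} {d : ℤ} (f : Raw n Γ Δ d) :
      Raw n (Graph.strands l r Γ) (Graph.strands l r Δ) d
  | hrefl {Γ Δ : Graph} {d : ℤ} (f : Raw n Γ Δ d) : Raw n Γ.hrefl Δ.hrefl d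
  | vrefl {Γ Δ : Graph} {d : ℤ} (f : Raw n Γ Δ d) : Raw n Γ.vrefl Δ.vrefl d

namespace Raw

variable {n : ℕ}

/-- Transport along equalities of graphs. -/
def cast {Γ Γ' Δ Δ' : Graph} {d : ℤ} (h : Γ = Γ') (h' : Δ = Δ') (f : Raw n Γ Δ d) :
    Raw n Γ' Δ' d :=
  h ▸ h' ▸ f

/-- A finite sum. -/
def sum {Γ Δ : Graph} {d : ℤ} (fs : List (Raw n Γ Δ d)) : Raw n Γ Δ d :=
  fs.foldr add (zero Γ Δ d)

def chi0 : Raw n (Graph.id [.up, .up]) (S .up) 1 := gen .chi0 rfl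

def chi1 : Raw n (S .up) (Graph.id [.up, .up]) 1 := gen .chi1 rfl

def eps : Raw n (Graph.id [.up]) (Graph.id [.up]) 2 := gen .eps rfl

def alpha : Raw n (S .up) (S .up) 2 := gen .alpha rfl

def gamma : Raw n (S .up) (S .up) 2 := gen .gamma rfl

/-- The `j`-th component of an invertible arrow. -/
def proj (D : Splitting) (j : ℕ) (hj : j < D.count n) {d : ℤ} (h : d = D.shift n j) :
    Raw n D.source (D.target j) d :=
  gen (.proj D ⟨j, hj⟩) h

/-- The `j`-th component of the inverse of an invertible arrow. -/
def incl (D : Splitting) (j : ℕ) (hj : j < D.count n) {d : ℤ} (h : d = -D.shift n j) :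
    Raw n (D.target j) D.source d :=
  gen (.incl D ⟨j, hj⟩) h

/-- `1_Θ ∘ f ∘ 1_Φ`. -/
def inside (Θ Φ : Graph) {Γ Δ : Graph} {d : ℤ} (f : Raw n Γ Δ d) (h₁ : Γ.src = Φ.tgt)
    (h₂ : Θ.src = Γ.tgt) (h₃ : Δ.src = Φ.tgt) (h₄ : Θ.src = Δ.tgt) :
    Raw n (Graph.comp Θ (Graph.comp Γ Φ h₁) h₂) (Graph.comp Θ (Graph.comp Δ Φ h₃) h₄) d :=
  vcomp (one Θ rfl) (vcomp f (one Φ rfl) h₁ h₃ (add_zero d).symm) h₂ h₄ (zero_add d).symm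

/-- `f ⊗ g = (f ⊗ 1) ∘ (1 ⊗ g)`. -/
def tens {Γ Γ' Δ Δ' : Graph} {d e k : ℤ} (f : Raw n Γ Γ' d) (g : Raw n Δ Δ' e)
    (hs : Γ.src = Γ'.src) (ht : Δ.tgt = Δ'.tgt) (h : k = d + e) :
    Raw n (Graph.tens Γ Δ) (Graph.tens Γ' Δ') k :=
  cast rfl (by simp only [Graph.tens, hs, ht])
    (vcomp (strands [] Δ.tgt f) (strands Γ.src [] g) (by simp [Graph.strands])
      (by simp [Graph.strands, hs, ht]) h)

/-- `(1 ⊗ g) ∘ (f ⊗ 1)`. -/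
def tens' {Γ Γ' Δ Δ' : Graph} {d e k : ℤ} (f : Raw n Γ Γ' d) (g : Raw n Δ Δ' e)
    (hs : Δ.src = Δ'.src) (ht : Γ.tgt = Γ'.tgt) (h : k = e + d) :
    Raw n (Graph.tens' Γ Δ) (Graph.tens' Γ' Δ') k :=
  cast rfl (by simp only [Graph.tens', hs, ht])
    (vcomp (strands Γ.tgt [] g) (strands [] Δ.src f) (by simp [Graph.strands])
      (by simp [Graph.strands, hs, ht]) h)

/-- The arrow which exchanges the heights of two graphs next to each other. -/
def exch (Γ Δ : Graph) : Raw n (Graph.tens Γ Δ) (Graph.tens' Γ Δ) 0 :=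
  proj (.exch Γ Δ) 0 Nat.one_pos rfl

/-- The inverse of `exch`. -/
def exchInv (Γ Δ : Graph) : Raw n (Graph.tens' Γ Δ) (Graph.tens Γ Δ) 0 :=
  incl (.exch Γ Δ) 0 Nat.one_pos rfl

/-! Some composites in which vertical strands at the top or at the bottom of a graph are omitted. -/

/-- `1_S ∘ χ₀`. -/
def oneChi0 : Raw n (S .up) SS 1 := cast rfl rfl (vcomp (one (S .up) rfl) chi0 rfl rfl rfl)

/-- `χ₀ ∘ 1_S`. -/
def chi0One : Raw n (S .up) SS 1 := cast rfl rfl (vcomp chi0 (one (S .up) rfl) rfl rfl rfl)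

/-- `1_S ∘ χ₁`. -/
def oneChi1 : Raw n SS (S .up) 1 := cast rfl rfl (vcomp (one (S .up) rfl) chi1 rfl rfl rfl)

/-- `1_S ∘ α`. -/
def oneAlpha : Raw n SS SS 2 := vcomp (one (S .up) rfl) alpha rfl rfl rfl

/-- `1_S ∘ γ`. -/
def oneGamma : Raw n SS SS 2 := vcomp (one (S .up) rfl) gamma rfl rfl rfl

/-- The arrow `ε` on the right side of a circle. -/
def epsCircle : Raw n circle circle 2 :=
  cast rfl rfl (inside (layer ⟨[], .cap .dn, []⟩) (layer ⟨[], .cup .dn, []⟩)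
    (strands [.dn] [] eps) rfl rfl rfl rfl)

/-- `1 ⊗ χ₀` from a circle next to a strand to the curl. -/
def curlChi0 : Raw n (Graph.strands [] [.up] circle) curl 1 :=
  cast rfl rfl (inside (layer ⟨[], .cap .dn, [.up]⟩) (layer ⟨[], .cup .dn, [.up]⟩)
    (strands [.dn] [] chi0) rfl rfl rfl rfl)

/-- `1 ⊗ χ₁` from the curl to a circle next to a strand. -/
def curlChi1 : Raw n curl (Graph.strands [] [.up] circle) 1 :=
  cast rfl rfl (inside (layer ⟨[], .cap .dn, [.up]⟩) (layer ⟨[], .cup .dn, [.up]⟩)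
    (strands [.dn] [] chi1) rfl rfl rfl rfl)

def curlAlpha : Raw n curl curl 2 :=
  cast rfl rfl (inside (layer ⟨[], .cap .dn, [.up]⟩) (layer ⟨[], .cup .dn, [.up]⟩)
    (strands [.dn] [] alpha) rfl rfl rfl rfl)

def curlGamma : Raw n curl curl 2 :=
  cast rfl rfl (inside (layer ⟨[], .cap .dn, [.up]⟩) (layer ⟨[], .cup .dn, [.up]⟩)
    (strands [.dn] [] gamma) rfl rfl rfl rfl)

/-- The arrow `χ₀ ⊗ 1` which creates the left wide edge of the square. -/
def squareChi0 : Raw n (Graph.strands [.up] [] curl.vrefl) square 1 :=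
  cast rfl rfl (inside (layer ⟨[.up], .cap .up, [.dn]⟩)
    (Graph.comp (layer ⟨[.up, .up], .S .dn, []⟩) (layer ⟨[.up], .cup .up, [.dn]⟩) rfl)
    (strands [] [.dn, .dn] chi0) rfl rfl rfl rfl)

/-- The arrow `1 ⊗ χ₁` which removes the right wide edge of the square. -/
def squareChi1 : Raw n square (Graph.strands [] [.dn] curl.hrefl) 1 :=
  cast rfl rfl (inside
    (Graph.comp (layer ⟨[.up], .cap .up, [.dn]⟩) (layer ⟨[], .S .up, [.dn, .dn]⟩) rfl)
    (layer ⟨[.up], .cup .up, [.dn]⟩) (strands [.up, .up] [] (vrefl chi1)) rfl rfl rfl rfl)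

/-- `(1 ⊗ 1) ∘ (1 ⊗ 1) ∘ (χ₀ ⊗ 1)`. -/
def tripleChi0 : Raw n (Graph.comp SI IS rfl) triple 1 :=
  cast rfl rfl (vcomp (one (Graph.comp SI IS rfl) rfl) (strands [] [.up] chi0) rfl rfl rfl)

/-- `(1 ⊗ 1) ∘ (1 ⊗ χ₁)`. -/
def siChi1 : Raw n (Graph.comp SI IS rfl) SI 1 :=
  cast rfl rfl (vcomp (one SI rfl) (strands [.up] [] chi1) rfl rfl rfl)

/-- `(1 ⊗ 1) ∘ (1 ⊗ χ₀)`. -/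
def siChi0 : Raw n SI (Graph.comp SI IS rfl) 1 :=
  cast rfl rfl (vcomp (one SI rfl) (strands [.up] [] chi0) rfl rfl rfl)

/-- The composition of an arrow with the `j`-th component of an invertible arrow. -/
def projComp (D : Splitting) (j : ℕ) (hj : j < D.count n) {Γ : Graph} {d k : ℤ}
    (f : Raw n Γ D.source d) (h : k = d + D.shift n j) : Raw n Γ (D.target j) k :=
  comp (proj D j hj rfl) f h

end Raw

/-! ## Relations -/

/-- Names of the families of relations between the elementary arrows. -/
inductive RelName
  | chi1chi0
  | moyEps
  | moyChi0
  | moyChi1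
  | alphaDef
  | moyChi0a
  | moyChi0b
  | moy2a
  | moy2b
  | moyz
  | moy2c
  | shift1
  | shift2
  | moy2d
  | moyNu1
  | moyNu2
  | moyEta
  | symmetry
  deriving DecidableEq

/-- The relations which describe `S ∘ S` and the arrows `1_S ∘ χ₀`, `χ₀ ∘ 1_S`, `1_S ∘ α`, `1_S ∘ γ`. The
set of all relations is `Set.univ`. -/
def coreRelations : Set RelName := {.moy2a, .moy2b, .moy2c, .shift1, .shift2}

open Raw in
/-- The relations between the elementary arrows. Diagrams are written out in components. The
relations for reflected arrows follow, since `Raw.hrefl` and `Raw.vrefl` respect relations. -/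
inductive ElementaryRel (n : ℕ) :
    RelName → ∀ {Γ Δ : Graph} {d : ℤ}, Raw n Γ Δ d → Raw n Γ Δ d → Prop
  | chi1chi0 : ElementaryRel n .chi1chi0 (comp chi1 chi0 (k := 2) rfl) (zero _ _ 2)
  | moyEps (j : ℕ) (h : j + 1 < n) (k : ℤ) (e e') :
      ElementaryRel n .moyEps (projComp .lam j (Nat.lt_of_succ_lt h) epsCircle (k := k) e)
        (proj .lam (j + 1) h e')
  | moyEps_last (j : ℕ) (h : j + 1 = n) (k : ℤ) (e) :
      ElementaryRel n .moyEps (projComp .lam j (h ▸ Nat.lt_succ_self j) epsCircle (k := k) e)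
        (zero _ _ k)
  | moyChi0 (j : ℕ) (h : j < n - 1) (k : ℤ) (e e') :
      ElementaryRel n .moyChi0 (projComp .mu j h curlChi0 (k := k) e)
        (strands [] [.up] (proj .lam (j + 1) (Nat.add_lt_of_lt_sub h) e'))
  | moyChi1 (j : ℕ) (h : j < n - 1) (hj : j < n) (k d : ℤ) (e e' e'') :
      ElementaryRel n .moyChi1
        (comp (strands [] [.up] (proj .lam j hj (d := d) e)) curlChi1 (k := k) e')
        (proj .mu j h e'')
  | moyChi1_last (j : ℕ) (h : j + 1 = n) (hj : j < n) (k d : ℤ) (e e') :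
      ElementaryRel n .moyChi1
        (comp (strands [] [.up] (proj .lam j hj (d := d) e)) curlChi1 (k := k) e')
        (zero _ _ k)
  | alphaDef : ElementaryRel n .alphaDef alpha (comp oneChi1 chi0One rfl)
  | moyChi0a (j : ℕ) (h : j < n - 1) (k : ℤ) (e) :
      ElementaryRel n .moyChi0a (projComp .mu j h curlAlpha (k := k) e) (zero _ _ k)
  | moyChi0b (j : ℕ) (h : j < n - 1) (k d : ℤ) (e e' e'') :
      ElementaryRel n .moyChi0b (projComp .mu j h curlGamma (k := k) e)
        (comp eps (proj .mu j h (d := d) e') e'')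
  | moy2a_zero : ElementaryRel n .moy2a
      (projComp .phi 0 Nat.zero_lt_two oneChi0 (k := 0) rfl) (one (S .up) rfl)
  | moy2a_one : ElementaryRel n .moy2a
      (projComp .phi 1 Nat.one_lt_two oneChi0 (k := 2) rfl) (zero _ _ 2)
  | moy2b_zero : ElementaryRel n .moy2b
      (projComp .phi 0 Nat.zero_lt_two chi0One (k := 0) rfl) (one (S .up) rfl)
  | moy2b_one : ElementaryRel n .moy2b
      (projComp .phi 1 Nat.one_lt_two chi0One (k := 2) rfl) alpha
  | moyz : ElementaryRel n .moyz siChi0 (zero _ _ 1)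
  | moy2c_zero : ElementaryRel n .moy2c
      (projComp .psi 0 Nat.zero_lt_two chi0One (k := 0) rfl) (one (S .up) rfl)
  | moy2c_one : ElementaryRel n .moy2c
      (projComp .psi 1 Nat.one_lt_two chi0One (k := 2) rfl) gamma
  | shift1_zero : ElementaryRel n .shift1
      (projComp .psi 0 Nat.zero_lt_two oneAlpha (k := 1) rfl)
      (proj .phi 1 Nat.one_lt_two rfl)
  | shift1_one : ElementaryRel n .shift1
      (projComp .psi 1 Nat.one_lt_two oneAlpha (k := 3) rfl) (zero _ _ 3)
  | shift2_zero : ElementaryRel n .shift2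
      (projComp .phi 0 Nat.zero_lt_two oneGamma (k := 1) rfl)
      (proj .psi 1 Nat.one_lt_two rfl)
  | shift2_one : ElementaryRel n .shift2
      (projComp .phi 1 Nat.one_lt_two oneGamma (k := 3) rfl) (zero _ _ 3)
  | moy2d : ElementaryRel n .moy2d oneChi1 (proj .phi 1 Nat.one_lt_two rfl)
  | moyNu1_zero (k : ℤ) (e) :
      ElementaryRel n .moyNu1 (projComp .nu 0 (Nat.succ_pos _) squareChi0 (k := k) e) (zero _ _ k)
  | moyNu1 (j : ℕ) (h : j + 1 < n - 2 + 1) (h' : j + 1 < n - 1) (k : ℤ) (e e') :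
      ElementaryRel n .moyNu1 (projComp .nu (j + 1) h squareChi0 (k := k) e)
        (cast rfl rfl (strands [.up] [] (vrefl (proj .mu (j + 1) h' e'))))
  | moyNu2 (j : ℕ) (h : j + 1 < n - 2 + 1) (h' : j < n - 1) (k d : ℤ) (e e' e'') :
      ElementaryRel n .moyNu2
        (comp (cast rfl rfl (strands [] [.dn] (hrefl (proj .mu j h' (d := d) e)))) squareChi1
          (k := k) e')
        (proj .nu (j + 1) h e'')
  | moyNu2_last (j : ℕ) (h : j + 1 = n - 1) (h' : j < n - 1) (k d : ℤ) (e e') :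
      ElementaryRel n .moyNu2
        (comp (strands [] [.dn] (hrefl (proj .mu j h' (d := d) e))) squareChi1 (k := k) e')
        (zero _ _ k)
  | moyEta_zero : ElementaryRel n .moyEta
      (projComp .eta 0 Nat.zero_lt_two tripleChi0 (k := 1) rfl) siChi1
  | moyEta_one : ElementaryRel n .moyEta
      (projComp .eta 1 Nat.one_lt_two tripleChi0 (k := 1) rfl) (zero _ _ 1)
  | hrefl_chi0 : ElementaryRel n .symmetry (cast rfl rfl (hrefl chi0)) chi0
  | hrefl_chi1 : ElementaryRel n .symmetry (cast rfl rfl (hrefl chi1)) chi1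
  | hrefl_eps : ElementaryRel n .symmetry (cast rfl rfl (hrefl eps)) eps
  | hrefl_alpha : ElementaryRel n .symmetry (cast rfl rfl (hrefl alpha)) alpha
  | hrefl_gamma : ElementaryRel n .symmetry (cast rfl rfl (hrefl gamma)) gamma
  | hrefl_phi (j : ℕ) (h : j < 2) (k : ℤ) (e) :
      ElementaryRel n .symmetry (cast rfl rfl (hrefl (proj .phi j h (d := k) e))) (proj .phi j h e)
  | hrefl_psi (j : ℕ) (h : j < 2) (k : ℤ) (e) :
      ElementaryRel n .symmetry (cast rfl rfl (hrefl (proj .psi j h (d := k) e))) (proj .psi j h e)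
  | hrefl_lam (j : ℕ) (h : j < n) (k : ℤ) (e) :
      ElementaryRel n .symmetry (cast rfl rfl (hrefl (proj .lam j h (d := k) e)))
        (vrefl (proj .lam j h e))
  | hrefl_nu_zero (h) (k : ℤ) (e) :
      ElementaryRel n .symmetry (cast rfl rfl (hrefl (proj .nu 0 h (d := k) e)))
        (vrefl (proj .nu 0 h e))
  | hrefl_nu (j : ℕ) (h) (k : ℤ) (e) :
      ElementaryRel n .symmetry (cast rfl rfl (hrefl (proj .nu (j + 1) h (d := k) e)))
        (vrefl (proj .nu (j + 1) h e))

open Raw in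
/-- The relations imposed on formal expressions: the laws of a `ℚ`-linear category under `Raw.comp`;
associativity, units and bilinearity of the vertical composition and its compatibility with
`Raw.comp`; functoriality of the tensor product with strands and of the reflections; invertibility
of the distinguished arrows; the change of heights is natural and multiplicative; and the relations
between the elementary arrows whose names belong to `L`. Equalities of graphs which enter as arguments
hold for all graphs in question. -/
inductive Rel (n : ℕ) (L : Set RelName) :
    ∀ {Γ Δ : Graph} {d : ℤ}, Raw n Γ Δ d → Raw n Γ Δ d → Prop
  /- compatibility with the operations -/
  | congr_add {Γ Δ d} (f g g' : Raw n Γ Δ d) : Rel n L g g' → Rel n L (add f g) (add f g')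
  | congr_smul {Γ Δ d} (q : ℚ) (f f' : Raw n Γ Δ d) :
      Rel n L f f' → Rel n L (smul q f) (smul q f')
  | congr_comp_left {Γ Δ Ξ d e k} (g g' : Raw n Δ Ξ e) (f : Raw n Γ Δ d) (h : k = d + e) :
      Rel n L g g' → Rel n L (comp g f h) (comp g' f h)
  | congr_comp_right {Γ Δ Ξ d e k} (g : Raw n Δ Ξ e) (f f' : Raw n Γ Δ d) (h : k = d + e) :
      Rel n L f f' → Rel n L (comp g f h) (comp g f' h)
  | congr_vcomp_left {Ψ Ψ' Γ Γ' d e k} (g g' : Raw n Ψ Ψ' d) (f : Raw n Γ Γ' e) (c c')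
      (h : k = d + e) : Rel n L g g' → Rel n L (vcomp g f c c' h) (vcomp g' f c c' h)
  | congr_vcomp_right {Ψ Ψ' Γ Γ' d e k} (g : Raw n Ψ Ψ' d) (f f' : Raw n Γ Γ' e) (c c')
      (h : k = d + e) : Rel n L f f' → Rel n L (vcomp g f c c' h) (vcomp g f' c c' h)
  | congr_strands {Γ Δ d} (l r) (f f' : Raw n Γ Δ d) :
      Rel n L f f' → Rel n L (strands l r f) (strands l r f')
  | congr_hrefl {Γ Δ d} (f f' : Raw n Γ Δ d) : Rel n L f f' → Rel n L (hrefl f) (hrefl f')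
  | congr_vrefl {Γ Δ d} (f f' : Raw n Γ Δ d) : Rel n L f f' → Rel n L (vrefl f) (vrefl f')
  /- linear structure -/
  | add_assoc {Γ Δ d} (f g h : Raw n Γ Δ d) : Rel n L (add (add f g) h) (add f (add g h))
  | add_comm {Γ Δ d} (f g : Raw n Γ Δ d) : Rel n L (add f g) (add g f)
  | add_zero {Γ Δ d} (f : Raw n Γ Δ d) : Rel n L (add f (zero Γ Δ d)) f
  | one_smul {Γ Δ d} (f : Raw n Γ Δ d) : Rel n L (smul 1 f) f
  | zero_smul {Γ Δ d} (f : Raw n Γ Δ d) : Rel n L (smul 0 f) (zero Γ Δ d)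
  | smul_add {Γ Δ d} (q) (f g : Raw n Γ Δ d) :
      Rel n L (smul q (add f g)) (add (smul q f) (smul q g))
  | add_smul {Γ Δ d} (q r) (f : Raw n Γ Δ d) :
      Rel n L (smul (q + r) f) (add (smul q f) (smul r f))
  | mul_smul {Γ Δ d} (q r) (f : Raw n Γ Δ d) : Rel n L (smul (q * r) f) (smul q (smul r f))
  | comp_add {Γ Δ Ξ d e k} (g : Raw n Δ Ξ e) (f f' : Raw n Γ Δ d) (h : k = d + e) :
      Rel n L (comp g (add f f') h) (add (comp g f h) (comp g f' h))
  | add_comp {Γ Δ Ξ d e k} (g g' : Raw n Δ Ξ e) (f : Raw n Γ Δ d) (h : k = d + e) :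
      Rel n L (comp (add g g') f h) (add (comp g f h) (comp g' f h))
  | comp_smul {Γ Δ Ξ d e k} (q) (g : Raw n Δ Ξ e) (f : Raw n Γ Δ d) (h : k = d + e) :
      Rel n L (comp g (smul q f) h) (smul q (comp g f h))
  | smul_comp {Γ Δ Ξ d e k} (q) (g : Raw n Δ Ξ e) (f : Raw n Γ Δ d) (h : k = d + e) :
      Rel n L (comp (smul q g) f h) (smul q (comp g f h))
  | vcomp_add {Ψ Ψ' Γ Γ' d e k} (g : Raw n Ψ Ψ' d) (f f' : Raw n Γ Γ' e) (c c')
      (h : k = d + e) :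
      Rel n L (vcomp g (add f f') c c' h) (add (vcomp g f c c' h) (vcomp g f' c c' h))
  | add_vcomp {Ψ Ψ' Γ Γ' d e k} (g g' : Raw n Ψ Ψ' d) (f : Raw n Γ Γ' e) (c c')
      (h : k = d + e) :
      Rel n L (vcomp (add g g') f c c' h) (add (vcomp g f c c' h) (vcomp g' f c c' h))
  | vcomp_smul {Ψ Ψ' Γ Γ' d e k} (q) (g : Raw n Ψ Ψ' d) (f : Raw n Γ Γ' e) (c c')
      (h : k = d + e) : Rel n L (vcomp g (smul q f) c c' h) (smul q (vcomp g f c c' h))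
  | smul_vcomp {Ψ Ψ' Γ Γ' d e k} (q) (g : Raw n Ψ Ψ' d) (f : Raw n Γ Γ' e) (c c')
      (h : k = d + e) : Rel n L (vcomp (smul q g) f c c' h) (smul q (vcomp g f c c' h))
  | strands_add {Γ Δ d} (l r) (f g : Raw n Γ Δ d) :
      Rel n L (strands l r (add f g)) (add (strands l r f) (strands l r g))
  | strands_smul {Γ Δ d} (l r q) (f : Raw n Γ Δ d) :
      Rel n L (strands l r (smul q f)) (smul q (strands l r f))
  | hrefl_add {Γ Δ d} (f g : Raw n Γ Δ d) :
      Rel n L (hrefl (add f g)) (add (hrefl f) (hrefl g))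
  | hrefl_smul {Γ Δ d} (q) (f : Raw n Γ Δ d) : Rel n L (hrefl (smul q f)) (smul q (hrefl f))
  | vrefl_add {Γ Δ d} (f g : Raw n Γ Δ d) :
      Rel n L (vrefl (add f g)) (add (vrefl f) (vrefl g))
  | vrefl_smul {Γ Δ d} (q) (f : Raw n Γ Δ d) : Rel n L (vrefl (smul q f)) (smul q (vrefl f))
  /- category -/
  | one_comp {Γ Δ d e} (f : Raw n Γ Δ d) (h₀ : e = 0) (h : d = d + e) :
      Rel n L (comp (one Δ h₀) f h) f
  | comp_one {Γ Δ d e} (f : Raw n Γ Δ d) (h₀ : e = 0) (h : d = e + d) :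
      Rel n L (comp f (one Γ h₀) h) f
  | comp_assoc {Γ Δ Ξ Ω a b c ab bc k} (h : Raw n Ξ Ω c) (g : Raw n Δ Ξ b) (f : Raw n Γ Δ a)
      (e₁ : bc = b + c) (e₂ : k = a + bc) (e₃ : ab = a + b) (e₄ : k = ab + c) :
      Rel n L (comp (comp h g e₁) f e₂) (comp h (comp g f e₃) e₄)
  /- vertical composition -/
  | vcomp_one {Ψ Γ d e k} (c) (h₀ : d = 0) (h₁ : e = 0) (h : k = d + e) (h₂ : k = 0) :
      Rel n L (vcomp (one Ψ h₀) (one Γ h₁) c c h) (one (Graph.comp Ψ Γ c) h₂)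
  | vcomp_comp {Ψ Ψ' Ψ'' Γ Γ' Γ'' a a' b b' aa bb ab ab' k}
      (g' : Raw n Ψ' Ψ'' a') (g : Raw n Ψ Ψ' a) (f' : Raw n Γ' Γ'' b') (f : Raw n Γ Γ' b)
      (c c' c'') (e₁ : aa = a + a') (e₂ : bb = b + b') (e₃ : k = aa + bb)
      (e₄ : ab = a + b) (e₅ : ab' = a' + b') (e₆ : k = ab + ab') :
      Rel n L (vcomp (comp g' g e₁) (comp f' f e₂) c c'' e₃)
        (comp (vcomp g' f' c' c'' e₅) (vcomp g f c c' e₄) e₆)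
  | vcomp_assoc {Ξ Ξ' Ψ Ψ' Γ Γ' a b c ab bc k} (h : Raw n Ξ Ξ' a) (g : Raw n Ψ Ψ' b)
      (f : Raw n Γ Γ' c) (c₁ c₁' c₂ c₂' c₃ c₃' c₄ c₄') (e₁ : ab = a + b) (e₂ : k = ab + c)
      (e₃ : bc = b + c) (e₄ : k = a + bc) (s t) :
      Rel n L (cast s t (vcomp (vcomp h g c₁ c₁' e₁) f c₂ c₂' e₂))
        (vcomp h (vcomp g f c₃ c₃' e₃) c₄ c₄' e₄)
  | id_vcomp {Γ Δ d e} (b : List Dir) (f : Raw n Γ Δ d) (c c') (h₀ : e = 0) (h : d = e + d)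
      (s t) : Rel n L (cast s t (vcomp (one (Graph.id b) h₀) f c c' h)) f
  | vcomp_id {Γ Δ d e} (a : List Dir) (f : Raw n Γ Δ d) (c c') (h₀ : e = 0) (h : d = d + e)
      (s t) : Rel n L (cast s t (vcomp f (one (Graph.id a) h₀) c c' h)) f
  /- tensor product with strands -/
  | strands_one {Γ d} (l r) (h₀ : d = 0) :
      Rel n L (strands l r (one Γ h₀)) (one (Graph.strands l r Γ) h₀)
  | strands_comp {Γ Δ Ξ d e k} (l r) (g : Raw n Δ Ξ e) (f : Raw n Γ Δ d) (h : k = d + e) :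
      Rel n L (strands l r (comp g f h)) (comp (strands l r g) (strands l r f) h)
  | strands_vcomp {Ψ Ψ' Γ Γ' d e k} (l r) (g : Raw n Ψ Ψ' d) (f : Raw n Γ Γ' e) (c c' c₁ c₁')
      (h : k = d + e) (s t) :
      Rel n L (cast s t (strands l r (vcomp g f c c' h)))
        (vcomp (strands l r g) (strands l r f) c₁ c₁' h)
  | strands_strands {Γ Δ d} (l l' r r') (f : Raw n Γ Δ d) (s t) :
      Rel n L (cast s t (strands l r (strands l' r' f))) (strands (l ++ l') (r' ++ r) f)
  | strands_nil {Γ Δ d} (f : Raw n Γ Δ d) (s t) : Rel n L (cast s t (strands [] [] f)) f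
  /- reflections -/
  | hrefl_one {Γ d} (h₀ : d = 0) : Rel n L (hrefl (one Γ h₀)) (one Γ.hrefl h₀)
  | hrefl_comp {Γ Δ Ξ d e k} (g : Raw n Δ Ξ e) (f : Raw n Γ Δ d) (h : k = d + e) :
      Rel n L (hrefl (comp g f h)) (comp (hrefl g) (hrefl f) h)
  | hrefl_vcomp {Ψ Ψ' Γ Γ' d e k} (g : Raw n Ψ Ψ' d) (f : Raw n Γ Γ' e) (c c' c₁ c₁')
      (h : k = d + e) (s t) :
      Rel n L (cast s t (hrefl (vcomp g f c c' h))) (vcomp (hrefl g) (hrefl f) c₁ c₁' h)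
  | hrefl_strands {Γ Δ d} (l r) (f : Raw n Γ Δ d) (s t) :
      Rel n L (cast s t (hrefl (strands l r f))) (strands r.reverse l.reverse (hrefl f))
  | hrefl_hrefl {Γ Δ d} (f : Raw n Γ Δ d) (s t) : Rel n L (cast s t (hrefl (hrefl f))) f
  | vrefl_one {Γ d} (h₀ : d = 0) : Rel n L (vrefl (one Γ h₀)) (one Γ.vrefl h₀)
  | vrefl_comp {Γ Δ Ξ d e k} (g : Raw n Δ Ξ e) (f : Raw n Γ Δ d) (h : k = d + e) :
      Rel n L (vrefl (comp g f h)) (comp (vrefl g) (vrefl f) h)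
  | vrefl_vcomp {Ψ Ψ' Γ Γ' d e k} (g : Raw n Ψ Ψ' d) (f : Raw n Γ Γ' e) (c c' c₁ c₁')
      (h : k = d + e) (h' : k = e + d) (s t) :
      Rel n L (cast s t (vrefl (vcomp g f c c' h))) (vcomp (vrefl f) (vrefl g) c₁ c₁' h')
  | vrefl_strands {Γ Δ d} (l r) (f : Raw n Γ Δ d) (s t) :
      Rel n L (cast s t (vrefl (strands l r f)))
        (strands (l.map Dir.flip) (r.map Dir.flip) (vrefl f))
  | vrefl_vrefl {Γ Δ d} (f : Raw n Γ Δ d) (s t) : Rel n L (cast s t (vrefl (vrefl f))) f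
  | hrefl_vrefl {Γ Δ d} (f : Raw n Γ Δ d) (s t) :
      Rel n L (cast s t (hrefl (vrefl f))) (vrefl (hrefl f))
  /- invertible arrows -/
  | proj_incl (D : Splitting) (j : ℕ) (hj : j < D.count n) {d e k : ℤ}
      (e₁ : d = -D.shift n j) (e₂ : e = D.shift n j) (h : k = d + e) (h₀ : k = 0) :
      Rel n L (comp (proj D j hj e₂) (incl D j hj e₁) h) (one (D.target j) h₀)
  | proj_incl_ne (D : Splitting) (i : ℕ) (hi : i < D.count n) (j : ℕ) (hj : j < D.count n)
      {d e k : ℤ} (e₁ : d = -D.shift n i) (e₂ : e = D.shift n j)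
      (h : k = d + e) (hij : i ≠ j) :
      Rel n L (comp (proj D j hj e₂) (incl D i hi e₁) h) (zero (D.target i) (D.target j) k)
  | sum_incl_proj (D : Splitting) {k : ℤ} (h₀ : k = 0)
      (e : ∀ j : Fin (D.count n), k = D.shift n j + -D.shift n j) :
      Rel n L (Raw.sum ((List.finRange (D.count n)).map fun j : Fin (D.count n) =>
        comp (incl D j j.2 rfl) (proj D j j.2 rfl) (e j))) (one D.source h₀)
  /- change of heights -/
  | exch_natural {Γ Γ' Δ Δ' d e k k'} (f : Raw n Γ Γ' d) (g : Raw n Δ Δ' e) (hs ht hs' ht')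
      (h : k = d + e) (h' : k' = e + d) (h₁ : k = 0 + k') (h₂ : k = k + 0) :
      Rel n L (comp (tens' f g hs' ht' h') (exch Γ Δ) h₁)
        (comp (exch Γ' Δ') (tens f g hs ht h) h₂)
  | exch_comp_right (Γ Δ₂ Δ₁ c c₁ c₂ c₃ c₄ s t b) :
      Rel n L (cast s t (exch Γ (Graph.comp Δ₂ Δ₁ c)))
        (comp (vcomp (one (Graph.strands Γ.tgt [] Δ₂) rfl) (exch Γ Δ₁) c₃ c₄ rfl)
          (cast rfl b (vcomp (exch Γ Δ₂) (one (Graph.strands Γ.src [] Δ₁) rfl) c₁ c₂ rfl)) rfl)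
  | exch_comp_left (Γ₂ Γ₁ Δ c c₁ c₂ c₃ c₄ s t b) :
      Rel n L (cast s t (exch (Graph.comp Γ₂ Γ₁ c) Δ))
        (comp (vcomp (exch Γ₂ Δ) (one (Graph.strands [] Δ.src Γ₁) rfl) c₃ c₄ rfl)
          (cast rfl b (vcomp (one (Graph.strands [] Δ.tgt Γ₂) rfl) (exch Γ₁ Δ) c₁ c₂ rfl)) rfl)
  | exch_strands_left (l Γ Δ s t) :
      Rel n L (cast s t (exch (Graph.strands l [] Γ) Δ)) (strands l [] (exch Γ Δ))
  | exch_strands_right (r Γ Δ s t) :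
      Rel n L (cast s t (exch Γ (Graph.strands [] r Δ))) (strands [] r (exch Γ Δ))
  | exch_strands_mid (m Γ Δ s t) :
      Rel n L (cast s t (exch (Graph.strands [] m Γ) Δ)) (exch Γ (Graph.strands m [] Δ))
  | hrefl_exch (Γ Δ s t) :
      Rel n L (cast s t (hrefl (exch Γ Δ))) (exchInv Δ.hrefl Γ.hrefl)
  | vrefl_exch (Γ Δ s t) :
      Rel n L (cast s t (vrefl (exch Γ Δ))) (exchInv Γ.vrefl Δ.vrefl)
  /- relations between the elementary arrows -/
  | elementary {Γ Δ d} {ℓ : RelName} (f g : Raw n Γ Δ d) :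
      ℓ ∈ L → ElementaryRel n ℓ f g → Rel n L f g

/-! ## Morphisms -/

/-- Morphisms `Γ{m} → Δ{m + d}`: formal expressions modulo the relations. -/
def Hom2 (n : ℕ) (L : Set RelName) (Γ Δ : Graph) (d : ℤ) : Type :=
  Quot (@Rel n L Γ Δ d)

namespace Hom2

section
variable {n : ℕ} {L : Set RelName}

def mk {Γ Δ : Graph} {d : ℤ} (f : Raw n Γ Δ d) : Hom2 n L Γ Δ d := Quot.mk _ f

instance {Γ Δ : Graph} {d : ℤ} : Zero (Hom2 n L Γ Δ d) := ⟨mk (.zero Γ Δ d)⟩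

theorem congr_add_left {Γ Δ : Graph} {d : ℤ} (f f' g : Raw n Γ Δ d) (h : Rel n L f f') :
    (mk (.add f g) : Hom2 n L Γ Δ d) = mk (.add f' g) := by
  have h₁ : (mk (.add f g) : Hom2 n L Γ Δ d) = mk (.add g f) := Quot.sound (.add_comm f g)
  have h₂ : (mk (.add g f) : Hom2 n L Γ Δ d) = mk (.add g f') := Quot.sound (.congr_add g f f' h)
  have h₃ : (mk (.add g f') : Hom2 n L Γ Δ d) = mk (.add f' g) := Quot.sound (.add_comm g f')
  exact h₁.trans (h₂.trans h₃)

instance {Γ Δ : Graph} {d : ℤ} : Add (Hom2 n L Γ Δ d) :=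
  ⟨fun f g => Quot.lift (fun a => Quot.lift (fun b => mk (.add a b))
    (fun b b' h => Quot.sound (.congr_add a b b' h)) g)
    (fun a a' h => by
      induction g using Quot.ind with
      | mk b => exact congr_add_left a a' b h) f⟩

instance {Γ Δ : Graph} {d : ℤ} : SMul ℚ (Hom2 n L Γ Δ d) :=
  ⟨fun q => Quot.map (Raw.smul q) (fun f f' h => .congr_smul q f f' h)⟩

instance {Γ Δ : Graph} {d : ℤ} : Neg (Hom2 n L Γ Δ d) := ⟨fun f => (-1 : ℚ) • f⟩

theorem zero_smul' {Γ Δ : Graph} {d : ℤ} (f : Hom2 n L Γ Δ d) : (0 : ℚ) • f = 0 := by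
  induction f using Quot.ind with | mk f => exact Quot.sound (.zero_smul f)

theorem one_smul' {Γ Δ : Graph} {d : ℤ} (f : Hom2 n L Γ Δ d) : (1 : ℚ) • f = f := by
  induction f using Quot.ind with | mk f => exact Quot.sound (.one_smul f)

theorem add_smul' {Γ Δ : Graph} {d : ℤ} (q r : ℚ) (f : Hom2 n L Γ Δ d) :
    (q + r) • f = q • f + r • f := by
  induction f using Quot.ind with | mk f => exact Quot.sound (.add_smul q r f)

theorem add_comm' {Γ Δ : Graph} {d : ℤ} (f g : Hom2 n L Γ Δ d) : f + g = g + f := by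
  induction f using Quot.ind with | mk f => ?_
  induction g using Quot.ind with | mk g => exact Quot.sound (.add_comm f g)

theorem add_zero' {Γ Δ : Graph} {d : ℤ} (f : Hom2 n L Γ Δ d) : f + 0 = f := by
  induction f using Quot.ind with | mk f => exact Quot.sound (.add_zero f)

theorem smul_add' {Γ Δ : Graph} {d : ℤ} (q : ℚ) (f g : Hom2 n L Γ Δ d) :
    q • (f + g) = q • f + q • g := by
  induction f using Quot.ind with | mk f => ?_
  induction g using Quot.ind with | mk g => exact Quot.sound (.smul_add q f g)

theorem mul_smul' {Γ Δ : Graph} {d : ℤ} (q r : ℚ) (f : Hom2 n L Γ Δ d) :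
    (q * r) • f = q • r • f := by
  induction f using Quot.ind with | mk f => exact Quot.sound (.mul_smul q r f)

instance {Γ Δ : Graph} {d : ℤ} : AddCommGroup (Hom2 n L Γ Δ d) where
  add_assoc f g h := by
    induction f using Quot.ind with | mk f => ?_
    induction g using Quot.ind with | mk g => ?_
    induction h using Quot.ind with | mk h => exact Quot.sound (.add_assoc f g h)
  add_comm := add_comm'
  add_zero := add_zero'
  zero_add f := by rw [add_comm', add_zero']
  neg_add_cancel f := by
    have h : (-1 + 1 : ℚ) • f = -f + (1 : ℚ) • f := add_smul' (-1) 1 f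
    rw [one_smul', neg_add_cancel, zero_smul'] at h
    exact h.symm
  nsmul := nsmulRec
  zsmul := zsmulRec

instance {Γ Δ : Graph} {d : ℤ} : Module ℚ (Hom2 n L Γ Δ d) where
  one_smul := one_smul'
  mul_smul := mul_smul'
  smul_zero q := by
    have h := mul_smul' q 0 (0 : Hom2 n L Γ Δ d)
    rw [mul_zero, zero_smul'] at h
    exact h.symm
  smul_add := smul_add'
  add_smul := add_smul'
  zero_smul := zero_smul'

/-- The identity. -/
def one (Γ : Graph) {d : ℤ} (h : d = 0) : Hom2 n L Γ Γ d := mk (.one Γ h)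

/-- An elementary arrow. -/
def gen {Γ Δ : Graph} {d e : ℤ} (g : Gen n Γ Δ e) (h : d = e) : Hom2 n L Γ Δ d := mk (.gen g h)

/-- (Horizontal) composition. -/
def comp {Γ Δ Ξ : Graph} {d e k : ℤ} (g : Hom2 n L Δ Ξ e) (f : Hom2 n L Γ Δ d)
    (h : k = d + e) : Hom2 n L Γ Ξ k :=
  Quot.map₂ (fun g f => Raw.comp g f h) (fun g f f' r => .congr_comp_right g f f' h r)
    (fun g g' f r => .congr_comp_left g g' f h r) g f

/-- Vertical composition. -/
def vcomp {Ψ Ψ' Γ Γ' : Graph} {d e k : ℤ} (g : Hom2 n L Ψ Ψ' d) (f : Hom2 n L Γ Γ' e)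
    (c : Ψ.src = Γ.tgt) (c' : Ψ'.src = Γ'.tgt) (h : k = d + e) :
    Hom2 n L (Graph.comp Ψ Γ c) (Graph.comp Ψ' Γ' c') k :=
  Quot.map₂ (fun g f => Raw.vcomp g f c c' h)
    (fun g f f' r => .congr_vcomp_right g f f' c c' h r)
    (fun g g' f r => .congr_vcomp_left g g' f c c' h r) g f

/-- Tensor product with vertical strands. -/
def strands (l r : List Dir) {Γ Δ : Graph} {d : ℤ} (f : Hom2 n L Γ Δ d) :
    Hom2 n L (Graph.strands l r Γ) (Graph.strands l r Δ) d :=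
  Quot.map (Raw.strands l r) (fun f f' h => .congr_strands l r f f' h) f

theorem one_comp {Γ Δ : Graph} {d e : ℤ} (f : Hom2 n L Γ Δ d) (h₀ : e = 0) (h : d = d + e) :
    comp (one Δ h₀) f h = f := by
  induction f using Quot.ind with | mk f => exact Quot.sound (.one_comp f h₀ h)

theorem comp_one {Γ Δ : Graph} {d e : ℤ} (f : Hom2 n L Γ Δ d) (h₀ : e = 0) (h : d = e + d) :
    comp f (one Γ h₀) h = f := by
  induction f using Quot.ind with | mk f => exact Quot.sound (.comp_one f h₀ h)

theorem comp_assoc {Γ Δ Ξ Ω : Graph} {a b c ab bc k : ℤ} (h : Hom2 n L Ξ Ω c)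
    (g : Hom2 n L Δ Ξ b) (f : Hom2 n L Γ Δ a) (e₁ : bc = b + c) (e₂ : k = a + bc)
    (e₃ : ab = a + b) (e₄ : k = ab + c) :
    comp (comp h g e₁) f e₂ = comp h (comp g f e₃) e₄ := by
  induction f using Quot.ind with | mk f => ?_
  induction g using Quot.ind with | mk g => ?_
  induction h using Quot.ind with | mk h => exact Quot.sound (.comp_assoc h g f e₁ e₂ e₃ e₄)

theorem comp_add {Γ Δ Ξ : Graph} {d e k : ℤ} (g : Hom2 n L Δ Ξ e) (f f' : Hom2 n L Γ Δ d)
    (h : k = d + e) : comp g (f + f') h = comp g f h + comp g f' h := by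
  induction f using Quot.ind with | mk f => ?_
  induction f' using Quot.ind with | mk f' => ?_
  induction g using Quot.ind with | mk g => exact Quot.sound (.comp_add g f f' h)

theorem add_comp {Γ Δ Ξ : Graph} {d e k : ℤ} (g g' : Hom2 n L Δ Ξ e) (f : Hom2 n L Γ Δ d)
    (h : k = d + e) : comp (g + g') f h = comp g f h + comp g' f h := by
  induction f using Quot.ind with | mk f => ?_
  induction g using Quot.ind with | mk g => ?_
  induction g' using Quot.ind with | mk g' => exact Quot.sound (.add_comp g g' f h)

theorem vcomp_add {Ψ Ψ' Γ Γ' : Graph} {d e k : ℤ} (g : Hom2 n L Ψ Ψ' d)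
    (f f' : Hom2 n L Γ Γ' e) (c : Ψ.src = Γ.tgt) (c' : Ψ'.src = Γ'.tgt) (h : k = d + e) :
    vcomp g (f + f') c c' h = vcomp g f c c' h + vcomp g f' c c' h := by
  induction f using Quot.ind with | mk f => ?_
  induction f' using Quot.ind with | mk f' => ?_
  induction g using Quot.ind with | mk g => exact Quot.sound (.vcomp_add g f f' c c' h)

theorem add_vcomp {Ψ Ψ' Γ Γ' : Graph} {d e k : ℤ} (g g' : Hom2 n L Ψ Ψ' d)
    (f : Hom2 n L Γ Γ' e) (c : Ψ.src = Γ.tgt) (c' : Ψ'.src = Γ'.tgt) (h : k = d + e) :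
    vcomp (g + g') f c c' h = vcomp g f c c' h + vcomp g' f c c' h := by
  induction f using Quot.ind with | mk f => ?_
  induction g using Quot.ind with | mk g => ?_
  induction g' using Quot.ind with | mk g' => exact Quot.sound (.add_vcomp g g' f c c' h)

theorem vcomp_one {Ψ Γ : Graph} {d e k : ℤ} (c : Ψ.src = Γ.tgt) (h₀ : d = 0) (h₁ : e = 0)
    (h : k = d + e) (h₂ : k = 0) :
    vcomp (one Ψ h₀ : Hom2 n L Ψ Ψ d) (one Γ h₁) c c h = one (Graph.comp Ψ Γ c) h₂ :=
  Quot.sound (.vcomp_one c h₀ h₁ h h₂)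

theorem vcomp_comp {Ψ Ψ' Ψ'' Γ Γ' Γ'' : Graph} {a a' b b' aa bb ab ab' k : ℤ}
    (g' : Hom2 n L Ψ' Ψ'' a') (g : Hom2 n L Ψ Ψ' a) (f' : Hom2 n L Γ' Γ'' b')
    (f : Hom2 n L Γ Γ' b) (c : Ψ.src = Γ.tgt) (c' : Ψ'.src = Γ'.tgt) (c'' : Ψ''.src = Γ''.tgt)
    (e₁ : aa = a + a') (e₂ : bb = b + b') (e₃ : k = aa + bb) (e₄ : ab = a + b)
    (e₅ : ab' = a' + b') (e₆ : k = ab + ab') :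
    vcomp (comp g' g e₁) (comp f' f e₂) c c'' e₃ =
      comp (vcomp g' f' c' c'' e₅) (vcomp g f c c' e₄) e₆ := by
  induction f using Quot.ind with | mk f => ?_
  induction g using Quot.ind with | mk g => ?_
  induction f' using Quot.ind with | mk f' => ?_
  induction g' using Quot.ind with
  | mk g' => exact Quot.sound (.vcomp_comp g' g f' f c c' c'' e₁ e₂ e₃ e₄ e₅ e₆)

theorem strands_add (l r : List Dir) {Γ Δ : Graph} {d : ℤ} (f g : Hom2 n L Γ Δ d) :
    strands l r (f + g) = strands l r f + strands l r g := by
  induction f using Quot.ind with | mk f => ?_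
  induction g using Quot.ind with | mk g => exact Quot.sound (.strands_add l r f g)

theorem strands_comp (l r : List Dir) {Γ Δ Ξ : Graph} {d e k : ℤ} (g : Hom2 n L Δ Ξ e)
    (f : Hom2 n L Γ Δ d) (h : k = d + e) :
    strands l r (comp g f h) = comp (strands l r g) (strands l r f) h := by
  induction f using Quot.ind with | mk f => ?_
  induction g using Quot.ind with | mk g => exact Quot.sound (.strands_comp l r g f h)

end

end Hom2

/-- A shifted graph `Γ{m}` with source `a` and target `b`. -/
structure Shifted (n : ℕ) (L : Set RelName) (a b : List Dir) where
  graph : Graph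
  shift : ℤ
  src_eq : graph.src = a
  tgt_eq : graph.tgt = b

namespace Shifted

section
variable {n : ℕ} {L : Set RelName} {a b c : List Dir}

instance : Category (Shifted n L a b) where
  Hom X Y := Hom2 n L X.graph Y.graph (Y.shift - X.shift)
  id X := Hom2.one X.graph (sub_self X.shift)
  comp f g := Hom2.comp g f (by ring)
  id_comp f := Hom2.comp_one f _ _
  comp_id f := Hom2.one_comp f _ _
  assoc f g h := (Hom2.comp_assoc h g f _ _ _ _).symm

instance : Preadditive (Shifted n L a b) where
  homGroup X Y := inferInstanceAs (AddCommGroup (Hom2 n L X.graph Y.graph (Y.shift - X.shift)))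
  add_comp _ _ _ f f' g := Hom2.comp_add g f f' _
  comp_add _ _ _ f g g' := Hom2.add_comp g g' f _

/-- `Γ{m} ∘ Φ{k} = (Γ ∘ Φ){m + k}`. -/
def vcomp (X : Shifted n L b c) (Y : Shifted n L a b) : Shifted n L a c :=
  ⟨Graph.comp X.graph Y.graph (X.src_eq.trans Y.tgt_eq.symm), X.shift + Y.shift, Y.src_eq,
    X.tgt_eq⟩

/-- Vertical composition of morphisms. -/
def vcompHom {X X' : Shifted n L b c} {Y Y' : Shifted n L a b} (f : X ⟶ X') (g : Y ⟶ Y') :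
    vcomp X Y ⟶ vcomp X' Y' :=
  Hom2.vcomp (n := n) (L := L) f g (X.src_eq.trans Y.tgt_eq.symm)
    (X'.src_eq.trans Y'.tgt_eq.symm) (by simp only [vcomp]; ring)

/-- `id_l ⊗ Γ{m} ⊗ id_r`. -/
def strands (l r : List Dir) {a' b' : List Dir} (ha : l ++ a ++ r = a') (hb : l ++ b ++ r = b')
    (X : Shifted n L a b) : Shifted n L a' b' :=
  ⟨Graph.strands l r X.graph, X.shift, (congrArg (fun t => l ++ t ++ r) X.src_eq).trans ha,
    (congrArg (fun t => l ++ t ++ r) X.tgt_eq).trans hb⟩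

/-- `1 ⊗ f ⊗ 1`. -/
def strandsHom (l r : List Dir) {a' b' : List Dir} (ha : l ++ a ++ r = a')
    (hb : l ++ b ++ r = b') {X Y : Shifted n L a b} (f : X ⟶ Y) :
    strands l r ha hb X ⟶ strands l r ha hb Y :=
  Hom2.strands (n := n) (L := L) l r f

theorem vcompHom_add {X X' : Shifted n L b c} {Y Y' : Shifted n L a b} (f : X ⟶ X')
    (g g' : Y ⟶ Y') : vcompHom f (g + g') = vcompHom f g + vcompHom f g' :=
  Hom2.vcomp_add _ _ _ _ _ _

theorem add_vcompHom {X X' : Shifted n L b c} {Y Y' : Shifted n L a b} (f f' : X ⟶ X')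
    (g : Y ⟶ Y') : vcompHom (f + f') g = vcompHom f g + vcompHom f' g :=
  Hom2.add_vcomp _ _ _ _ _ _

theorem vcompHom_comp {X X' X'' : Shifted n L b c} {Y Y' Y'' : Shifted n L a b} (f : X ⟶ X')
    (f' : X' ⟶ X'') (g : Y ⟶ Y') (g' : Y' ⟶ Y'') :
    vcompHom (f ≫ f') (g ≫ g') = vcompHom f g ≫ vcompHom f' g' :=
  Hom2.vcomp_comp _ _ _ _ _ _ _ _ _ _ _ _ _

theorem vcompHom_id (X : Shifted n L b c) (Y : Shifted n L a b) :
    vcompHom (𝟙 X) (𝟙 Y) = 𝟙 (vcomp X Y) :=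
  Hom2.vcomp_one _ _ _ _ _

/-- `vcompHom` as an additive map in both arguments. -/
def vcompAdd (X X' : Shifted n L b c) (Y Y' : Shifted n L a b) :
    (X ⟶ X') →+ (Y ⟶ Y') →+ (vcomp X Y ⟶ vcomp X' Y') :=
  AddMonoidHom.mk' (fun f => AddMonoidHom.mk' (vcompHom f) (vcompHom_add f))
    (fun f f' => AddMonoidHom.ext fun g => add_vcompHom f f' g)

/-- `strandsHom` as an additive map. -/
def strandsAdd (l r : List Dir) {a' b' : List Dir} (ha : l ++ a ++ r = a')
    (hb : l ++ b ++ r = b') (X Y : Shifted n L a b) :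
    (X ⟶ Y) →+ (strands l r ha hb X ⟶ strands l r ha hb Y) :=
  AddMonoidHom.mk' (strandsHom l r ha hb) (Hom2.strands_add l r)

theorem strandsHom_comp (l r : List Dir) {a' b' : List Dir} (ha : l ++ a ++ r = a')
    (hb : l ++ b ++ r = b') {X Y Z : Shifted n L a b} (f : X ⟶ Y) (g : Y ⟶ Z) :
    strandsHom l r ha hb (f ≫ g) = strandsHom l r ha hb f ≫ strandsHom l r ha hb g :=
  Hom2.strands_comp l r _ _ _

end

end Shifted

/-! ## Formal complexes -/

/-- The data of a bounded complex of formal direct sums of shifted graphs: the summands of all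
terms are listed together, each with its homological degree, and the differential is given by
its matrix entries. -/
structure PreComplex (n : ℕ) (L : Set RelName) (a b : List Dir) where
  ι : Type
  [fin : Fintype ι]
  deg : ι → ℤ
  obj : ι → Shifted n L a b
  d : ∀ x y, obj x ⟶ obj y

attribute [instance] PreComplex.fin

/-- The differential raises the degree by one and squares to zero. -/
def PreComplex.IsComplex {n : ℕ} {L : Set RelName} {a b : List Dir} (C : PreComplex n L a b) :
    Prop :=
  (∀ x y, C.deg y ≠ C.deg x + 1 → C.d x y = 0) ∧ ∀ x z, ∑ y, C.d x y ≫ C.d y z = 0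

/-- A bounded formal complex of formal direct sums of shifted graphs with source `a` and
target `b`. -/
structure FormalComplex (n : ℕ) (L : Set RelName) (a b : List Dir) extends
    PreComplex n L a b where
  isComplex : toPreComplex.IsComplex

section
variable {n : ℕ} {L : Set RelName} {a b c : List Dir}

open Classical in
/-- The entries of the identity matrix. -/
noncomputable def kron {ι : Type} (X : ι → Shifted n L a b) (x y : ι) : X x ⟶ X y :=
  if h : x = y then eqToHom (by rw [h]) else 0

theorem kron_self {ι : Type} (X : ι → Shifted n L a b) (x : ι) : kron X x x = 𝟙 (X x) := by
  simp [kron]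

theorem kron_ne {ι : Type} (X : ι → Shifted n L a b) {x y : ι} (h : x ≠ y) :
    kron X x y = 0 := by
  simp [kron, h]

theorem sum_kron_comp {ι : Type} [Fintype ι] (X : ι → Shifted n L a b) (x : ι)
    {Z : Shifted n L a b} (f : ∀ y, X y ⟶ Z) : ∑ y, kron X x y ≫ f y = f x := by
  classical
  rw [Finset.sum_eq_single x, kron_self, Category.id_comp]
  · intro y _ h
    rw [kron_ne X h.symm, Limits.zero_comp]
  · simp

theorem sum_comp_kron {ι : Type} [Fintype ι] (X : ι → Shifted n L a b) (z : ι)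
    {Z : Shifted n L a b} (f : ∀ y, Z ⟶ X y) : ∑ y, f y ≫ kron X y z = f z := by
  classical
  rw [Finset.sum_eq_single z, kron_self, Category.comp_id]
  · intro y _ h
    rw [kron_ne X h, Limits.comp_zero]
  · simp

open Shifted in
theorem sum_vcompHom {ι κ : Type} [Fintype ι] [Fintype κ] {X X' : Shifted n L b c}
    {Y Y' : Shifted n L a b} (f : ι → (X ⟶ X')) (g : κ → (Y ⟶ Y')) :
    ∑ y : ι × κ, vcompHom (f y.1) (g y.2) = vcompHom (∑ i, f i) (∑ j, g j) := by
  have h : ∀ (u : X ⟶ X') (v : Y ⟶ Y'), vcompHom u v = vcompAdd X X' Y Y' u v := fun _ _ => rfl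
  simp only [h, map_sum, AddMonoidHom.finsetSum_apply, Fintype.sum_prod_type]
  exact Finset.sum_comm

open Shifted in
theorem smul_vcompHom {X X' : Shifted n L b c} {Y Y' : Shifted n L a b} (s : ℤˣ) (f : X ⟶ X')
    (g : Y ⟶ Y') : vcompHom (s • f) g = s • vcompHom f g := by
  have h : ∀ (u : X ⟶ X') (v : Y ⟶ Y'), vcompHom u v = vcompAdd X X' Y Y' u v := fun _ _ => rfl
  rcases Int.units_eq_one_or s with rfl | rfl <;> simp [h, Units.neg_smul]

open Shifted in
theorem vcompHom_zero {X X' : Shifted n L b c} {Y Y' : Shifted n L a b} (f : X ⟶ X') :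
    vcompHom f (0 : Y ⟶ Y') = 0 :=
  map_zero (vcompAdd X X' Y Y' f)

open Shifted in
theorem zero_vcompHom {X X' : Shifted n L b c} {Y Y' : Shifted n L a b} (g : Y ⟶ Y') :
    vcompHom (0 : X ⟶ X') g = 0 := by
  change vcompAdd X X' Y Y' 0 g = 0
  simp

namespace FormalComplex

open Shifted in
/-- The composition `M ∘ N` of formal complexes: the total complex of the bicomplex with entries
`M_i ∘ N_j`. -/
noncomputable def comp (M : FormalComplex n L b c) (N : FormalComplex n L a b) :
    FormalComplex n L a c where
  ι := M.ι × N.ι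
  deg x := M.deg x.1 + N.deg x.2
  obj x := Shifted.vcomp (M.obj x.1) (N.obj x.2)
  d x y := vcompHom (M.d x.1 y.1) (kron N.obj x.2 y.2) +
    (M.deg x.1).negOnePow • vcompHom (kron M.obj x.1 y.1) (N.d x.2 y.2)
  isComplex := by
    constructor
    · rintro ⟨x₁, x₂⟩ ⟨y₁, y₂⟩ h
      have h₁ : vcompHom (M.d x₁ y₁) (kron N.obj x₂ y₂) = 0 := by
        by_cases e : x₂ = y₂
        · subst e
          rw [M.isComplex.1 x₁ y₁ (fun h' => h (by simp only [h']; ring)), zero_vcompHom]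
        · rw [kron_ne _ e, vcompHom_zero]
      have h₂ : vcompHom (kron M.obj x₁ y₁) (N.d x₂ y₂) = 0 := by
        by_cases e : x₁ = y₁
        · subst e
          rw [N.isComplex.1 x₂ y₂ (fun h' => h (by simp only [h']; ring)), vcompHom_zero]
        · rw [kron_ne _ e, zero_vcompHom]
      simp only [h₁, h₂, smul_zero, add_zero]
    · rintro ⟨x₁, x₂⟩ ⟨z₁, z₂⟩
      have key : ∀ y : M.ι × N.ι,
          (vcompHom (M.d x₁ y.1) (kron N.obj x₂ y.2) +
            (M.deg x₁).negOnePow • vcompHom (kron M.obj x₁ y.1) (N.d x₂ y.2)) ≫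
          (vcompHom (M.d y.1 z₁) (kron N.obj y.2 z₂) +
            (M.deg y.1).negOnePow • vcompHom (kron M.obj y.1 z₁) (N.d y.2 z₂)) =
          vcompHom (M.d x₁ y.1 ≫ M.d y.1 z₁) (kron N.obj x₂ y.2 ≫ kron N.obj y.2 z₂) +
          vcompHom ((M.deg y.1).negOnePow • (M.d x₁ y.1 ≫ kron M.obj y.1 z₁))
            (kron N.obj x₂ y.2 ≫ N.d y.2 z₂) +
          (vcompHom ((M.deg x₁).negOnePow • (kron M.obj x₁ y.1 ≫ M.d y.1 z₁))
            (N.d x₂ y.2 ≫ kron N.obj y.2 z₂) +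
          vcompHom ((M.deg x₁).negOnePow • (kron M.obj x₁ y.1 ≫
              ((M.deg y.1).negOnePow • kron M.obj y.1 z₁)))
            (N.d x₂ y.2 ≫ N.d y.2 z₂)) := by
        intro y
        have sc : ∀ {X Y Z : Shifted n L a c} (s : ℤˣ) (f : X ⟶ Y) (g : Y ⟶ Z),
            (s • f) ≫ g = s • (f ≫ g) := by
          intro X Y Z s f g
          rcases Int.units_eq_one_or s with rfl | rfl <;> simp [Units.neg_smul]
        have cs : ∀ {X Y Z : Shifted n L a c} (s : ℤˣ) (f : X ⟶ Y) (g : Y ⟶ Z),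
            f ≫ (s • g) = s • (f ≫ g) := by
          intro X Y Z s f g
          rcases Int.units_eq_one_or s with rfl | rfl <;> simp [Units.neg_smul]
        have cs' : ∀ {X Y Z : Shifted n L b c} (s : ℤˣ) (f : X ⟶ Y) (g : Y ⟶ Z),
            f ≫ (s • g) = s • (f ≫ g) := by
          intro X Y Z s f g
          rcases Int.units_eq_one_or s with rfl | rfl <;> simp [Units.neg_smul]
        simp only [Preadditive.add_comp, Preadditive.comp_add, sc, cs, cs', smul_vcompHom,
          vcompHom_comp, smul_add]
        rw [smul_comm (M.deg y.1).negOnePow (M.deg x₁).negOnePow]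
        abel
      have ha := sum_vcompHom (fun i => M.d x₁ i ≫ M.d i z₁)
        (fun j => kron N.obj x₂ j ≫ kron N.obj j z₂)
      have hb := sum_vcompHom (fun i => (M.deg i).negOnePow • (M.d x₁ i ≫ kron M.obj i z₁))
        (fun j => kron N.obj x₂ j ≫ N.d j z₂)
      have hc := sum_vcompHom (fun i => (M.deg x₁).negOnePow • (kron M.obj x₁ i ≫ M.d i z₁))
        (fun j => N.d x₂ j ≫ kron N.obj j z₂)
      have hd := sum_vcompHom (fun i => (M.deg x₁).negOnePow • (kron M.obj x₁ i ≫
        ((M.deg i).negOnePow • kron M.obj i z₁))) (fun j => N.d x₂ j ≫ N.d j z₂)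
      rw [M.isComplex.2, zero_vcompHom] at ha
      rw [N.isComplex.2, vcompHom_zero] at hd
      have hs : ∑ i, (M.deg i).negOnePow • (M.d x₁ i ≫ kron M.obj i z₁) =
          (M.deg z₁).negOnePow • M.d x₁ z₁ := by
        classical
        rw [Finset.sum_eq_single z₁, kron_self, Category.comp_id]
        · intro y _ h
          rw [kron_ne _ h, Limits.comp_zero, smul_zero]
        · simp
      rw [hs, sum_kron_comp] at hb
      rw [← Finset.smul_sum, sum_kron_comp, sum_comp_kron] at hc
      refine (Finset.sum_congr rfl fun y _ => key y).trans ?_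
      rw [Finset.sum_add_distrib, Finset.sum_add_distrib, Finset.sum_add_distrib, ha, hb, hc, hd,
        zero_add, add_zero, ← add_vcompHom]
      by_cases e : M.deg z₁ = M.deg x₁ + 1
      · rw [e, Int.negOnePow_succ, Units.neg_smul, neg_add_cancel, zero_vcompHom]
      · rw [M.isComplex.1 _ _ e, smul_zero, smul_zero, add_zero, zero_vcompHom]

open Shifted in
/-- `id_l ⊗ M ⊗ id_r`. -/
def strands (l r : List Dir) {a' b' : List Dir} (ha : l ++ a ++ r = a') (hb : l ++ b ++ r = b')
    (M : FormalComplex n L a b) : FormalComplex n L a' b' where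
  ι := M.ι
  deg := M.deg
  obj x := Shifted.strands l r ha hb (M.obj x)
  d x y := strandsHom l r ha hb (M.d x y)
  isComplex := by
    constructor
    · intro x y h
      change strandsHom l r ha hb (M.d x y) = 0
      rw [M.isComplex.1 x y h]
      exact map_zero (strandsAdd l r ha hb (M.obj x) (M.obj y))
    · intro x z
      simp only [← strandsHom_comp]
      change ∑ y, strandsAdd l r ha hb (M.obj x) (M.obj z) (M.d x y ≫ M.d y z) = 0
      rw [← map_sum, M.isComplex.2, map_zero]

/-- The tensor product `M ⊗ N` of formal complexes: the total complex of the bicomplex with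
entries `M_i ⊗ N_j`. -/
noncomputable def tensor {a' b' : List Dir} (M : FormalComplex n L a b)
    (N : FormalComplex n L a' b') : FormalComplex n L (a ++ a') (b ++ b') :=
  comp (strands [] b' rfl rfl M) (strands a [] (List.append_nil _) (List.append_nil _) N)

/-- The complex with one term, in degree zero. -/
def single (X : Shifted n L a b) : FormalComplex n L a b where
  ι := Unit
  deg _ := 0
  obj _ := X
  d _ _ := 0
  isComplex := by constructor <;> simp

/-- The complex `X → Y`, with `X` in degree `i`. -/
def two (i : ℤ) {X Y : Shifted n L a b} (f : X ⟶ Y) : FormalComplex n L a b where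
  ι := Bool
  deg x := if x then i + 1 else i
  obj x := bif x then Y else X
  d
    | false, true => f
    | _, _ => 0
  isComplex := by
    constructor
    · rintro (_ | _) (_ | _) h <;> first | rfl | exact absurd rfl h
    · rintro (_ | _) (_ | _) <;> simp

/-- Isomorphism of formal complexes: mutually inverse degree preserving matrices which commute with
the differentials. -/
def Isomorphic (C D : FormalComplex n L a b) : Prop :=
  ∃ (p : ∀ x y, C.obj x ⟶ D.obj y) (q : ∀ y x, D.obj y ⟶ C.obj x),
    (∀ x y, D.deg y ≠ C.deg x → p x y = 0) ∧
    (∀ y x, C.deg x ≠ D.deg y → q y x = 0) ∧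
    (∀ x y, ∑ z, C.d x z ≫ p z y = ∑ z, p x z ≫ D.d z y) ∧
    (∀ x x', ∑ y, p x y ≫ q y x' = kron C.obj x x') ∧
    (∀ y y', ∑ x, q y x ≫ p x y' = kron D.obj y y')

end FormalComplex

namespace PreComplex

/-- The complex with terms `N ⊕ D_i` in degree `i`, `N ⊕ D_{i+1}` in degree `i + 1` and `D_j` in the
other degrees, where `N` in degree `i` is mapped identically to `N` in degree `i + 1`; the two copies
of `N` form a subcomplex. The further entries of the differential are `u : D_{i-1} → N` and
`v : D_i → N`. -/
noncomputable def extSub (D : PreComplex n L a b) {κ : Type} [Fintype κ]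
    (N : κ → Shifted n L a b) (i : ℤ) (u v : ∀ x k, D.obj x ⟶ N k) : PreComplex n L a b where
  ι := κ ⊕ κ ⊕ D.ι
  deg := Sum.elim (fun _ => i) (Sum.elim (fun _ => i + 1) D.deg)
  obj := Sum.elim N (Sum.elim N D.obj)
  d
    | .inl k, .inr (.inl k') => kron N k k'
    | .inr (.inr x), .inl k => u x k
    | .inr (.inr x), .inr (.inl k) => v x k
    | .inr (.inr x), .inr (.inr y) => D.d x y
    | _, _ => 0

/-- The complex with terms `D_i ⊕ N` in degree `i`, `D_{i+1} ⊕ N` in degree `i + 1` and `D_j` in the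
other degrees, where `N` in degree `i` is mapped identically to `N` in degree `i + 1`; the two copies
of `N` form a quotient complex. The further entries of the differential are `v : N → D_{i+1}` and
`u : N → D_{i+2}`. -/
noncomputable def extQuot (D : PreComplex n L a b) {κ : Type} [Fintype κ]
    (N : κ → Shifted n L a b) (i : ℤ) (v u : ∀ k x, N k ⟶ D.obj x) : PreComplex n L a b where
  ι := κ ⊕ κ ⊕ D.ι
  deg := Sum.elim (fun _ => i) (Sum.elim (fun _ => i + 1) D.deg)
  obj := Sum.elim N (Sum.elim N D.obj)
  d
    | .inl k, .inr (.inl k') => kron N k k'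
    | .inl k, .inr (.inr x) => v k x
    | .inr (.inl k), .inr (.inr x) => u k x
    | .inr (.inr x), .inr (.inr y) => D.d x y
    | _, _ => 0

end PreComplex

/-- The elementary equivalences of formal complexes: isomorphisms, and the cancellation of a term
`N → N` with identity differential which appears as a subcomplex or as a quotient complex. -/
inductive FormalComplex.Step : FormalComplex n L a b → FormalComplex n L a b → Prop
  | iso {C D : FormalComplex n L a b} (h : C.Isomorphic D) : Step C D
  | sub {C D : FormalComplex n L a b} {κ : Type} [Fintype κ] (N : κ → Shifted n L a b) (i : ℤ)
      (u v : ∀ x k, D.obj x ⟶ N k) (h : C.toPreComplex = D.toPreComplex.extSub N i u v) : Step C D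
  | quot {C D : FormalComplex n L a b} {κ : Type} [Fintype κ] (N : κ → Shifted n L a b) (i : ℤ)
      (v u : ∀ k x, N k ⟶ D.obj x) (h : C.toPreComplex = D.toPreComplex.extQuot N i v u) :
      Step C D

end

/-- The morphisms `a → b` of the category `KR`: formal complexes up to the equivalence relation
generated by `FormalComplex.Step`. -/
def Mor (n : ℕ) (L : Set RelName) (a b : List Dir) : Type 1 :=
  Quot (@FormalComplex.Step n L a b)

/-- The equivalence class of a formal complex. -/
def FormalComplex.toMor {n : ℕ} {L : Set RelName} {a b : List Dir} (C : FormalComplex n L a b) :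
    Mor n L a b :=
  Quot.mk _ C

/-! ## Tangle diagrams and their complexes -/

/-- Oriented tangle diagrams, generated by strands, evaluations, coevaluations and the two
crossings under composition (`comp s t` is `s` on top of `t`) and juxtaposition. -/
inductive Tangle : List Dir → List Dir → Type
  | id (a : List Dir) : Tangle a a
  | cap (o : Dir) : Tangle [o, o.flip] []
  | cup (o : Dir) : Tangle [] [o, o.flip]
  | pos : Tangle [.up, .up] [.up, .up]
  | neg : Tangle [.up, .up] [.up, .up]
  | comp {a b c : List Dir} (s : Tangle b c) (t : Tangle a b) : Tangle a c
  | tensor {a b a' b' : List Dir} (s : Tangle a b) (t : Tangle a' b') :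
      Tangle (a ++ a') (b ++ b')

section
variable (n : ℕ) (L : Set RelName)

/-- The graph `id_a{m}`. -/
def idObj (a : List Dir) (m : ℤ) : Shifted n L a a := ⟨Graph.id a, m, rfl, rfl⟩

/-- The graph `S{m}`. -/
def wideObj (m : ℤ) : Shifted n L [.up, .up] [.up, .up] := ⟨S .up, m, rfl, rfl⟩

/-- `χ₀ : id₂{m} → S{m + 1}`. -/
def chi0Hom (m m' : ℤ) (h : m' - m = 1) : idObj n L [.up, .up] m ⟶ wideObj n L m' :=
  Hom2.gen (n := n) (L := L) .chi0 h

/-- `χ₁ : S{m} → id₂{m + 1}`. -/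
def chi1Hom (m m' : ℤ) (h : m' - m = 1) : wideObj n L m ⟶ idObj n L [.up, .up] m' :=
  Hom2.gen (n := n) (L := L) .chi1 h

/-- `α : S{m} → S{m + 2}`. -/
def alphaHom (m m' : ℤ) (h : m' - m = 2) : wideObj n L m ⟶ wideObj n L m' :=
  Hom2.gen (n := n) (L := L) .alpha h

/-- `γ : S{m} → S{m + 2}`. -/
def gammaHom (m m' : ℤ) (h : m' - m = 2) : wideObj n L m ⟶ wideObj n L m' :=
  Hom2.gen (n := n) (L := L) .gamma h

/-- `id₂{n - 1} → S{n}`, with `id₂{n - 1}` in degree zero. -/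
def posComplex : FormalComplex n L [.up, .up] [.up, .up] :=
  .two 0 (chi0Hom n L (n - 1) n (by ring))

/-- `S{-n} → id₂{1 - n}`, with `id₂{1 - n}` in degree zero. -/
def negComplex : FormalComplex n L [.up, .up] [.up, .up] :=
  .two (-1) (chi1Hom n L (-n) (1 - n) (by ring))

/-- The formal complex of a tangle diagram. -/
noncomputable def khComplex : {a b : List Dir} → Tangle a b → FormalComplex n L a b
  | _, _, .id a => .single (idObj n L a 0)
  | _, _, .cap o => .single ⟨layer ⟨[], .cap o, []⟩, 0, rfl, rfl⟩
  | _, _, .cup o => .single ⟨layer ⟨[], .cup o, []⟩, 0, rfl, rfl⟩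
  | _, _, .pos => posComplex n L
  | _, _, .neg => negComplex n L
  | _, _, .comp s t => .comp (khComplex s) (khComplex t)
  | _, _, .tensor s t => .tensor (khComplex s) (khComplex t)

/-- The Khovanov-Rozansky morphism `Kh_n` of a tangle diagram. -/
noncomputable def Kh {a b : List Dir} (t : Tangle a b) : Mor n L a b := (khComplex n L t).toMor

/-- The terms `id₂{N}`, `S{1 + N}`, `S{3 + N}`, `S{5 + N}`, … -/
def chainObj (N : ℤ) : ℕ → Shifted n L [.up, .up] [.up, .up]
  | 0 => idObj n L [.up, .up] N
  | j + 1 => wideObj n L (2 * j + 1 + N)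

/-- The arrows `χ₀`, `α`, `γ`, `α`, `γ`, … between these terms. -/
def chainStep (N : ℤ) : ∀ j : ℕ, chainObj n L N j ⟶ chainObj n L N (j + 1)
  | 0 => chi0Hom n L N _ (by push_cast; ring)
  | j + 1 =>
    if Even j then alphaHom n L _ _ (by push_cast; ring)
    else gammaHom n L _ _ (by push_cast; ring)

/-- The sequence
`[id₂ → S{1} → S{3} → S{5} → ⋯ → S{2m - 1}]{N}` with the arrows `χ₀, α, γ, α, …`, where
`id₂{N}` is in degree zero. -/
def braidChain (m : ℕ) (N : ℤ) : PreComplex n L [.up, .up] [.up, .up] where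
  ι := Fin (m + 1)
  deg i := (i : ℕ)
  obj i := chainObj n L N i
  d i j := if h : (i : ℕ) + 1 = j then chainStep n L N i ≫ eqToHom (by rw [h]) else 0

end

/-- The braid on two upward strands with `m` positive crossings. -/
def twoBraid : ℕ → Tangle [.up, .up] [.up, .up]
  | 0 => .id _
  | 1 => .pos
  | m + 2 => .comp .pos (twoBraid (m + 1))

end KR

/-! ### Matrix calculus for formal complexes: splitting terms and renaming indices. -/

namespace KR

section
variable {n : ℕ} {L : Set RelName} {a b c : List Dir}

/-! The proof is an induction on the number of crossings. Write `X₀ → X₁ → ⋯ → X_m` for the chain of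
`σ^m`, with `X₀` a shift of `id₂` and all other terms shifts of `S`. Composing with the positive
crossing gives a bicomplex with two rows: a row of `id₂ ∘ X_j`, which is the same chain shifted by
`n - 1`, and a row of `S ∘ X_j`. Vertical arrows `χ₀ ∘ 1` lead from the former to the latter.

In the second row `S ∘ X₀` is `S`, and every other `S ∘ X_j` splits into two copies of `S`, a first
and a last one. The splitting is done by `φ` if the arrow that continues the chain after `X_j` is
`α`, and by `ψ` if it is `γ`. With this choice (moy2a), (shift1) and (shift2) say that `1_S`
composed with the arrow `X_j → X_{j+1}` is exactly "project to the last summand, then include as the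
first summand" (`chainStep_wideRow`). So the row falls apart into pairs "last summand of `S ∘ X_j` →
first summand of `S ∘ X_{j+1}`" with differential `± 1`, and only the last summand of `S ∘ X_m` is
left over. The pairs are subcomplexes, so they can be cancelled without any correction term. By
(moy2b) and (moy2c) the vertical arrow into the surviving summand is `α` or `γ`, namely the next
arrow of the chain (`vcompHom_chi0_wideRowProjLast`). What remains is the chain with one more term;
this is `comp_braidChain`. That the sequence is a complex is not checked directly from relations
such as `γ α = 0`: the property is inherited under splitting and cancellation.

Two general facts about formal complexes are needed. The steps defining `Mor` allow only the
cancellation of identities in one degree; `toMor_restrict_of_sub_family` extends this to finite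
families of pairs with invertible differential in varying degrees. Moreover the induction hypothesis
is an equality of classes and not of complexes, so composition with the crossing must respect the
equivalence relation; this is `comp_two_toMor_congr`. -/

theorem comp_eq_comp_zero {C : Type*} [Category C] [Limits.HasZeroMorphisms C] {W X Y Z : C}
    {f : W ⟶ X} {g : X ⟶ Z} {h : W ⟶ Y} (hf : f = 0) : f ≫ g = h ≫ (0 : Y ⟶ Z) := by
  rw [hf, Limits.zero_comp, Limits.comp_zero]

theorem sum_inr_inr {κ κ' J M : Type*} [Fintype κ] [Fintype κ'] [Fintype J] [AddCommMonoid M]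
    (f : κ ⊕ κ' ⊕ J → M) (h : ∀ k, f (.inl k) = 0) (h' : ∀ k, f (.inr (.inl k)) = 0) :
    ∑ x, f x = ∑ j, f (.inr (.inr j)) := by
  simp [Fintype.sum_sum_type, h, h']

theorem bijective_elim_inl_inr (κ κ' J : Type*) :
    (Sum.elim .inl (Sum.elim (.inr ∘ .inl) (.inr ∘ .inr)) : κ ⊕ κ' ⊕ J → κ ⊕ κ' ⊕ J).Bijective := by
  convert Function.bijective_id
  ext (_ | _ | _) <;> rfl

namespace PreComplex

/-- The formal direct sum of all terms of a complex, as an object of the category of matrices. -/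
def total (C : PreComplex n L a b) : Mat_ (Shifted n L a b) := ⟨C.ι, C.obj⟩

/-- The differential as a matrix. -/
def dTotal (C : PreComplex n L a b) : C.total ⟶ C.total := C.d

/-- Reading the differential as one endomorphism in the category of matrices replaces manipulations
of double sums by equations between composites. -/
theorem isComplex_iff (C : PreComplex n L a b) :
    C.IsComplex ↔ (∀ x y, C.deg y ≠ C.deg x + 1 → C.d x y = 0) ∧ C.dTotal ≫ C.dTotal = 0 :=
  and_congr_right fun _ => ⟨fun h => Mat_.hom_ext _ _ h, fun h x z => congrFun (congrFun h x) z⟩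

/-- A complex all of whose terms are split into direct summands indexed by `D.ι`. The summand `i`
belongs to the term `π i`; its projection is `p i` and its inclusion is `q i`. -/
theorem isomorphic_of_splitting {C : PreComplex n L a b} (hC : C.IsComplex) (D : PreComplex n L a b)
    (π : D.ι → C.ι) (p : ∀ i, C.obj (π i) ⟶ D.obj i) (q : ∀ i, D.obj i ⟶ C.obj (π i))
    (hdeg : ∀ i, D.deg i = C.deg (π i))
    (hpq : ∀ x y, ∑ i, kron C.obj x (π i) ≫ p i ≫ q i ≫ kron C.obj (π i) y = kron C.obj x y)
    (hqp : ∀ i j, q i ≫ kron C.obj (π i) (π j) ≫ p j = kron D.obj i j)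
    (hd : ∀ i j, D.d i j = q i ≫ C.d (π i) (π j) ≫ p j) :
    ∃ h : D.IsComplex, FormalComplex.Isomorphic ⟨C, hC⟩ ⟨D, h⟩ := by
  let P : C.total ⟶ D.total := fun x i => kron C.obj x (π i) ≫ p i
  let Q : D.total ⟶ C.total := fun i x => q i ≫ kron C.obj (π i) x
  have hPQ : P ≫ Q = 𝟙 _ := by
    ext x y
    refine Eq.trans ?_ (hpq x y)
    exact Finset.sum_congr rfl fun i _ => Category.assoc _ _ _
  have hQP : Q ≫ P = 𝟙 _ := by
    ext i j
    refine Eq.trans ?_ (hqp i j)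
    change ∑ x, (q i ≫ kron C.obj (π i) x) ≫ kron C.obj x (π j) ≫ p j = _
    simp only [Category.assoc]
    rw [← Preadditive.comp_sum, sum_kron_comp (Z := D.obj j) C.obj (π i)
      fun x => kron C.obj x (π j) ≫ p j]
  -- The differential of `D` is the conjugate of that of `C` by the isomorphism `P`, `Q`. Both
  -- `D.IsComplex` and the compatibility of `P` with the differentials follow from this one formula.
  have hD : D.dTotal = Q ≫ C.dTotal ≫ P := by
    ext i j
    refine (hd i j).trans ?_
    change _ = ∑ x, (q i ≫ kron C.obj (π i) x) ≫ ∑ y, C.d x y ≫ kron C.obj y (π j) ≫ p j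
    simp only [Category.assoc]
    rw [← Preadditive.comp_sum, sum_kron_comp (Z := D.obj j) C.obj (π i)
      fun x => ∑ y, C.d x y ≫ kron C.obj y (π j) ≫ p j]
    simp only [← Category.assoc]
    rw [← Preadditive.sum_comp, sum_comp_kron]
    exact Category.assoc (q i) (C.d (π i) (π j)) (p j)
  have hdD : D.IsComplex := by
    refine (isComplex_iff D).2 ⟨fun x y h => ?_, ?_⟩
    · rw [hd, hC.1, Limits.zero_comp, Limits.comp_zero]
      rwa [← hdeg, ← hdeg]
    · have := ((isComplex_iff C).1 hC).2
      rw [hD, Category.assoc, Category.assoc, reassoc_of% hPQ, reassoc_of% this, Limits.zero_comp,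
        Limits.comp_zero]
  refine ⟨hdD, P, Q, fun x i h => ?_, fun i x h => ?_, fun x y => ?_, fun x y => ?_, fun i j => ?_⟩
  · change kron C.obj x (π i) ≫ p i = 0
    rw [kron_ne, Limits.zero_comp]
    rintro rfl
    exact h (hdeg i)
  · change q i ≫ kron C.obj (π i) x = 0
    rw [kron_ne, Limits.comp_zero]
    rintro rfl
    exact h (hdeg i).symm
  · have : C.dTotal ≫ P = P ≫ D.dTotal := by rw [hD, reassoc_of% hPQ]
    exact congrFun (congrFun this x) y
  · exact congrFun (congrFun hPQ x) y
  · exact congrFun (congrFun hQP i) j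

/-- A complex obtained by splitting each term `C.obj x` into summands indexed by `σ x`. -/
theorem isomorphic_sigma {C : PreComplex n L a b} (hC : C.IsComplex) (σ : C.ι → Type)
    [∀ x, Fintype (σ x)] (Z : ∀ x, σ x → Shifted n L a b) (p : ∀ x s, C.obj x ⟶ Z x s)
    (q : ∀ x s, Z x s ⟶ C.obj x) (hpq : ∀ x, ∑ s, p x s ≫ q x s = 𝟙 _)
    (hqp : ∀ x s t, q x s ≫ p x t = kron (Z x) s t) :
    ∃ h, FormalComplex.Isomorphic ⟨C, hC⟩
      ⟨{ ι := Σ x, σ x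
         deg := fun i => C.deg i.1
         obj := fun i => Z i.1 i.2
         d := fun i j => q i.1 i.2 ≫ C.d i.1 j.1 ≫ p j.1 j.2 }, h⟩ := by
  refine isomorphic_of_splitting hC _ Sigma.fst (fun i => p i.1 i.2) (fun i => q i.1 i.2)
    (fun _ => rfl) (fun x y => ?_) ?_ fun _ _ => rfl
  · rw [Fintype.sum_sigma]
    have : ∀ z, ∑ s : σ z, kron C.obj x z ≫ p z s ≫ q z s ≫ kron C.obj z y =
        kron C.obj x z ≫ kron C.obj z y := by
      intro z
      rw [← Preadditive.comp_sum]
      simp only [← Category.assoc (p z _)]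
      rw [← Preadditive.sum_comp, hpq, Category.id_comp]
    simp only [this]
    exact sum_kron_comp C.obj x fun z => kron C.obj z y
  · rintro ⟨x, s⟩ ⟨y, t⟩
    by_cases h : x = y
    · subst h
      simp only [kron_self, Category.id_comp, hqp]
      by_cases h : s = t
      · subst h
        simp only [kron_self]
      · rw [kron_ne _ h, kron_ne]
        simpa using h
    · rw [kron_ne _ h, kron_ne, Limits.zero_comp, Limits.comp_zero]
      simp [h]

/-- Isomorphic terms and a renaming of the indices. -/
theorem isomorphic_of_bijective {C : PreComplex n L a b} (hC : C.IsComplex)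
    (D : PreComplex n L a b) (e : D.ι → C.ι) (he : e.Bijective)
    (f : ∀ i, C.obj (e i) ≅ D.obj i) (hdeg : ∀ i, D.deg i = C.deg (e i))
    (hd : ∀ i j, C.d (e i) (e j) ≫ (f j).hom = (f i).hom ≫ D.d i j) :
    ∃ h : D.IsComplex, FormalComplex.Isomorphic ⟨C, hC⟩ ⟨D, h⟩ := by
  refine isomorphic_of_splitting hC D e (fun i => (f i).hom) (fun i => (f i).inv) hdeg
    (fun x y => ?_) (fun i j => ?_) fun i j => ?_
  · simp only [Iso.hom_inv_id_assoc]
    rw [he.sum_comp fun z => kron C.obj x z ≫ kron C.obj z y]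
    exact sum_kron_comp C.obj x fun z => kron C.obj z y
  · by_cases h : i = j
    · subst h
      simp [kron_self]
    · rw [kron_ne _ h, kron_ne _ fun h' => h (he.1 h'), Limits.zero_comp, Limits.comp_zero]
  · rw [hd, Iso.inv_hom_id_assoc]

/-- The terms `C.obj (f j)` with the entries of the differential between them. -/
def restrict (C : PreComplex n L a b) {J : Type} [Fintype J] (f : J → C.ι) :
    PreComplex n L a b where
  ι := J
  deg j := C.deg (f j)
  obj j := C.obj (f j)
  d i j := C.d (f i) (f j)

end PreComplex

/-! ### Cancellation of pairs of terms with invertible differential. -/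

namespace FormalComplex

theorem Isomorphic.toMor_eq {C D : FormalComplex n L a b} (h : C.Isomorphic D) :
    C.toMor = D.toMor := Quot.sound (.iso h)

open PreComplex in
/-- Cancellation of a subcomplex of the form `A → B`, with an invertible diagonal matrix. -/
theorem toMor_restrict_of_sub {C : PreComplex n L a b} (hC : C.IsComplex) {κ J : Type} [Fintype κ]
    [Fintype J] (s t : κ → C.ι) (r : J → C.ι) (i : ℤ)
    (hb : (Sum.elim s (Sum.elim t r)).Bijective)
    (hs : ∀ k, C.deg (s k) = i) (ht : ∀ k, C.deg (t k) = i + 1)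
    (hiso : ∀ k, IsIso (C.d (s k) (t k))) (hst : ∀ k l, k ≠ l → C.d (s k) (t l) = 0)
    (hsr : ∀ k j, C.d (s k) (r j) = 0) (htr : ∀ k j, C.d (t k) (r j) = 0) :
    ∃ h : (C.restrict r).IsComplex, toMor ⟨C, hC⟩ = toMor ⟨C.restrict r, h⟩ := by
  -- All `s k` lie in degree `i` and all `t k` in degree `i + 1`, so the remaining entries among
  -- these terms vanish for degree reasons.
  have hss : ∀ k l, C.d (s k) (s l) = 0 := fun k l => hC.1 _ _ (by rw [hs, hs]; omega)
  have hts : ∀ k l, C.d (t k) (s l) = 0 := fun k l => hC.1 _ _ (by rw [hs, ht]; omega)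
  have htt : ∀ k l, C.d (t k) (t l) = 0 := fun k l => hC.1 _ _ (by rw [ht, ht]; omega)
  -- Each `C.obj (s k)` is identified with `C.obj (t k)` through the invertible entry. The diagonal
  -- matrix becomes an identity matrix, as `Step.sub` demands, and arrows into `s k` get composed
  -- with that entry.
  let E := (C.restrict r).extSub (fun k => C.obj (t k)) i
    (fun x k => C.d (r x) (s k) ≫ C.d (s k) (t k)) (fun x k => C.d (r x) (t k))
  obtain ⟨hE, hiso'⟩ := isomorphic_of_bijective hC E (Sum.elim s (Sum.elim t r)) hb
    (fun
      | .inl k => @asIso _ _ _ _ (C.d (s k) (t k)) (hiso k)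
      | .inr (.inl k) => Iso.refl (C.obj (t k))
      | .inr (.inr j) => Iso.refl (C.obj (r j)))
    (by rintro (k | k | j); exacts [(hs k).symm, (ht k).symm, rfl])
    (by
      rintro (k | k | x) (l | l | y)
      · exact comp_eq_comp_zero (hss k l)
      · change C.d (s k) (t l) ≫ 𝟙 _ = C.d (s k) (t k) ≫ kron (fun k => C.obj (t k)) k l
        by_cases h : k = l
        · subst h; simp only [kron_self]
        · rw [hst k l h, kron_ne _ h, Limits.zero_comp, Limits.comp_zero]
      · exact comp_eq_comp_zero (hsr k y)
      · exact comp_eq_comp_zero (hts k l)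
      · exact comp_eq_comp_zero (htt k l)
      · exact comp_eq_comp_zero (htr k y)
      · exact (Category.id_comp _).symm
      · exact (Category.comp_id _).trans (Category.id_comp _).symm
      · exact (Category.comp_id _).trans (Category.id_comp _).symm)
  -- Paths through a cancelled term do not contribute to the square between terms of `r`, because no
  -- arrow leads from a cancelled term back to `r`.
  have hr : (C.restrict r).IsComplex := by
    refine ⟨fun x y h => hC.1 _ _ h, fun x z => ?_⟩
    refine (sum_inr_inr _ (fun _ => ?_) fun _ => ?_).symm.trans
      (hE.2 (.inr (.inr x)) (.inr (.inr z)))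
    exacts [Limits.comp_zero, Limits.comp_zero]
  exact ⟨hr, hiso'.toMor_eq.trans (Quot.sound (.sub _ i _ _ rfl))⟩

open PreComplex in
/-- Cancellation of a quotient complex of the form `A → B`, with an invertible diagonal matrix. -/
theorem toMor_restrict_of_quot {C : PreComplex n L a b} (hC : C.IsComplex) {κ J : Type} [Fintype κ]
    [Fintype J] (s t : κ → C.ι) (r : J → C.ι) (i : ℤ)
    (hb : (Sum.elim s (Sum.elim t r)).Bijective)
    (hs : ∀ k, C.deg (s k) = i) (ht : ∀ k, C.deg (t k) = i + 1)
    (hiso : ∀ k, IsIso (C.d (s k) (t k))) (hst : ∀ k l, k ≠ l → C.d (s k) (t l) = 0)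
    (hrs : ∀ k j, C.d (r j) (s k) = 0) (hrt : ∀ k j, C.d (r j) (t k) = 0) :
    ∃ h : (C.restrict r).IsComplex, toMor ⟨C, hC⟩ = toMor ⟨C.restrict r, h⟩ := by
  have hss : ∀ k l, C.d (s k) (s l) = 0 := fun k l => hC.1 _ _ (by rw [hs, hs]; omega)
  have hts : ∀ k l, C.d (t k) (s l) = 0 := fun k l => hC.1 _ _ (by rw [hs, ht]; omega)
  have htt : ∀ k l, C.d (t k) (t l) = 0 := fun k l => hC.1 _ _ (by rw [ht, ht]; omega)
  -- Dual to the case of a subcomplex: now `C.obj (t k)` is identified with `C.obj (s k)`, and it is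
  -- the arrows out of `t k` that get composed with the invertible entry.
  let E := (C.restrict r).extQuot (fun k => C.obj (s k)) i
    (fun k x => C.d (s k) (r x)) (fun k x => C.d (s k) (t k) ≫ C.d (t k) (r x))
  obtain ⟨hE, hiso'⟩ := isomorphic_of_bijective hC E (Sum.elim s (Sum.elim t r)) hb
    (fun
      | .inl k => Iso.refl (C.obj (s k))
      | .inr (.inl k) => (@asIso _ _ _ _ (C.d (s k) (t k)) (hiso k)).symm
      | .inr (.inr j) => Iso.refl (C.obj (r j)))
    (by rintro (k | k | j); exacts [(hs k).symm, (ht k).symm, rfl])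
    (by
      rintro (k | k | x) (l | l | y)
      · exact comp_eq_comp_zero (hss k l)
      · have := hiso l
        change C.d (s k) (t l) ≫ inv (C.d (s l) (t l)) = 𝟙 _ ≫ kron (fun k => C.obj (s k)) k l
        by_cases h : k = l
        · subst h; simp only [kron_self, IsIso.hom_inv_id, Category.comp_id]
        · rw [hst k l h, kron_ne _ h, Limits.zero_comp, Limits.comp_zero]
      · exact (Category.comp_id _).trans (Category.id_comp _).symm
      · exact comp_eq_comp_zero (hts k l)
      · exact comp_eq_comp_zero (htt k l)
      · have := hiso k
        exact (Category.comp_id _).trans (IsIso.inv_hom_id_assoc (C.d (s k) (t k)) _).symm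
      · exact comp_eq_comp_zero (hrs l x)
      · exact comp_eq_comp_zero (hrt l x)
      · exact (Category.comp_id _).trans (Category.id_comp _).symm)
  have hr : (C.restrict r).IsComplex := by
    refine ⟨fun x y h => hC.1 _ _ h, fun x z => ?_⟩
    refine (sum_inr_inr _ (fun _ => ?_) fun _ => ?_).symm.trans
      (hE.2 (.inr (.inr x)) (.inr (.inr z)))
    exacts [Limits.zero_comp, Limits.zero_comp]
  exact ⟨hr, hiso'.toMor_eq.trans (Quot.sound (.quot _ i _ _ rfl))⟩

/-- Iterated cancellation of subcomplexes `A_k → B_k` with invertible differential, of varying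
degrees. -/
theorem toMor_restrict_of_sub_family {κ J : Type} [Finite κ] [Fintype J]
    {C : PreComplex n L a b} (hC : C.IsComplex) (s t : κ → C.ι) (r : J → C.ι)
    (hb : (Sum.elim s (Sum.elim t r)).Bijective) (ht : ∀ k, C.deg (t k) = C.deg (s k) + 1)
    (hiso : ∀ k, IsIso (C.d (s k) (t k))) (hst : ∀ k l, k ≠ l → C.d (s k) (t l) = 0)
    (hss : ∀ k l, C.d (s k) (s l) = 0) (hsr : ∀ k j, C.d (s k) (r j) = 0)
    (ht0 : ∀ k x, C.d (t k) x = 0) :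
    ∃ h : (C.restrict r).IsComplex, toMor ⟨C, hC⟩ = toMor ⟨C.restrict r, h⟩ := by
  induction κ using Finite.induction_empty_option generalizing C with
  | of_equiv e ih =>
    refine ih hC (s ∘ e) (t ∘ e) r ?_ (fun k => ht _) (fun k => hiso _)
      (fun k l h => hst _ _ (e.injective.ne h)) (fun k l => hss _ _) (fun k j => hsr _ _)
      (fun k x => ht0 _ _)
    convert hb.comp (Equiv.sumCongr e (Equiv.sumCongr e (Equiv.refl J))).bijective using 1
    ext (k | k | j) <;> rfl
  -- Without pairs `r` is a bijection and only a renaming of the indices is left; the degree `0` is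
  -- arbitrary.
  | h_empty =>
    refine toMor_restrict_of_sub hC s t r 0 hb (fun k => k.elim) (fun k => k.elim)
      (fun k => k.elim) (fun k => k.elim) (fun k => k.elim) (fun k => k.elim)
  | h_option ih =>
    rename_i κ _
    have := Fintype.ofFinite κ
    -- One pair is cancelled at a time, since a single step handles one degree only. The other pairs
    -- count as remaining terms, so arrows from `s none` to them must vanish. For arrows between the
    -- `s k` this is a genuine hypothesis, as their degrees may be consecutive.
    let r' : κ ⊕ κ ⊕ J → C.ι := Sum.elim (s ∘ some) (Sum.elim (t ∘ some) r)
    obtain ⟨h, e⟩ := toMor_restrict_of_sub hC (fun _ : Unit => s none) (fun _ => t none) r'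
      (C.deg (s none))
      (by
        let g : Unit ⊕ Unit ⊕ (κ ⊕ κ ⊕ J) → Option κ ⊕ Option κ ⊕ J :=
          Sum.elim (fun _ => .inl none) (Sum.elim (fun _ => .inr (.inl none))
            (Sum.elim (.inl ∘ some) (Sum.elim (.inr ∘ .inl ∘ some) (.inr ∘ .inr))))
        have hg : g.Bijective := by
          constructor
          · rintro (_ | _ | _ | _ | _) (_ | _ | _ | _ | _) h <;> cases h <;> rfl
          · rintro ((_ | k) | (_ | k) | j)
            exacts [⟨.inl (), rfl⟩, ⟨.inr (.inr (.inl k)), rfl⟩, ⟨.inr (.inl ()), rfl⟩,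
              ⟨.inr (.inr (.inr (.inl k))), rfl⟩, ⟨.inr (.inr (.inr (.inr j))), rfl⟩]
        convert hb.comp hg using 1
        ext (_ | _ | _ | _ | _) <;> rfl)
      (fun _ => rfl) (fun _ => ht none) (fun _ => hiso none) (fun k l h => absurd rfl h)
      (by
        rintro _ (k | k | j)
        exacts [hss _ _, hst _ _ nofun, hsr _ _])
      (fun _ _ => ht0 _ _)
    obtain ⟨h', e'⟩ := ih (C := C.restrict r') h .inl (.inr ∘ .inl) (.inr ∘ .inr)
      (bijective_elim_inl_inr _ _ _)
      (fun k => ht _) (fun k => hiso _) (fun k l h => hst _ _ (by simpa using h))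
      (fun k l => hss _ _) (fun k l => hsr _ _) (fun k x => ht0 _ _)
    exact ⟨h', e.trans e'⟩

end FormalComplex

end

end KR

/-! ### Composition of formal complexes and its compatibility with the equivalence relation. -/

namespace KR

section
variable {n : ℕ} {L : Set RelName} {a b c : List Dir}

theorem units_smul_comp {X Y Z : Shifted n L a b} (s : ℤˣ) (f : X ⟶ Y) (g : Y ⟶ Z) :
    (s • f) ≫ g = s • (f ≫ g) := by
  rcases Int.units_eq_one_or s with rfl | rfl <;> simp [Units.neg_smul]

theorem comp_units_smul {X Y Z : Shifted n L a b} (s : ℤˣ) (f : X ⟶ Y) (g : Y ⟶ Z) :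
    f ≫ (s • g) = s • (f ≫ g) := by
  rcases Int.units_eq_one_or s with rfl | rfl <;> simp [Units.neg_smul]

theorem isIso_units_smul_id (X : Shifted n L a b) (s : ℤˣ) : IsIso (s • 𝟙 X) :=
  ⟨s • 𝟙 X, by
    rcases Int.units_eq_one_or s with rfl | rfl <;> simp [Units.neg_smul]⟩

theorem kron_prod {ι κ : Type} (X : ι → Shifted n L b c) (Y : κ → Shifted n L a b) (x y : ι × κ) :
    kron (fun z : ι × κ => Shifted.vcomp (X z.1) (Y z.2)) x y =
      Shifted.vcompHom (kron X x.1 y.1) (kron Y x.2 y.2) := by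
  obtain ⟨x₁, x₂⟩ := x
  obtain ⟨y₁, y₂⟩ := y
  by_cases h₁ : x₁ = y₁
  · by_cases h₂ : x₂ = y₂
    · subst h₁ h₂
      simp only [kron_self, Shifted.vcompHom_id]
    · rw [kron_ne _ (by simp [h₂]), kron_ne Y h₂, vcompHom_zero]
  · rw [kron_ne _ (by simp [h₁]), kron_ne X h₁, zero_vcompHom]

/-- Injectivity excludes identities off the diagonal, which would arise from a repeated index. -/
theorem kron_comp_of_injective {ι κ : Type} (X : ι → Shifted n L a b) {f : κ → ι}
    (hf : f.Injective) (x y : κ) : kron X (f x) (f y) = kron (fun k => X (f k)) x y := by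
  by_cases h : x = y
  · subst h; simp only [kron_self]
  · rw [kron_ne _ h, kron_ne _ (hf.ne h)]

/-- The isomorphism is `1_M ∘ p` with inverse `1_M ∘ q`; everything follows from the interchange
law. -/
theorem FormalComplex.Isomorphic.comp_left (M : FormalComplex n L b c)
    {C D : FormalComplex n L a b} (h : C.Isomorphic D) :
    (FormalComplex.comp M C).Isomorphic (FormalComplex.comp M D) := by
  obtain ⟨p, q, hp, hq, hpd, hpq, hqp⟩ := h
  have prod_one : ∀ {C D E : FormalComplex n L a b} (p : ∀ x y, C.obj x ⟶ D.obj y)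
      (q : ∀ x y, D.obj x ⟶ E.obj y) (x : M.ι × C.ι) (y : M.ι × E.ι),
      ∑ z : M.ι × D.ι, Shifted.vcompHom (kron M.obj x.1 z.1) (p x.2 z.2) ≫
        Shifted.vcompHom (kron M.obj z.1 y.1) (q z.2 y.2) =
        Shifted.vcompHom (kron M.obj x.1 y.1) (∑ z, p x.2 z ≫ q z y.2) := by
    intro C D E p q x y
    simp only [← Shifted.vcompHom_comp]
    rw [sum_vcompHom (fun z => kron M.obj x.1 z ≫ kron M.obj z y.1) fun z => p x.2 z ≫ q z y.2,
      sum_kron_comp M.obj x.1 fun z => kron M.obj z y.1]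
  refine ⟨fun x y => Shifted.vcompHom (kron M.obj x.1 y.1) (p x.2 y.2),
    fun y x => Shifted.vcompHom (kron M.obj y.1 x.1) (q y.2 x.2), ?_, ?_, ?_, ?_, ?_⟩
  · rintro ⟨x₁, x₂⟩ ⟨y₁, y₂⟩ h
    change Shifted.vcompHom (kron M.obj x₁ y₁) (p x₂ y₂) = 0
    by_cases e : x₁ = y₁
    · subst e
      rw [hp x₂ y₂ fun h' => h (congrArg (M.deg x₁ + ·) h'), vcompHom_zero]
    · rw [kron_ne _ e, zero_vcompHom]
  · rintro ⟨y₁, y₂⟩ ⟨x₁, x₂⟩ h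
    change Shifted.vcompHom (kron M.obj y₁ x₁) (q y₂ x₂) = 0
    by_cases e : y₁ = x₁
    · subst e
      rw [hq y₂ x₂ fun h' => h (congrArg (M.deg y₁ + ·) h'), vcompHom_zero]
    · rw [kron_ne _ e, zero_vcompHom]
  · rintro ⟨x₁, x₂⟩ ⟨y₁, y₂⟩
    change ∑ z : M.ι × C.ι, (Shifted.vcompHom (M.d x₁ z.1) (kron C.obj x₂ z.2) +
        (M.deg x₁).negOnePow • Shifted.vcompHom (kron M.obj x₁ z.1) (C.d x₂ z.2)) ≫
        Shifted.vcompHom (kron M.obj z.1 y₁) (p z.2 y₂) =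
      ∑ z : M.ι × D.ι, Shifted.vcompHom (kron M.obj x₁ z.1) (p x₂ z.2) ≫
        (Shifted.vcompHom (M.d z.1 y₁) (kron D.obj z.2 y₂) +
          (M.deg z.1).negOnePow • Shifted.vcompHom (kron M.obj z.1 y₁) (D.d z.2 y₂))
    -- The sign depends on the intermediate index `z.1`, but the Kronecker factor kills every
    -- summand with `z.1 ≠ x₁`, so the sign can be pulled out of the sum.
    have sign : ∀ z : M.ι × D.ι, Shifted.vcompHom (kron M.obj x₁ z.1) (p x₂ z.2) ≫
        ((M.deg z.1).negOnePow • Shifted.vcompHom (kron M.obj z.1 y₁) (D.d z.2 y₂)) =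
        (M.deg x₁).negOnePow • (Shifted.vcompHom (kron M.obj x₁ z.1) (p x₂ z.2) ≫
          Shifted.vcompHom (kron M.obj z.1 y₁) (D.d z.2 y₂)) := by
      rintro ⟨z, w⟩
      rw [comp_units_smul]
      by_cases e : x₁ = z
      · subst e; rfl
      · simp only [kron_ne M.obj e, zero_vcompHom, Limits.zero_comp, smul_zero]
    simp only [Preadditive.add_comp, Preadditive.comp_add, sign, units_smul_comp,
      Finset.sum_add_distrib, ← Finset.smul_sum]
    rw [prod_one C.d p (x₁, x₂) (y₁, y₂), prod_one p D.d (x₁, x₂) (y₁, y₂)]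
    simp only [hpd]
    congr 1
    simp only [← Shifted.vcompHom_comp]
    rw [sum_vcompHom (fun z => M.d x₁ z ≫ kron M.obj z y₁) fun z => kron C.obj x₂ z ≫ p z y₂,
      sum_vcompHom (fun z => kron M.obj x₁ z ≫ M.d z y₁) fun z => p x₂ z ≫ kron D.obj z y₂,
      sum_kron_comp C.obj x₂ fun z => p z y₂, sum_kron_comp M.obj x₁ fun z => M.d z y₁,
      sum_comp_kron, sum_comp_kron]
  · intro x y
    exact (prod_one p q x y).trans (by rw [hpq]; exact (kron_prod M.obj C.obj x y).symm)
  · intro x y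
    exact (prod_one q p x y).trans (by rw [hqp]; exact (kron_prod M.obj D.obj x y).symm)

namespace FormalComplex

section
variable (M : FormalComplex n L b c) (C : FormalComplex n L a b)

/-- An entry of `M.d` from a term to itself would preserve the degree, hence is zero; only the
differential of `C` contributes inside a row. -/
theorem comp_d_self (β : M.ι) (x y : C.ι) : (comp M C).d (β, x) (β, y) =
    (M.deg β).negOnePow • Shifted.vcompHom (𝟙 (M.obj β)) (C.d x y) := by
  change Shifted.vcompHom (M.d β β) (kron C.obj x y) +
    (M.deg β).negOnePow • Shifted.vcompHom (kron M.obj β β) (C.d x y) = _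
  rw [M.isComplex.1 β β (by simp), zero_vcompHom, zero_add, kron_self]

theorem comp_d_of_ne {β β' : M.ι} (h : β ≠ β') (x y : C.ι) :
    (comp M C).d (β, x) (β', y) = Shifted.vcompHom (M.d β β') (kron C.obj x y) := by
  change Shifted.vcompHom (M.d β β') (kron C.obj x y) +
    (M.deg β).negOnePow • Shifted.vcompHom (kron M.obj β β') (C.d x y) = _
  rw [kron_ne _ h, zero_vcompHom, smul_zero, add_zero]

theorem comp_d_self_eq_zero (β : M.ι) {x y : C.ι} (h : C.d x y = 0) :
    (comp M C).d (β, x) (β, y) = 0 := by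
  refine (comp_d_self M C β x y).trans ?_
  rw [h, vcompHom_zero, smul_zero]
  rfl

theorem comp_d_of_ne_eq_zero {β β' : M.ι} (h : β ≠ β') {x y : C.ι} (h' : x ≠ y) :
    (comp M C).d (β, x) (β', y) = 0 := by
  refine (comp_d_of_ne M C h x y).trans ?_
  rw [kron_ne _ h', vcompHom_zero]
  rfl

theorem _root_.KR.isIso_units_smul_vcompHom {X : Shifted n L b c} {Y Y' : Shifted n L a b} (s : ℤˣ)
    {g : Y ⟶ Y'} (h : IsIso g) : IsIso (s • Shifted.vcompHom (𝟙 X) g) := by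
  obtain ⟨g', h₁, h₂⟩ := h
  refine ⟨s • Shifted.vcompHom (𝟙 X) g', ?_, ?_⟩
  · rw [comp_units_smul, units_smul_comp, smul_smul, Int.units_mul_self, one_smul,
      ← Shifted.vcompHom_comp, h₁, Category.comp_id, Shifted.vcompHom_id]
  · rw [comp_units_smul, units_smul_comp, smul_smul, Int.units_mul_self, one_smul,
      ← Shifted.vcompHom_comp, h₂, Category.comp_id, Shifted.vcompHom_id]

theorem isIso_comp_d_self (β : M.ι) {x y : C.ι} (h : IsIso (C.d x y)) :
    IsIso ((comp M C).d (β, x) (β, y)) := by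
  have := isIso_units_smul_vcompHom (X := M.obj β) (M.deg β).negOnePow h
  rwa [← comp_d_self] at this

end

theorem comp_two_d_true_false {X Y : Shifted n L b c} (i : ℤ) (f : X ⟶ Y)
    (C : FormalComplex n L a b) (x y : C.ι) :
    (comp (two i f) C).d (true, x) (false, y) = 0 :=
  (comp_d_of_ne (two i f) C (β := true) (β' := false) nofun x y).trans (zero_vcompHom _)

theorem comp_two_d_eq_zero {X Y : Shifted n L b c} (i : ℤ) (f : X ⟶ Y)
    (C : FormalComplex n L a b) {x y : C.ι} (h : x ≠ y) :
    (comp (two i f) C).d (false, x) (true, y) = 0 :=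
  comp_d_of_ne_eq_zero (two i f) C (β := false) (β' := true) nofun h

theorem comp_restrict_d (M : FormalComplex n L b c) (C : FormalComplex n L a b) {J : Type}
    [Fintype J] {f : J → C.ι} (hf : f.Injective) (h : (C.restrict f).IsComplex)
    (x y : M.ι × J) :
    (comp M C).d (x.1, f x.2) (y.1, f y.2) = (comp M ⟨C.restrict f, h⟩).d x y := by
  change Shifted.vcompHom _ (kron C.obj (f x.2) (f y.2)) + _ = _
  rw [kron_comp_of_injective C.obj hf]
  rfl

/-- The terms on both sides agree. The differentials differ only in whether the Kronecker symbol is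
formed before or after the restriction, so identity arrows give an isomorphism. -/
theorem toMor_restrict_comp (M : FormalComplex n L b c) {C : PreComplex n L a b} (hC : C.IsComplex)
    {J : Type} [Fintype J] (r : J → C.ι) (h : (C.restrict r).IsComplex) (hr : r.Injective) (h') :
    toMor ⟨(comp M ⟨C, hC⟩).restrict fun j : M.ι × J => (j.1, r j.2), h'⟩ =
      toMor (comp M ⟨C.restrict r, h⟩) := by
  obtain ⟨_, h⟩ := PreComplex.isomorphic_of_bijective h'
    (comp M ⟨C.restrict r, h⟩).toPreComplex id Function.bijective_id
    (fun _ => Iso.refl _) (fun _ => rfl) (fun x y => by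
      refine (Category.comp_id _).trans (Eq.trans ?_ (Category.id_comp _).symm)
      exact comp_restrict_d M ⟨C, hC⟩ hr h x y)
  exact h.toMor_eq

/-- The rearrangement of a product with `Bool` in which the summands `κ`, `κ'` in the copy `β` come
first, followed by those in the other copy. -/
def boolProdSum (β : Bool) (κ κ' J : Type) :
    κ ⊕ κ' ⊕ (κ ⊕ κ' ⊕ Bool × J) → Bool × (κ ⊕ κ' ⊕ J) :=
  Sum.elim (fun k => (β, .inl k)) (Sum.elim (fun k => (β, .inr (.inl k)))
    (Sum.elim (fun k => (!β, .inl k)) (Sum.elim (fun k => (!β, .inr (.inl k)))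
      fun j => (j.1, .inr (.inr j.2)))))

theorem bijective_boolProdSum (β : Bool) (κ κ' J : Type) :
    (boolProdSum β κ κ' J).Bijective := by
  constructor
  · rintro (_ | _ | _ | _ | ⟨_, _⟩) (_ | _ | _ | _ | ⟨_, _⟩) h <;>
      simp_all [boolProdSum, Prod.ext_iff]
  · rintro ⟨β', (k | k | j)⟩
    · by_cases h : β' = β
      · exact ⟨.inl k, by rw [h]; rfl⟩
      · exact ⟨.inr (.inr (.inl k)), by rw [Bool.eq_not_of_ne h]; rfl⟩
    · by_cases h : β' = β
      · exact ⟨.inr (.inl k), by rw [h]; rfl⟩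
      · exact ⟨.inr (.inr (.inr (.inl k))), by rw [Bool.eq_not_of_ne h]; rfl⟩
    · exact ⟨.inr (.inr (.inr (.inr (β', j)))), rfl⟩

theorem bijective_boolProdSum_elim (β : Bool) {κ J ι : Type} {s t : κ → ι} {r : J → ι}
    (hb : (Sum.elim s (Sum.elim t r)).Bijective) :
    (Sum.elim (fun k => (β, s k)) (Sum.elim (fun k => (β, t k)) (Sum.elim (fun k => (!β, s k))
      (Sum.elim (fun k => (!β, t k)) fun j : Bool × J => (j.1, r j.2))))).Bijective := by
  convert (Function.Bijective.prodMap Function.bijective_id hb).comp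
    (bijective_boolProdSum β κ κ J) using 1
  ext (_ | _ | _ | _ | _) <;> rfl

section
variable {X Y : Shifted n L b c} (i₀ : ℤ) (f : X ⟶ Y) {C : PreComplex n L a b}
  (hC : C.IsComplex) {κ J : Type} [Fintype κ] [Fintype J] (s t : κ → C.ι) (r : J → C.ι)

/-- The pairs occur twice in the composition, once under `Y` and once under `X`. The row of `Y` is a
subcomplex, so its pairs form a subcomplex of the whole and have to go first. -/
theorem comp_two_toMor_restrict_of_sub (i : ℤ) (hb : (Sum.elim s (Sum.elim t r)).Bijective)
    (hs : ∀ k, C.deg (s k) = i) (ht : ∀ k, C.deg (t k) = i + 1)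
    (hiso : ∀ k, IsIso (C.d (s k) (t k))) (hst : ∀ k l, k ≠ l → C.d (s k) (t l) = 0)
    (hsr : ∀ k j, C.d (s k) (r j) = 0) (htr : ∀ k j, C.d (t k) (r j) = 0)
    (h : (C.restrict r).IsComplex) :
    toMor (comp (two i₀ f) ⟨C, hC⟩) = toMor (comp (two i₀ f) ⟨C.restrict r, h⟩) := by
  let T := comp (two i₀ f) ⟨C, hC⟩
  let r' : κ ⊕ κ ⊕ Bool × J → Bool × C.ι := Sum.elim (fun k => (false, s k))
      (Sum.elim (fun k => (false, t k)) fun j : Bool × J => (j.1, r j.2))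
  have ne_sr : ∀ k j, s k ≠ r j := fun k j => hb.1.ne (a₁ := .inl k) (a₂ := .inr (.inr j)) nofun
  have ne_tr : ∀ k j, t k ≠ r j := fun k j =>
    hb.1.ne (a₁ := .inr (.inl k)) (a₂ := .inr (.inr j)) nofun
  obtain ⟨h₁, e₁⟩ := toMor_restrict_of_sub T.isComplex (fun k => (true, s k))
    (fun k => (true, t k)) r' (i₀ + 1 + i) (bijective_boolProdSum_elim true hb)
    (fun k => congrArg (i₀ + 1 + ·) (hs k))
    (fun k => (congrArg (i₀ + 1 + ·) (ht k)).trans (add_assoc _ _ _).symm)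
    (fun k => isIso_comp_d_self (two i₀ f) _ true (hiso k))
    (fun k l hkl => comp_d_self_eq_zero (two i₀ f) ⟨C, hC⟩ true (hst k l hkl))
    (by
      rintro k (l | l | ⟨_ | _, j⟩)
      exacts [comp_two_d_true_false i₀ f _ _ _, comp_two_d_true_false i₀ f _ _ _,
        comp_two_d_true_false i₀ f _ _ _, comp_d_self_eq_zero (two i₀ f) ⟨C, hC⟩ true (hsr k j)])
    (by
      rintro k (l | l | ⟨_ | _, j⟩)
      exacts [comp_two_d_true_false i₀ f _ _ _, comp_two_d_true_false i₀ f _ _ _,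
        comp_two_d_true_false i₀ f _ _ _, comp_d_self_eq_zero (two i₀ f) ⟨C, hC⟩ true (htr k j)])
  -- The pairs under `X` were mapped by `f` only to the same pairs under `Y`. These are gone, so the
  -- pairs under `X` now form a subcomplex too.
  obtain ⟨h₂, e₂⟩ := toMor_restrict_of_sub (C := T.restrict r') h₁ .inl (.inr ∘ .inl)
    (.inr ∘ .inr) (i₀ + i) (bijective_elim_inl_inr _ _ _)
    (fun k => congrArg (i₀ + ·) (hs k))
    (fun k => (congrArg (i₀ + ·) (ht k)).trans (add_assoc _ _ _).symm)
    (fun k => isIso_comp_d_self (two i₀ f) _ false (hiso k))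
    (fun k l hkl => comp_d_self_eq_zero (two i₀ f) ⟨C, hC⟩ false (hst k l hkl))
    (by
      rintro k ⟨_ | _, j⟩
      exacts [comp_d_self_eq_zero (two i₀ f) ⟨C, hC⟩ false (hsr k j),
        comp_two_d_eq_zero i₀ f ⟨C, hC⟩ (ne_sr k j)])
    (by
      rintro k ⟨_ | _, j⟩
      exacts [comp_d_self_eq_zero (two i₀ f) ⟨C, hC⟩ false (htr k j),
        comp_two_d_eq_zero i₀ f ⟨C, hC⟩ (ne_tr k j)])
  have hr : r.Injective := fun j j' hj => by
    simpa using hb.1 (a₁ := .inr (.inr j)) (a₂ := .inr (.inr j')) hj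
  exact e₁.trans (e₂.trans (toMor_restrict_comp (two i₀ f) hC r h hr h₂))

/-- Here the order is reversed: the row of `X` is the quotient complex, so its pairs are cancelled
first, after which nothing maps to the pairs under `Y` from outside. -/
theorem comp_two_toMor_restrict_of_quot (i : ℤ) (hb : (Sum.elim s (Sum.elim t r)).Bijective)
    (hs : ∀ k, C.deg (s k) = i) (ht : ∀ k, C.deg (t k) = i + 1)
    (hiso : ∀ k, IsIso (C.d (s k) (t k))) (hst : ∀ k l, k ≠ l → C.d (s k) (t l) = 0)
    (hrs : ∀ k j, C.d (r j) (s k) = 0) (hrt : ∀ k j, C.d (r j) (t k) = 0)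
    (h : (C.restrict r).IsComplex) :
    toMor (comp (two i₀ f) ⟨C, hC⟩) = toMor (comp (two i₀ f) ⟨C.restrict r, h⟩) := by
  let T := comp (two i₀ f) ⟨C, hC⟩
  let r' : κ ⊕ κ ⊕ Bool × J → Bool × C.ι := Sum.elim (fun k => (true, s k))
      (Sum.elim (fun k => (true, t k)) fun j : Bool × J => (j.1, r j.2))
  have ne_rs : ∀ k j, r j ≠ s k := fun k j => hb.1.ne (a₂ := .inl k) (a₁ := .inr (.inr j)) nofun
  have ne_rt : ∀ k j, r j ≠ t k := fun k j =>
    hb.1.ne (a₂ := .inr (.inl k)) (a₁ := .inr (.inr j)) nofun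
  obtain ⟨h₁, e₁⟩ := toMor_restrict_of_quot T.isComplex (fun k => (false, s k))
    (fun k => (false, t k)) r' (i₀ + i) (bijective_boolProdSum_elim false hb)
    (fun k => congrArg (i₀ + ·) (hs k))
    (fun k => (congrArg (i₀ + ·) (ht k)).trans (add_assoc _ _ _).symm)
    (fun k => isIso_comp_d_self (two i₀ f) _ false (hiso k))
    (fun k l hkl => comp_d_self_eq_zero (two i₀ f) ⟨C, hC⟩ false (hst k l hkl))
    (by
      rintro k (l | l | ⟨_ | _, j⟩)
      exacts [comp_two_d_true_false i₀ f _ _ _, comp_two_d_true_false i₀ f _ _ _,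
        comp_d_self_eq_zero (two i₀ f) ⟨C, hC⟩ false (hrs k j), comp_two_d_true_false i₀ f _ _ _])
    (by
      rintro k (l | l | ⟨_ | _, j⟩)
      exacts [comp_two_d_true_false i₀ f _ _ _, comp_two_d_true_false i₀ f _ _ _,
        comp_d_self_eq_zero (two i₀ f) ⟨C, hC⟩ false (hrt k j), comp_two_d_true_false i₀ f _ _ _])
  obtain ⟨h₂, e₂⟩ := toMor_restrict_of_quot (C := T.restrict r') h₁ .inl (.inr ∘ .inl)
    (.inr ∘ .inr) (i₀ + 1 + i) (bijective_elim_inl_inr _ _ _)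
    (fun k => congrArg (i₀ + 1 + ·) (hs k))
    (fun k => (congrArg (i₀ + 1 + ·) (ht k)).trans (add_assoc _ _ _).symm)
    (fun k => isIso_comp_d_self (two i₀ f) _ true (hiso k))
    (fun k l hkl => comp_d_self_eq_zero (two i₀ f) ⟨C, hC⟩ true (hst k l hkl))
    (by
      rintro k ⟨_ | _, j⟩
      exacts [comp_two_d_eq_zero i₀ f ⟨C, hC⟩ (ne_rs k j),
        comp_d_self_eq_zero (two i₀ f) ⟨C, hC⟩ true (hrs k j)])
    (by
      rintro k ⟨_ | _, j⟩
      exacts [comp_two_d_eq_zero i₀ f ⟨C, hC⟩ (ne_rt k j),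
        comp_d_self_eq_zero (two i₀ f) ⟨C, hC⟩ true (hrt k j)])
  have hr : r.Injective := fun j j' hj => by
    simpa using hb.1 (a₁ := .inr (.inr j)) (a₂ := .inr (.inr j')) hj
  exact e₁.trans (e₂.trans (toMor_restrict_comp (two i₀ f) hC r h hr h₂))

/-- Composition with a complex `X → Y` respects the equivalence of formal complexes. -/
theorem comp_two_toMor_congr {C D : FormalComplex n L a b} (h : C.toMor = D.toMor) :
    (comp (two i₀ f) C).toMor = (comp (two i₀ f) D).toMor := by
  -- Equality in the quotient is generated by single steps. It is enough to let the composition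
  -- descend to a map of quotients, which requires checking each kind of step once.
  let F : Mor n L a b → Mor n L a c := Quot.lift (fun C => (comp (two i₀ f) C).toMor) (by
    intro C D h
    have iso_kron : ∀ {κ : Type} (N : κ → Shifted n L a b) k, IsIso (kron N k k) :=
      fun N k => by rw [kron_self]; infer_instance
    cases h with
    | iso h => exact (h.comp_left _).toMor_eq
    | sub N i u v h =>
      obtain ⟨C, hC⟩ := C
      subst h
      exact comp_two_toMor_restrict_of_sub i₀ f hC .inl (.inr ∘ .inl) (.inr ∘ .inr) i
        (bijective_elim_inl_inr _ _ _) (fun _ => rfl) (fun _ => rfl) (iso_kron N)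
        (fun k l h => kron_ne N h) (fun _ _ => rfl) (fun _ _ => rfl) D.isComplex
    | quot N i v u h =>
      obtain ⟨C, hC⟩ := C
      subst h
      exact comp_two_toMor_restrict_of_quot i₀ f hC .inl (.inr ∘ .inl) (.inr ∘ .inr) i
        (bijective_elim_inl_inr _ _ _) (fun _ => rfl) (fun _ => rfl) (iso_kron N)
        (fun k l h => kron_ne N h) (fun _ _ => rfl) (fun _ _ => rfl) D.isComplex)
  exact congrArg F h

end

end FormalComplex

end

end KR

/-! ### The relations for `S ∘ S`, stated uniformly in `α`, `φ` and `γ`, `ψ`. -/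

namespace KR

open KR.Graph (SS S)

namespace Hom2

section
variable {n : ℕ} {L : Set RelName}

/-- The components of `φ` (for `true`) and `ψ` (for `false`). -/
def wideProj (β : Bool) (i : Fin 2) {d : ℤ} (h : d = -1 + 2 * (i : ℕ)) : Hom2 n L SS (S .up) d :=
  match β with
  | true => gen (.proj .phi i) h
  | false => gen (.proj .psi i) h

/-- The components of the inverse of `φ` (for `true`) and `ψ` (for `false`). -/
def wideIncl (β : Bool) (i : Fin 2) {d : ℤ} (h : d = -(-1 + 2 * (i : ℕ))) :
    Hom2 n L (S .up) SS d :=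
  match β with
  | true => gen (.incl .phi i) h
  | false => gen (.incl .psi i) h

/-- The arrows `α` (for `true`) and `γ` (for `false`). -/
def wideArrow (β : Bool) {d : ℤ} (h : d = 2) : Hom2 n L (S .up) (S .up) d :=
  match β with
  | true => gen .alpha h
  | false => gen .gamma h

/-- Here and below, degrees are variables constrained by equations. In `Shifted` they occur as
differences of shifts, which equal the expected integers only propositionally, and this form applies
to them without transports. -/
theorem one_comp_one {Γ : Graph} {d e k : ℤ} (hd : d = 0) (he : e = 0) (hk : k = d + e)
    (h₀ : k = 0) : comp (one Γ he) (one Γ hd) hk = (one Γ h₀ : Hom2 n L Γ Γ k) := by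
  subst hd
  obtain rfl : k = 0 := h₀
  exact one_comp _ _ _

theorem wideProj_comp_wideIncl (β : Bool) (i : Fin 2) {d e k : ℤ} (h : d = -(-1 + 2 * (i : ℕ)))
    (h' : e = -1 + 2 * (i : ℕ)) (hk : k = d + e) (h₀ : k = 0) :
    comp (wideProj β i h') (wideIncl β i h) hk = (one (S .up) h₀ : Hom2 n L _ _ k) := by
  cases β
  · exact Quot.sound (.proj_incl .psi i i.2 h h' hk h₀)
  · exact Quot.sound (.proj_incl .phi i i.2 h h' hk h₀)

theorem wideProj_comp_wideIncl_of_ne (β : Bool) {i j : Fin 2} (hij : i ≠ j) {d e k : ℤ}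
    (h : d = -(-1 + 2 * (i : ℕ))) (h' : e = -1 + 2 * (j : ℕ)) (hk : k = d + e) :
    comp (wideProj β j h') (wideIncl β i h) hk = (0 : Hom2 n L (S .up) (S .up) k) := by
  have hij' : (i : ℕ) ≠ j := fun h => hij (Fin.ext h)
  cases β
  · exact Quot.sound (.proj_incl_ne .psi i i.2 j j.2 h h' hk hij')
  · exact Quot.sound (.proj_incl_ne .phi i i.2 j j.2 h h' hk hij')

theorem sum_wideIncl_comp_wideProj (β : Bool) {d d' e e' k : ℤ} (h : d = -1 + 2 * ((0 : Fin 2) : ℕ))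
    (h' : e = -(-1 + 2 * ((0 : Fin 2) : ℕ))) (hk : k = d + e)
    (g : d' = -1 + 2 * ((1 : Fin 2) : ℕ)) (g' : e' = -(-1 + 2 * ((1 : Fin 2) : ℕ)))
    (gk : k = d' + e') (h₀ : k = 0) :
    comp (wideIncl β 0 h') (wideProj β 0 h) hk + comp (wideIncl β 1 g') (wideProj β 1 g) gk =
      (one SS h₀ : Hom2 n L SS SS k) := by
  subst h h' g g'
  cases β
  · have := Quot.sound (Rel.sum_incl_proj (n := n) (L := L) .psi h₀ fun j => by rw [h₀]; ring)
    refine Eq.trans ?_ this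
    -- `Raw.sum` is a right fold ending in the zero arrow, so a sum of two terms carries an extra `+
    -- 0`.
    exact congrArg (_ + ·) (add_zero' _).symm
  · have := Quot.sound (Rel.sum_incl_proj (n := n) (L := L) .phi h₀ fun j => by rw [h₀]; ring)
    refine Eq.trans ?_ this
    exact congrArg (_ + ·) (add_zero' _).symm

variable (hL : coreRelations ⊆ L)
include hL

/-- The first rows of (shift1) and (shift2). The letter `β` names both the arrow and the splitting
of its source, while its target is split by the other of `φ` and `ψ`. -/
theorem wideProj_zero_comp_wideArrow {β β' : Bool} (hβ : β' = !β) {d₀ d e f k : ℤ}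
    (h₀ : d₀ = 0) (h : d = 2) (he : e = d₀ + d) (hf : f = -1 + 2 * ((0 : Fin 2) : ℕ))
    (hk : k = e + f)
    (hk' : k = -1 + 2 * ((1 : Fin 2) : ℕ)) :
    comp (wideProj β' 0 hf) (vcomp (one (S .up) h₀) (wideArrow β h) rfl rfl he) hk =
      (wideProj β 1 hk' : Hom2 n L SS (S .up) k) := by
  obtain rfl : e = 2 := by omega
  obtain rfl : k = 1 := by simpa using hk'
  subst h₀ h hf hβ
  cases β
  · exact Quot.sound (.elementary _ _ (hL (by simp [coreRelations])) .shift2_zero)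
  · exact Quot.sound (.elementary _ _ (hL (by simp [coreRelations])) .shift1_zero)

theorem wideProj_one_comp_wideArrow {β β' : Bool} (hβ : β' = !β) {d₀ d e f k : ℤ}
    (h₀ : d₀ = 0) (h : d = 2) (he : e = d₀ + d) (hf : f = -1 + 2 * ((1 : Fin 2) : ℕ))
    (hk : k = e + f) :
    comp (wideProj β' 1 hf) (vcomp (one (S .up) h₀) (wideArrow β h) rfl rfl he) hk =
      (0 : Hom2 n L SS (S .up) k) := by
  obtain rfl : e = 2 := by omega
  obtain rfl : f = 1 := by simpa using hf
  obtain rfl : k = 3 := by omega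
  subst h₀ h hβ
  cases β
  · exact Quot.sound (.elementary _ _ (hL (by simp [coreRelations])) .shift2_one)
  · exact Quot.sound (.elementary _ _ (hL (by simp [coreRelations])) .shift1_one)

theorem wideProj_zero_comp_one_vcomp_chi0 {d₀ d e f k : ℤ} (h₀ : d₀ = 0) (h : d = 1)
    (he : e = d₀ + d) (hf : f = -1 + 2 * ((0 : Fin 2) : ℕ)) (hk : k = e + f) (hk' : k = 0) :
    comp (wideProj true 0 hf) (vcomp (one (S .up) h₀) (gen .chi0 h) rfl rfl he) hk =
      (one (S .up) hk' : Hom2 n L (S .up) (S .up) k) := by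
  obtain rfl : e = 1 := by omega
  subst h₀ h hf hk'
  exact Quot.sound (.elementary _ _ (hL (by simp [coreRelations])) .moy2a_zero)

theorem wideProj_one_comp_one_vcomp_chi0 {d₀ d e f k : ℤ} (h₀ : d₀ = 0) (h : d = 1)
    (he : e = d₀ + d) (hf : f = -1 + 2 * ((1 : Fin 2) : ℕ)) (hk : k = e + f) :
    comp (wideProj true 1 hf) (vcomp (one (S .up) h₀) (gen .chi0 h) rfl rfl he) hk =
      (0 : Hom2 n L (S .up) (S .up) k) := by
  obtain rfl : e = 1 := by omega
  obtain rfl : f = 1 := by simpa using hf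
  obtain rfl : k = 2 := by omega
  subst h₀ h
  exact Quot.sound (.elementary _ _ (hL (by simp [coreRelations])) .moy2a_one)

/-- The second rows of (moy2b) and (moy2c). The first rows play no role, since they describe arrows
into summands that will be cancelled as part of a subcomplex. -/
theorem wideProj_one_comp_chi0_vcomp_one (β : Bool) {d₀ d e f k : ℤ} (h₀ : d₀ = 0) (h : d = 1)
    (he : e = d + d₀) (hf : f = -1 + 2 * ((1 : Fin 2) : ℕ)) (hk : k = e + f) (hk' : k = 2) :
    comp (wideProj β 1 hf) (vcomp (gen .chi0 h) (one (S .up) h₀) rfl rfl he) hk =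
      (wideArrow β hk' : Hom2 n L (S .up) (S .up) k) := by
  obtain rfl : e = 1 := by omega
  obtain rfl : f = 1 := by simpa using hf
  subst h₀ h hk'
  cases β
  · exact Quot.sound (.elementary _ _ (hL (by simp [coreRelations])) .moy2c_one)
  · exact Quot.sound (.elementary _ _ (hL (by simp [coreRelations])) .moy2b_one)

end

section
variable {n : ℕ} {L : Set RelName}

/-- For graphs with explicit lists of layers, gluing an identity graph changes nothing by
computation, so the transports in `Rel.id_vcomp` and `Rel.vcomp_id` are along `rfl`. -/
theorem id_vcomp_wideArrow (β : Bool) {d₀ d e : ℤ} (h₀ : d₀ = 0) (h : d = 2) (he : e = d₀ + d)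
    (he' : e = 2) :
    vcomp (one (Graph.id [.up, .up]) h₀) (wideArrow β h) rfl rfl he =
      (wideArrow β he' : Hom2 n L (S .up) (S .up) e) := by
  subst h
  obtain rfl : e = 2 := by omega
  cases β
  · exact Quot.sound (.id_vcomp [.up, .up] (.gen .gamma rfl) rfl rfl h₀ he rfl rfl)
  · exact Quot.sound (.id_vcomp [.up, .up] (.gen .alpha rfl) rfl rfl h₀ he rfl rfl)

theorem id_vcomp_chi0 {d₀ d e : ℤ} (h₀ : d₀ = 0) (h : d = 1) (he : e = d₀ + d) (he' : e = 1) :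
    vcomp (one (Graph.id [.up, .up]) h₀) (gen .chi0 h) rfl rfl he =
      (gen .chi0 he' : Hom2 n L (Graph.id [.up, .up]) (S .up) e) := by
  subst h
  obtain rfl : e = 1 := by omega
  exact Quot.sound (.id_vcomp [.up, .up] (.gen .chi0 rfl) rfl rfl h₀ he rfl rfl)

theorem chi0_vcomp_id {d₀ d e : ℤ} (h₀ : d₀ = 0) (h : d = 1) (he : e = d + d₀) (he' : e = 1) :
    vcomp (gen .chi0 h) (one (Graph.id [.up, .up]) h₀) rfl rfl he =
      (gen .chi0 he' : Hom2 n L (Graph.id [.up, .up]) (S .up) e) := by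
  subst h
  obtain rfl : e = 1 := by omega
  exact Quot.sound (.vcomp_id [.up, .up] (.gen .chi0 rfl) rfl rfl h₀ he rfl rfl)

theorem one_comp_gen {Γ Δ : Graph} {d₀ d e k : ℤ} (g : Gen n Γ Δ d₀) (hd : d = d₀) (he : e = 0)
    (hk : k = d + e) (hk' : k = d₀) :
    comp (one Δ he) (gen g hd) hk = (gen g hk' : Hom2 n L Γ Δ k) := by
  subst hd
  obtain rfl : k = d := hk'
  exact one_comp _ _ _

theorem gen_comp_one {Γ Δ : Graph} {d₀ d e k : ℤ} (g : Gen n Γ Δ d₀) (hd : d = d₀) (he : e = 0)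
    (hk : k = e + d) (hk' : k = d₀) :
    comp (gen g hd) (one Γ he) hk = (gen g hk' : Hom2 n L Γ Δ k) := by
  subst hd
  obtain rfl : k = d := hk'
  exact comp_one _ _ _

theorem one_comp_wideArrow (β : Bool) {d e k : ℤ} (hd : d = 2) (he : e = 0) (hk : k = d + e)
    (hk' : k = 2) :
    comp (one (S .up) he) (wideArrow β hd) hk = (wideArrow β hk' : Hom2 n L _ _ k) := by
  cases β <;> exact one_comp_gen _ _ _ _ _

theorem wideArrow_comp_one (β : Bool) {d e k : ℤ} (hd : d = 2) (he : e = 0) (hk : k = e + d)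
    (hk' : k = 2) :
    comp (wideArrow β hd) (one (S .up) he) hk = (wideArrow β hk' : Hom2 n L _ _ k) := by
  cases β <;> exact gen_comp_one _ _ _ _ _

/-- This and its variants for `χ₀` are the commuting squares of `idRowIso_naturality` and
`vcompHom_chi0_wideRowProjLast`, where changes of shift appear as identity arrows on graphs. -/
theorem one_comp_id_vcomp_wideArrow (β : Bool) {d₀ d e f k d' f' : ℤ} (h₀ : d₀ = 0) (h : d = 2)
    (he : e = d₀ + d) (hf : f = 0) (hk : k = e + f) (h' : d' = 2) (hf' : f' = 0)
    (hk' : k = f' + d') :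
    comp (one (S .up) hf)
        (vcomp (one (Graph.id [.up, .up]) h₀) (wideArrow β h) rfl rfl he :
          Hom2 n L (S .up) (S .up) e) hk =
      (comp (wideArrow β h') (one (S .up) hf') hk' : Hom2 n L _ _ k) := by
  have h₁ : e = 2 := by omega
  have h₂ : k = 2 := by omega
  exact (congrArg (fun f => comp _ f hk) (id_vcomp_wideArrow β h₀ h he h₁)).trans
    ((one_comp_wideArrow β h₁ hf hk h₂).trans (wideArrow_comp_one β h' hf' hk' h₂).symm)

theorem one_comp_id_vcomp_chi0 {d₀ d e f k d' f' : ℤ} (h₀ : d₀ = 0) (h : d = 1)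
    (he : e = d₀ + d) (hf : f = 0) (hk : k = e + f) (h' : d' = 1) (hf' : f' = 0)
    (hk' : k = f' + d') :
    comp (one (S .up) hf)
        (vcomp (one (Graph.id [.up, .up]) h₀) (gen .chi0 h) rfl rfl he :
          Hom2 n L (Graph.id [.up, .up]) (S .up) e) hk =
      (comp (gen .chi0 h') (one (Graph.id [.up, .up]) hf') hk' : Hom2 n L _ _ k) := by
  have h₁ : e = 1 := by omega
  have h₂ : k = 1 := by omega
  exact (congrArg (fun f => comp _ f hk) (id_vcomp_chi0 h₀ h he h₁)).trans
    ((one_comp_gen .chi0 h₁ hf hk h₂).trans (gen_comp_one .chi0 h' hf' hk' h₂).symm)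

theorem one_comp_chi0_vcomp_id {d₀ d e f k d' f' : ℤ} (h₀ : d₀ = 0) (h : d = 1)
    (he : e = d + d₀) (hf : f = 0) (hk : k = e + f) (h' : d' = 1) (hf' : f' = 0)
    (hk' : k = f' + d') :
    comp (one (S .up) hf)
        (vcomp (gen .chi0 h) (one (Graph.id [.up, .up]) h₀) rfl rfl he :
          Hom2 n L (Graph.id [.up, .up]) (S .up) e) hk =
      (comp (gen .chi0 h') (one (Graph.id [.up, .up]) hf') hk' : Hom2 n L _ _ k) := by
  have h₁ : e = 1 := by omega
  have h₂ : k = 1 := by omega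
  exact (congrArg (fun f => comp _ f hk) (chi0_vcomp_id h₀ h he h₁)).trans
    ((one_comp_gen .chi0 h₁ hf hk h₂).trans (gen_comp_one .chi0 h' hf' hk' h₂).symm)

theorem wideProj_one_comp_chi0_vcomp_one' (hL : coreRelations ⊆ L) (β : Bool)
    {d₀ d e f k d' f' : ℤ} (h₀ : d₀ = 0) (h : d = 1) (he : e = d + d₀)
    (hf : f = -1 + 2 * ((1 : Fin 2) : ℕ)) (hk : k = e + f) (h' : d' = 2) (hf' : f' = 0)
    (hk' : k = f' + d') :
    comp (wideProj β 1 hf) (vcomp (gen .chi0 h) (one (S .up) h₀) rfl rfl he :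
        Hom2 n L (S .up) SS e) hk =
      (comp (wideArrow β h') (one (S .up) hf') hk' : Hom2 n L _ _ k) := by
  rw [wideArrow_comp_one β h' hf' hk' (by omega)]
  exact wideProj_one_comp_chi0_vcomp_one hL β h₀ h he hf hk _

end

end Hom2

end KR

/-! ### The two rows of the positive crossing composed with `braidChain`. -/

namespace KR

open KR.Graph (SS S)

section
variable (n : ℕ) (L : Set RelName)

/-- The arrow `α` (for `true`) or `γ` (for `false`), as a morphism of shifted graphs. -/
def wideHom (β : Bool) (m m' : ℤ) (h : m' - m = 2) : wideObj n L m ⟶ wideObj n L m' :=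
  Hom2.wideArrow (n := n) (L := L) β h

theorem chainStep_succ (N : ℤ) (j : ℕ) :
    chainStep n L N (j + 1) =
      wideHom n L (decide (Even j)) (2 * (j : ℕ) + 1 + N) (2 * (j + 1 : ℕ) + 1 + N)
        (by push_cast; ring) := by
  by_cases h : Even j
  · rw [decide_eq_true h]; exact if_pos h
  · rw [decide_eq_false h]; exact if_neg h

/-- The entries of the differential of `braidChain`. -/
def chainD (N : ℤ) (i j : ℕ) : chainObj n L N i ⟶ chainObj n L N j :=
  if h : i + 1 = j then chainStep n L N i ≫ eqToHom (by rw [h]) else 0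

theorem chainD_succ (N : ℤ) (j : ℕ) : chainD n L N j (j + 1) = chainStep n L N j := by
  simp [chainD]

theorem chainD_of_ne (N : ℤ) {i j : ℕ} (h : i + 1 ≠ j) : chainD n L N i j = 0 := by
  simp [chainD, h]

variable {n L} {N N' : ℤ} (hN : N' = N + (n - 1))

/-- The projection of `S{n} ∘ X`, for a term `X` of `braidChain`, onto its last summand. -/
def wideRowProjLast : ∀ j, (wideObj n L n).vcomp (chainObj n L N j) ⟶ chainObj n L N' (j + 1)
  | 0 => Hom2.one (n := n) (L := L) (S .up)
      (by simp [Shifted.vcomp, wideObj, chainObj, idObj]; omega)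
  | j + 1 => Hom2.wideProj (n := n) (L := L) (decide (Even j)) 1
      (by simp [Shifted.vcomp, wideObj, chainObj]; omega)

/-- The inclusion of the last summand of `S{n} ∘ X`, for a term `X` of `braidChain`. -/
def wideRowInclLast : ∀ j, chainObj n L N' (j + 1) ⟶ (wideObj n L n).vcomp (chainObj n L N j)
  | 0 => Hom2.one (n := n) (L := L) (S .up)
      (by simp [Shifted.vcomp, wideObj, chainObj, idObj]; omega)
  | j + 1 => Hom2.wideIncl (n := n) (L := L) (decide (Even j)) 1
      (by simp [Shifted.vcomp, wideObj, chainObj]; omega)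

/-- The projection of `S{n} ∘ S{m}` onto its first summand. -/
def wideRowProjFirst : ∀ j, 0 < j →
    ((wideObj n L n).vcomp (chainObj n L N j) ⟶ chainObj n L N' j)
  | 0 => fun h => absurd h (lt_irrefl 0)
  | j + 1 => fun _ => Hom2.wideProj (n := n) (L := L) (decide (Even j)) 0
      (by simp [Shifted.vcomp, wideObj, chainObj]; omega)

/-- The inclusion of the first summand of `S{n} ∘ S{m}`. -/
def wideRowInclFirst : ∀ j, 0 < j →
    (chainObj n L N' j ⟶ (wideObj n L n).vcomp (chainObj n L N j))
  | 0 => fun h => absurd h (lt_irrefl 0)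
  | j + 1 => fun _ => Hom2.wideIncl (n := n) (L := L) (decide (Even j)) 0
      (by simp [Shifted.vcomp, wideObj, chainObj]; omega)

theorem wideRowInclLast_projLast (j : ℕ) :
    wideRowInclLast (L := L) hN j ≫ wideRowProjLast hN j = 𝟙 _ := by
  cases j with
  | zero => exact Hom2.one_comp_one _ _ _ _
  | succ j => exact Hom2.wideProj_comp_wideIncl _ _ _ _ _ _

theorem wideRowInclFirst_projFirst (j : ℕ) (h : 0 < j) :
    wideRowInclFirst (L := L) hN j h ≫ wideRowProjFirst hN j h = 𝟙 _ := by
  cases j with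
  | zero => exact absurd h (lt_irrefl 0)
  | succ j => exact Hom2.wideProj_comp_wideIncl _ _ _ _ _ _

theorem wideRowInclFirst_projLast (j : ℕ) (h : 0 < j) :
    wideRowInclFirst (L := L) hN j h ≫ wideRowProjLast hN j = 0 := by
  cases j with
  | zero => exact absurd h (lt_irrefl 0)
  | succ j => exact Hom2.wideProj_comp_wideIncl_of_ne _ zero_ne_one _ _ _

theorem wideRowInclLast_projFirst (j : ℕ) (h : 0 < j) :
    wideRowInclLast (L := L) hN j ≫ wideRowProjFirst hN j h = 0 := by
  cases j with
  | zero => exact absurd h (lt_irrefl 0)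
  | succ j => exact Hom2.wideProj_comp_wideIncl_of_ne _ one_ne_zero _ _ _

theorem wideRowProj_incl_succ (j : ℕ) :
    wideRowProjFirst (L := L) hN (j + 1) j.succ_pos ≫ wideRowInclFirst hN (j + 1) j.succ_pos +
      wideRowProjLast (L := L) hN (j + 1) ≫ wideRowInclLast hN (j + 1) = 𝟙 _ :=
  Hom2.sum_wideIncl_comp_wideProj _ _ _ _ _ _ _ _

theorem wideRowProj_incl (j : ℕ) :
    wideRowProjLast (L := L) hN j ≫ wideRowInclLast hN j +
      ∑ h : PLift (0 < j), wideRowProjFirst hN j h.down ≫ wideRowInclFirst hN j h.down = 𝟙 _ := by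
  cases j with
  | zero =>
    have : IsEmpty (PLift (0 < 0)) := ⟨fun h => lt_irrefl 0 h.down⟩
    rw [Fintype.sum_empty, add_zero]
    exact Hom2.one_comp_one _ _ _ _
  | succ j =>
    have : Unique (PLift (0 < j + 1)) := ⟨⟨⟨j.succ_pos⟩⟩, fun _ => rfl⟩
    exact (congrArg (_ + ·) (Fintype.sum_unique _)).trans
      ((add_comm _ _).trans (wideRowProj_incl_succ hN j))

/-- The identification of `id₂{n - 1} ∘ X` with a shift of `X`, for a term `X` of `braidChain`. -/
def idRowIso : ∀ j, (idObj n L [.up, .up] (n - 1)).vcomp (chainObj n L N j) ≅ chainObj n L N' j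
  | 0 =>
    { hom := Hom2.one (n := n) (L := L) (Graph.id [.up, .up])
        (by simp [Shifted.vcomp, chainObj, idObj]; omega)
      inv := Hom2.one (n := n) (L := L) (Graph.id [.up, .up])
        (by simp [Shifted.vcomp, chainObj, idObj]; omega)
      hom_inv_id := Hom2.one_comp_one _ _ _ _
      inv_hom_id := Hom2.one_comp_one _ _ _ _ }
  | j + 1 =>
    { hom := Hom2.one (n := n) (L := L) (S .up)
        (by simp [Shifted.vcomp, chainObj, idObj, wideObj]; omega)
      inv := Hom2.one (n := n) (L := L) (S .up)
        (by simp [Shifted.vcomp, chainObj, idObj, wideObj]; omega)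
      hom_inv_id := Hom2.one_comp_one _ _ _ _
      inv_hom_id := Hom2.one_comp_one _ _ _ _ }

/-- The heart of the argument: in the row of `S` each arrow is a matrix with a single nonzero entry,
an identity from the last summand to the next first summand. -/
theorem chainStep_wideRow (hL : coreRelations ⊆ L) (j : ℕ) :
    Shifted.vcompHom (𝟙 (wideObj n L n)) (chainStep n L N j) =
      wideRowProjLast hN j ≫ wideRowInclFirst hN (j + 1) j.succ_pos := by
  -- An arrow into `S ∘ S` is determined by its two components. For `χ₀` they are given by (moy2a),
  -- for `α` and `γ` by (shift1) and (shift2).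
  have key : Shifted.vcompHom (𝟙 (wideObj n L n)) (chainStep n L N j) ≫
      wideRowProjFirst hN (j + 1) j.succ_pos = wideRowProjLast hN j ∧
      Shifted.vcompHom (𝟙 (wideObj n L n)) (chainStep n L N j) ≫
      wideRowProjLast hN (j + 1) = 0 := by
    cases j with
    | zero =>
      exact ⟨Hom2.wideProj_zero_comp_one_vcomp_chi0 hL _ _ _ _ _ _,
        Hom2.wideProj_one_comp_one_vcomp_chi0 hL _ _ _ _ _⟩
    | succ j =>
      rw [chainStep_succ]
      -- The alternation of `α` and `γ` is what makes the splittings of source and target differ, as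
      -- the shift relations require.
      have h : decide (Even (j + 1)) = !decide (Even j) := by
        simp [Nat.even_add_one, -Nat.not_even_iff_odd]
      exact ⟨Hom2.wideProj_zero_comp_wideArrow hL h _ _ _ _ _ _,
        Hom2.wideProj_one_comp_wideArrow hL h _ _ _ _ _⟩
  rw [← Category.comp_id (Shifted.vcompHom _ _), ← wideRowProj_incl_succ hN j,
    Preadditive.comp_add, ← Category.assoc, ← Category.assoc, key.1, key.2, Limits.zero_comp,
    add_zero]

theorem idRowIso_naturality (j : ℕ) :
    Shifted.vcompHom (𝟙 (idObj n L [.up, .up] (n - 1))) (chainStep n L N j) ≫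
      (idRowIso hN (j + 1)).hom = (idRowIso hN j).hom ≫ chainStep n L N' j := by
  cases j with
  | zero => exact Hom2.one_comp_id_vcomp_chi0 _ _ _ _ _ _ _ _
  | succ j =>
    rw [chainStep_succ, chainStep_succ]
    exact Hom2.one_comp_id_vcomp_wideArrow _ _ _ _ _ _ _ _ _

/-- The parity that selects the splitting of `S ∘ X_j` also selects the arrow after `X_j`, so the
vertical component is exactly the next arrow of the chain. For `j = 0` this is the unit law for
`χ₀`. -/
theorem vcompHom_chi0_wideRowProjLast (hL : coreRelations ⊆ L) (j : ℕ) :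
    Shifted.vcompHom (chi0Hom n L (n - 1) n (by ring)) (𝟙 (chainObj n L N j)) ≫
      wideRowProjLast hN j = (idRowIso hN j).hom ≫ chainStep n L N' j := by
  cases j with
  | zero => exact Hom2.one_comp_chi0_vcomp_id _ _ _ _ _ _ _ _
  | succ j =>
    rw [chainStep_succ]
    exact Hom2.wideProj_one_comp_chi0_vcomp_one' hL _ _ _ _ _ _ _ _ _

/-- The arrows of the row end in first summands, so last summands receive nothing from the row. -/
theorem chainD_wideRow_projLast (hL : coreRelations ⊆ L) (i j : ℕ) :
    Shifted.vcompHom (𝟙 (wideObj n L n)) (chainD n L N i j) ≫ wideRowProjLast hN j = 0 := by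
  by_cases h : i + 1 = j
  · subst h
    rw [chainD_succ, chainStep_wideRow hN hL, Category.assoc, wideRowInclFirst_projLast,
      Limits.comp_zero]
  · rw [chainD_of_ne n L N h, vcompHom_zero, Limits.zero_comp]

/-- The arrows of the row start at last summands, so nothing leaves a first summand. This makes the
cancelled pairs subcomplexes. -/
theorem wideRowInclFirst_chainD (hL : coreRelations ⊆ L) (i j : ℕ) (hi : 0 < i) :
    wideRowInclFirst hN i hi ≫ Shifted.vcompHom (𝟙 (wideObj n L n)) (chainD n L N i j) = 0 := by
  by_cases h : i + 1 = j
  · subst h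
    rw [chainD_succ, chainStep_wideRow hN hL, ← Category.assoc, wideRowInclFirst_projLast,
      Limits.zero_comp]
  · rw [chainD_of_ne n L N h, vcompHom_zero, Limits.comp_zero]

theorem wideRowInclLast_chainD_projFirst (hL : coreRelations ⊆ L) (j : ℕ) :
    wideRowInclLast hN j ≫ Shifted.vcompHom (𝟙 (wideObj n L n)) (chainD n L N j (j + 1)) ≫
      wideRowProjFirst hN (j + 1) j.succ_pos = 𝟙 _ := by
  rw [chainD_succ, chainStep_wideRow hN hL, Category.assoc, wideRowInclFirst_projFirst,
    Category.comp_id, wideRowInclLast_projLast]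

theorem idRowIso_inv_chainD (i j : ℕ) :
    (idRowIso hN i).inv ≫ Shifted.vcompHom (𝟙 (idObj n L [.up, .up] (n - 1))) (chainD n L N i j) ≫
      (idRowIso hN j).hom = chainD n L N' i j := by
  by_cases h : i + 1 = j
  · subst h
    rw [chainD_succ, chainD_succ, idRowIso_naturality hN, Iso.inv_hom_id_assoc]
  · rw [chainD_of_ne n L N h, chainD_of_ne n L N' h, vcompHom_zero, Limits.zero_comp,
      Limits.comp_zero]

end

end KR

/-! ### The induction step and the braid `σ^m`. -/

namespace KR

section
variable {n : ℕ} {L : Set RelName}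

/-- A variant of `isomorphic_of_bijective`, with the bijection in the other direction. -/
theorem PreComplex.isomorphic_of_bijective' {a b : List Dir} {C : PreComplex n L a b}
    (hC : C.IsComplex) (D : PreComplex n L a b) (e : C.ι → D.ι) (he : e.Bijective)
    (f : ∀ x, C.obj x ≅ D.obj (e x)) (hdeg : ∀ x, D.deg (e x) = C.deg x)
    (hd : ∀ x y, C.d x y ≫ (f y).hom = (f x).hom ≫ D.d (e x) (e y)) :
    ∃ h : D.IsComplex, FormalComplex.Isomorphic ⟨C, hC⟩ ⟨D, h⟩ := by
  let E := Equiv.ofBijective e he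
  have hE : ∀ i, e (E.symm i) = i := E.apply_symm_apply
  refine isomorphic_of_bijective hC D E.symm E.symm.bijective
    (fun i => f (E.symm i) ≪≫ eqToIso (congrArg D.obj (hE i)))
    (fun i => by rw [← hdeg, hE]) fun i j => ?_
  -- With `i` and `j` free, the transports disappear by substitution; this would be impossible for
  -- the values of `E.symm` directly.
  have key : ∀ x y i j (hi : e x = i) (hj : e y = j),
      C.d x y ≫ (f y).hom ≫ eqToHom (congrArg D.obj hj) =
        ((f x).hom ≫ eqToHom (congrArg D.obj hi)) ≫ D.d i j := by
    rintro x y _ _ rfl rfl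
    simp [hd]
  exact key _ _ i j (hE i) (hE j)

/-- The summands of the terms of the composition of the positive crossing with `braidChain`: a term
of the row of `S` has a last summand `none` and, unless it comes from `id₂`, a first summand. -/
def crossingSummand (x : Bool × ℕ) : Type :=
  match x with
  | (false, _) => Unit
  | (true, j) => Option (PLift (0 < j))

instance (x : Bool × ℕ) : Fintype (crossingSummand x) :=
  match x with
  | (false, _) => inferInstanceAs (Fintype Unit)
  | (true, j) => inferInstanceAs (Fintype (Option (PLift (0 < j))))

/-- The graph of a summand. -/
def crossingSummandObj (N' : ℤ) : ∀ x, crossingSummand x → Shifted n L [.up, .up] [.up, .up]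
  | (false, j), _ => chainObj n L N' j
  | (true, j), none => chainObj n L N' (j + 1)
  | (true, j), some _ => chainObj n L N' j

variable {N N' : ℤ} (hN : N' = N + (n - 1))

/-- The projection onto a summand. -/
def crossingSummandProj : ∀ (x : Bool × ℕ) (s : crossingSummand x),
    (((posComplex n L).obj x.1).vcomp (chainObj n L N x.2) ⟶
      crossingSummandObj (n := n) (L := L) N' x s)
  | (false, j), _ => (idRowIso hN j).hom
  | (true, j), none => wideRowProjLast hN j
  | (true, j), some h => wideRowProjFirst hN j h.down

/-- The inclusion of a summand. -/
def crossingSummandIncl : ∀ (x : Bool × ℕ) (s : crossingSummand x),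
    (crossingSummandObj (n := n) (L := L) N' x s ⟶
      ((posComplex n L).obj x.1).vcomp (chainObj n L N x.2))
  | (false, j), _ => (idRowIso hN j).inv
  | (true, j), none => wideRowInclLast hN j
  | (true, j), some h => wideRowInclFirst hN j h.down

theorem crossingSummand_sum (x : Bool × ℕ) :
    ∑ s, crossingSummandProj (L := L) hN x s ≫ crossingSummandIncl hN x s = 𝟙 _ := by
  obtain ⟨_ | _, j⟩ := x
  · exact (Fintype.sum_unique (ι := Unit) _).trans (idRowIso hN j).hom_inv_id
  · exact (Fintype.sum_option (α := PLift (0 < j)) _).trans (wideRowProj_incl hN j)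

theorem crossingSummand_kron (x : Bool × ℕ) (s t : crossingSummand x) :
    crossingSummandIncl (L := L) hN x s ≫ crossingSummandProj hN x t =
      kron (crossingSummandObj N' x) s t := by
  obtain ⟨_ | _, j⟩ := x
  · exact (idRowIso hN j).inv_hom_id.trans (kron_self (crossingSummandObj N' (false, j)) ()).symm
  · have ne : ∀ t, (none : Option (PLift (0 < j))) ≠ some t := nofun
    rcases s with _ | s <;> rcases t with _ | t
    · exact (wideRowInclLast_projLast hN j).trans
        (kron_self (crossingSummandObj N' (true, j)) none).symm
    · exact (wideRowInclLast_projFirst hN j t.down).trans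
        (kron_ne (crossingSummandObj N' (true, j)) (ne t)).symm
    · exact (wideRowInclFirst_projLast hN j s.down).trans
        (kron_ne (crossingSummandObj N' (true, j)) (ne s).symm).symm
    · obtain rfl : s = t := by cases s; cases t; rfl
      exact (wideRowInclFirst_projFirst hN j s.down).trans
        (kron_self (crossingSummandObj N' (true, j)) (some s)).symm

theorem comp_comp_eq_zero {C : Type*} [Category C] [Limits.HasZeroMorphisms C] {W X Y Z : C}
    {f : W ⟶ X} {g : X ⟶ Y} {h : Y ⟶ Z} (hg : g = 0) : f ≫ g ≫ h = 0 := by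
  rw [hg, Limits.zero_comp, Limits.comp_zero]

theorem comp_comp_eq_zero_of_left {C : Type*} [Category C] [Limits.HasZeroMorphisms C]
    {W X Y Z : C} {f : W ⟶ X} {g : X ⟶ Y} {h : Y ⟶ Z} (hg : f ≫ g = 0) : f ≫ g ≫ h = 0 := by
  rw [← Category.assoc, hg, Limits.zero_comp]

theorem comp_comp_eq_zero_of_right {C : Type*} [Category C] [Limits.HasZeroMorphisms C]
    {W X Y Z : C} {f : W ⟶ X} {g : X ⟶ Y} {h : Y ⟶ Z} (hg : g ≫ h = 0) : f ≫ g ≫ h = 0 := by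
  rw [hg, Limits.comp_zero]

theorem smul_chainD_wideRow_projLast (hL : coreRelations ⊆ L) (u : ℤˣ) (i j : ℕ) :
    (u • Shifted.vcompHom (𝟙 (wideObj n L n)) (chainD n L N i j)) ≫ wideRowProjLast hN j = 0 := by
  rw [units_smul_comp, chainD_wideRow_projLast hN hL, smul_zero]

theorem wideRowInclFirst_smul_chainD (hL : coreRelations ⊆ L) (u : ℤˣ) (i j : ℕ) (hi : 0 < i) :
    wideRowInclFirst hN i hi ≫ (u • Shifted.vcompHom (𝟙 (wideObj n L n)) (chainD n L N i j)) =
      0 := by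
  rw [comp_units_smul, wideRowInclFirst_chainD hN hL, smul_zero]

/-- The total complex puts the sign `-1` on the row of degree one, so the entry to be cancelled is
invertible but not an identity. -/
theorem isIso_smul_chainD (hL : coreRelations ⊆ L) (u : ℤˣ) (j : ℕ) :
    IsIso (wideRowInclLast hN j ≫
      (u • Shifted.vcompHom (𝟙 (wideObj n L n)) (chainD n L N j (j + 1))) ≫
      wideRowProjFirst hN (j + 1) j.succ_pos) := by
  rw [units_smul_comp, comp_units_smul, wideRowInclLast_chainD_projFirst hN hL]
  exact isIso_units_smul_id _ u

theorem comp_braidChain_d_self {m : ℕ} (hm : (braidChain n L m N).IsComplex) (β : Bool)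
    (i j : Fin (m + 1)) :
    (FormalComplex.comp (posComplex n L) ⟨_, hm⟩).d (β, i) (β, j) =
      ((posComplex n L).deg β).negOnePow • Shifted.vcompHom (𝟙 ((posComplex n L).obj β))
        (chainD n L N i j) :=
  FormalComplex.comp_d_self (posComplex n L) ⟨_, hm⟩ β i j

theorem comp_braidChain_d_self_eq_zero {m : ℕ} (hm : (braidChain n L m N).IsComplex) (β : Bool)
    {i j : Fin (m + 1)} (h : (i : ℕ) + 1 ≠ j) :
    (FormalComplex.comp (posComplex n L) ⟨_, hm⟩).d (β, i) (β, j) = 0 := by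
  refine (comp_braidChain_d_self hm β i j).trans ?_
  rw [chainD_of_ne n L N h, vcompHom_zero, smul_zero]
  rfl

/-- Vertical arrows preserve the position in the chain, so only the last term of the row of `id₂`
maps to the surviving summand. -/
theorem comp_braidChain_d_last (hN : N' = N + (n - 1)) (hL : coreRelations ⊆ L) {m : ℕ}
    (hm : (braidChain n L m N).IsComplex) (i : Fin (m + 1)) :
    (idRowIso hN i).inv ≫
      (FormalComplex.comp (posComplex n L) ⟨_, hm⟩).d (false, i) (true, Fin.last m) ≫
        wideRowProjLast hN m = chainD n L N' i (m + 1) := by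
  induction i using Fin.lastCases with
  | last =>
    refine .trans ?_ (chainD_succ n L N' m).symm
    rw [← Iso.inv_hom_id_assoc (idRowIso hN m) (chainStep n L N' m),
      ← vcompHom_chi0_wideRowProjLast hN hL]
    refine congrArg (fun d => (idRowIso hN m).inv ≫ d ≫ wideRowProjLast hN m) ?_
    refine (FormalComplex.comp_d_of_ne (posComplex n L) ⟨_, hm⟩ (β := false) (β' := true) nofun
      _ _).trans ?_
    exact congrArg (Shifted.vcompHom (chi0Hom n L (n - 1) n (by ring))) (kron_self _ _)
  | cast k =>
    refine (comp_comp_eq_zero ?_).trans (chainD_of_ne n L N' ?_).symm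
    · exact FormalComplex.comp_two_d_eq_zero 0 (chi0Hom n L (n - 1) n (by ring)) ⟨_, hm⟩
        (Fin.castSucc_lt_last k).ne
    · have := k.2
      simp; omega

/-- The composition of the positive crossing with `braidChain` is equivalent to a longer
`braidChain`. -/
theorem comp_braidChain (hN : N' = N + (n - 1)) (hL : coreRelations ⊆ L) {m : ℕ}
    (hm : (braidChain n L m N).IsComplex) :
    ∃ h : (braidChain n L (m + 1) N').IsComplex,
      (FormalComplex.comp (posComplex n L) ⟨_, hm⟩).toMor = FormalComplex.toMor ⟨_, h⟩ := by
  let T := FormalComplex.comp (posComplex n L) ⟨_, hm⟩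
  let pt : Bool × Fin (m + 1) → Bool × ℕ := fun x => (x.1, x.2)
  obtain ⟨hW, e₁⟩ := PreComplex.isomorphic_sigma T.isComplex (fun x => crossingSummand (pt x))
    (fun x => crossingSummandObj N' (pt x)) (fun x => crossingSummandProj hN (pt x))
    (fun x => crossingSummandIncl hN (pt x)) (fun x => crossingSummand_sum hN (pt x))
    (fun x => crossingSummand_kron hN (pt x))
  let I := Σ x : Bool × Fin (m + 1), crossingSummand (pt x)
  -- The pairs to cancel lead from the last summand of `S ∘ X_k` to the first summand of `S ∘
  -- X_{k+1}`, for `k < m`. There remain the row of `id₂` and the last summand of `S ∘ X_m`.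
  let s : Fin m → I := fun k => ⟨(true, k.castSucc), (none : Option (PLift (0 < (k : ℕ))))⟩
  let t : Fin m → I := fun k =>
    ⟨(true, k.succ), (some ⟨k.1.succ_pos⟩ : Option (PLift (0 < (k : ℕ) + 1)))⟩
  let r : Fin (m + 1) ⊕ Unit → I := Sum.elim (fun j => ⟨(false, j), ()⟩)
    fun _ => ⟨(true, Fin.last m), (none : Option (PLift (0 < m)))⟩
  have hst : ∀ k l : Fin m, k ≠ l → T.d (true, k.castSucc) (true, l.succ) = 0 := by
    intro k l hkl
    exact comp_braidChain_d_self_eq_zero hm true fun h => hkl (Fin.ext (by simpa using h))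
  have hl : ∀ i j : Fin (m + 1), T.d (true, i) (true, j) ≫ wideRowProjLast hN j = 0 := fun i j =>
    (congrArg (· ≫ wideRowProjLast hN j) (comp_braidChain_d_self hm true i j)).trans
      (smul_chainD_wideRow_projLast hN hL _ i j)
  have hf : ∀ (i j : Fin (m + 1)) (h : 0 < (i : ℕ)),
      wideRowInclFirst hN i h ≫ T.d (true, i) (true, j) = 0 := fun i j h =>
    (congrArg (wideRowInclFirst hN i h ≫ ·) (comp_braidChain_d_self hm true i j)).trans
      (wideRowInclFirst_smul_chainD hN hL _ i j h)
  have htf : ∀ i j : Fin (m + 1), T.d (true, i) (false, j) = 0 := fun i j =>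
    FormalComplex.comp_two_d_true_false 0 (chi0Hom n L (n - 1) n (by ring)) ⟨_, hm⟩ i j
  have hb : (Sum.elim s (Sum.elim t r)).Bijective := by
    constructor
    -- Row, position and kind of summand already distinguish the indices; `F` forgets the dependent
    -- types.
    · let F : I → Bool × ℕ × Bool := fun x => match x with
        | ⟨(false, j), _⟩ => (false, j, false)
        | ⟨(true, j), none⟩ => (true, j, false)
        | ⟨(true, j), some _⟩ => (true, j, true)
      rintro (k | k | k | k) (l | l | l | l) h
      all_goals
        have h' := congrArg F h
        simp [F, s, t, r, Fin.ext_iff] at h' ⊢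
        try omega
    · rintro ⟨⟨_ | _, j⟩, x⟩
      · exact ⟨.inr (.inr (.inl j)), rfl⟩
      · rcases x with _ | x
        · induction j using Fin.lastCases with
          | last => exact ⟨.inr (.inr (.inr ())), rfl⟩
          | cast k => exact ⟨.inl k, rfl⟩
        -- A first summand exists only at positive positions, so each one is the target of a pair.
        · induction j using Fin.cases with
          | zero => exact absurd x.down (lt_irrefl 0)
          | succ k => exact ⟨.inr (.inl k), rfl⟩
  have he : (Sum.elim Fin.castSucc fun _ => Fin.last (m + 1) :
      Fin (m + 1) ⊕ Unit → Fin (m + 2)).Bijective := by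
    constructor
    · rintro (k | k) (l | l) h <;> simp [Fin.ext_iff] at h ⊢ <;> omega
    · intro j
      induction j using Fin.lastCases with
      | last => exact ⟨.inr (), rfl⟩
      | cast k => exact ⟨.inl k, rfl⟩
  obtain ⟨h₂, e₂⟩ := FormalComplex.toMor_restrict_of_sub_family hW s t r hb
    (fun k => by
      change (posComplex n L).deg true + ((k.succ : ℕ) : ℤ) =
        (posComplex n L).deg true + ((k.castSucc : ℕ) : ℤ) + 1
      simp [add_assoc])
    (fun k => by
      have := isIso_smul_chainD (N := N) hN hL ((posComplex n L).deg true).negOnePow k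
      refine Eq.mp (congrArg (fun d => IsIso (wideRowInclLast hN k ≫ d ≫
        wideRowProjFirst hN (k + 1) k.1.succ_pos)) ?_) this
      exact (comp_braidChain_d_self hm true k.castSucc k.succ).symm)
    (fun k l h => comp_comp_eq_zero (hst k l h))
    (fun k l => comp_comp_eq_zero_of_right (hl _ _))
    (by
      rintro k (j | _)
      · exact comp_comp_eq_zero (htf _ _)
      · exact comp_comp_eq_zero_of_right (hl _ _))
    (by
      rintro k ⟨⟨_ | _, j⟩, x⟩
      · exact comp_comp_eq_zero (htf _ _)
      · exact comp_comp_eq_zero_of_left (hf k.succ j k.1.succ_pos))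
  -- The surviving `S` is the new final term. No signs need correcting: the row of `id₂` has degree
  -- zero and the vertical arrows carry no sign.
  obtain ⟨h₃, e₃⟩ := PreComplex.isomorphic_of_bijective' h₂ (braidChain n L (m + 1) N')
    (Sum.elim Fin.castSucc fun _ => Fin.last (m + 1)) he
    (fun
      | .inl j => Iso.refl (chainObj n L N' j)
      | .inr _ => Iso.refl (chainObj n L N' (m + 1)))
    (by
      rintro (j | _)
      · exact (zero_add _).symm
      · change ((m + 1 : ℕ) : ℤ) = 0 + 1 + (m : ℤ)
        push_cast; ring)
    (by
      rintro (i | _) (j | _) <;>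
        refine (Category.comp_id _).trans (.trans ?_ (Category.id_comp _).symm)
      · refine .trans ?_ (idRowIso_inv_chainD hN i j)
        refine congrArg (fun d => (idRowIso hN i).inv ≫ d ≫ (idRowIso hN j).hom) ?_
        refine (comp_braidChain_d_self hm false i j).trans ?_
        exact (congrArg (· • _) Int.negOnePow_zero).trans (one_smul _ _)
      · refine .trans ?_ (comp_braidChain_d_last hN hL hm i)
        rfl
      · refine (comp_comp_eq_zero (htf _ _)).trans (chainD_of_ne n L N' ?_).symm
        have : (j : ℕ) < m + 1 := j.2
        change m + 1 + 1 ≠ (j : ℕ)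
        omega
      · refine (comp_comp_eq_zero (comp_braidChain_d_self_eq_zero hm true ?_)).trans
          (chainD_of_ne n L N' ?_).symm <;> simp)
  exact ⟨h₃, e₁.toMor_eq.trans (e₂.trans e₃.toMor_eq)⟩

/-- Only the shift of `S` has to be adjusted: `n` and `2 * 0 + 1 + (n - 1)` are equal, but not by
definition. -/
theorem posComplex_isomorphic_braidChain :
    ∃ h : (braidChain n L 1 (n - 1)).IsComplex,
      (posComplex n L).Isomorphic ⟨braidChain n L 1 (n - 1), h⟩ := by
  refine PreComplex.isomorphic_of_bijective' (posComplex n L).isComplex _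
    (fun x => (bif x then 1 else 0 : Fin 2))
    (show Function.Bijective fun x : Bool => (bif x then 1 else 0 : Fin 2) by decide)
    (fun
      | false => Iso.refl (idObj n L [.up, .up] (n - 1))
      | true => eqToIso (congrArg (wideObj n L) (by push_cast; ring))) ?_ ?_
  · rintro (_ | _) <;> rfl
  · rintro (_ | _) (_ | _)
    · exact (Category.comp_id _).trans (Category.id_comp _).symm
    · have key : ∀ k (h : (n : ℤ) = k) h₁ h₂, chi0Hom n L (n - 1) n h₁ ≫
          eqToHom (congrArg (wideObj n L) h) = chi0Hom n L (n - 1) k h₂ := by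
        rintro _ rfl _ _
        exact Category.comp_id _
      refine (key (2 * (0 : ℕ) + 1 + (n - 1)) (by push_cast; ring) _
        (by push_cast; ring)).trans (.trans ?_ (Category.id_comp _).symm)
      exact (chainD_succ n L (n - 1) 0).symm
    · exact comp_eq_comp_zero rfl
    · exact comp_eq_comp_zero rfl

theorem Kh_twoBraid_succ (hL : coreRelations ⊆ L) (m : ℕ) :
    ∃ h : (braidChain n L (m + 1) ((n - 1) * (m + 1))).IsComplex,
      Kh n L (twoBraid (m + 1)) = FormalComplex.toMor ⟨_, h⟩ := by
  induction m with
  | zero =>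
    obtain ⟨h, e⟩ := posComplex_isomorphic_braidChain (n := n) (L := L)
    have hN : ((n : ℤ) - 1) * ((0 : ℕ) + 1) = n - 1 := by simp
    rw [hN]
    exact ⟨h, e.toMor_eq⟩
  | succ m ih =>
    obtain ⟨h, e⟩ := ih
    obtain ⟨h', e'⟩ := comp_braidChain (N' := (n - 1) * ((m + 1 : ℕ) + 1))
      (by push_cast; ring) hL h
    -- By definition `twoBraid (m + 2)` is a crossing on top of `twoBraid (m + 1)`, whose complex
    -- may be replaced by the equivalent chain before the induction step applies.
    exact ⟨h', (FormalComplex.comp_two_toMor_congr 0 _ e).trans e'⟩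

end

end KR

theorem mainTheorem1 (n : ℕ) (hn : 2 ≤ n) (L : Set KR.RelName) (hL : KR.coreRelations ⊆ L) :
    (∀ k : ℕ, ∃ h : (KR.braidChain n L (2 * k + 1) (((n : ℤ) - 1) * (2 * k + 1))).IsComplex,
      KR.Kh n L (KR.twoBraid (2 * k + 1)) = KR.FormalComplex.toMor ⟨_, h⟩) ∧
    (∀ k : ℕ, 1 ≤ k → ∃ h : (KR.braidChain n L (2 * k) (((n : ℤ) - 1) * (2 * k))).IsComplex,
      KR.Kh n L (KR.twoBraid (2 * k)) = KR.FormalComplex.toMor ⟨_, h⟩) := by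
  constructor
  · intro k
    have := KR.Kh_twoBraid_succ (n := n) hL (2 * k)
    push_cast at this
    exact this
  · rintro (_ | k) hk
    · exact absurd hk (by omega)
    · have := KR.Kh_twoBraid_succ (n := n) hL (2 * k + 1)
      have hN : ((n : ℤ) - 1) * ((2 * k + 1 : ℕ) + 1) = ((n : ℤ) - 1) * (2 * (k + 1 : ℕ)) := by
        push_cast; ring
      rw [hN] at this
      exact this
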